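/- **Setting.** Let $X$ be a set with at least two points. A *quasi-metric* on $X$ is a function $\rho:X\times X\to[0,\infty)$ with $\rho(x,y)=0\iff x=y$ for which there are constants $C_0,C_1>0$ with $\rho(y,x)\le C_0\rho(x,y)$ and $\rho(x,y)\le C_1\max\{\rho(x,z),\rho(z,y)\}$ for all $x,y,z\in X$. Put $B_\rho(x,r)=\{y:\rho(x,y)<r\}$ and let $\tau_\rho$ be the topology in which $O$ is open iff every $x\in O$ has some $r>0$ with $B_\rho(x,r)\subset O$. Let $\mu$ be a measure on a $\sigma$-algebra (whose members are called $\mu$-measurable) that contains the Borel sets of $\tau_\rho$ and all $\rho$-balls, with $0<\mu(B_\rho(x,r))<\infty$ for all $x\in X$, $r>0$. Assume that $\mu$ is *Borel regular* (every $\mu$-measurable set is contained in a Borel set of equal measure) and *$Q$-doubling* for some $Q\in(0,\infty)$: there is $\kappa>0$ with $$\kappa\Big(\frac rR\Big)^{Q}\le\frac{\mu(B_\rho(x,r))}{\mu(B_\rho(y,R))}\quad\text{whenever }0<r\le R<\infty\text{ and }B_\rho(x,r)\subset B_\rho(y,R).$$ For a quasi-metric $\varrho$ on $X$ let $C_\varrho=\sup\frac{\varrho(x,y)}{\max\{\varrho(x,z),\varrho(z,y)\}}\in[1,\infty)$,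 the supremum being over all $x,y,z\in X$ that are not all equal. Let $$\mathrm{ind}(X,\rho)=\sup_{\varrho\approx\rho}(\log_2C_\varrho)^{-1}\in(0,\infty],\qquad 0^{-1}:=\infty,$$ where $\varrho$ runs over the quasi-metrics on $X$ with $c^{-1}\varrho\le\rho\le c\varrho$ for some $c>0$. For $s\in(0,\infty)$, $q\in(0,\infty]$, write $s\preceq_q\mathrm{ind}(X,\rho)$ if $s\le\mathrm{ind}(X,\rho)$, and equality $s=\mathrm{ind}(X,\rho)$ occurs only if $q=\infty$ and the supremum defining $\mathrm{ind}(X,\rho)$ is attained. **Function spaces.** Let $Y$ be $X$, or a $\mu$-measurable subset of $X$ with the restrictions of $\rho$ and $\mu$. A *fractional $s$-gradient* of a $\mu$-measurable $u:Y\to\mathbb R$ is a sequence $\vec g=(g_k)_{k\in\mathbb Z}$ of nonnegative $\mu$-measurable functions on $Y$ for which there is a set $E\subset Y$ with $\mu(E)=0$ and $$|u(x)-u(y)|\le\rho(x,y)^s\,[g_k(x)+g_k(y)]\quad\text{for all }k\in\mathbb Z,\ x,y\in Y\setminus E\text{ with }2^{-k-1}\le\rho(x,y)<2^{-k}.$$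 For $p\in(0,\infty)$ and $q\in(0,\infty]$ let $$\|u\|_{M^s_{p,q}(Y)}=\inf_{\vec g}\big\|\,\|(g_k)_k\|_{\ell^q}\big\|_{L^p(Y,\mu)}+\|u\|_{L^p(Y,\mu)},\qquad \|u\|_{N^s_{p,q}(Y)}=\inf_{\vec g}\big\|\,(\|g_k\|_{L^p(Y,\mu)})_k\big\|_{\ell^q}+\|u\|_{L^p(Y,\mu)},$$ the infima being over all fractional $s$-gradients of $u$ ($\inf\emptyset=\infty$). $M^s_{p,q}(Y)$ and $N^s_{p,q}(Y)$ are the vector spaces of $\mu$-measurable $u:Y\to\mathbb R$ for which the respective quantity is finite. **Theorem.** In this setting let $s,p\in(0,\infty)$ and $q\in(0,\infty]$ with $s\preceq_q\mathrm{ind}(X,\rho)$, and let $\Omega\subset X$ be a nonempty $\mu$-measurable set satisfying the *measure density condition*: there is $C_\mu>0$ with $$\mu(B_\rho(x,r))\le C_\mu\,\mu(B_\rho(x,r)\cap\Omega)\quad\text{for all }x\in\Omega,\ r\in(0,1].$$ Then: 1. There is a constant $C>0$ such that for every $u\in M^s_{p,q}(\Omega)$ there is $\tilde u\in M^s_{p,q}(X)$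 with $\tilde u|_\Omega=u$ and $\|\tilde u\|_{M^s_{p,q}(X)}\le C\|u\|_{M^s_{p,q}(\Omega)}$. 2. Consequently, $M^s_{p,q}(\Omega)=\{\tilde u|_\Omega:\tilde u\in M^s_{p,q}(X)\}$. 3. If $p>Q/(Q+s)$ and $q>Q/(Q+s)$, there is a linear operator $\mathscr E:M^s_{p,q}(\Omega)\to M^s_{p,q}(X)$ that is bounded, i.e. $\|\mathscr Eu\|_{M^s_{p,q}(X)}\le C\|u\|_{M^s_{p,q}(\Omega)}$ for all $u$ with a constant $C>0$ independent of $u$, and satisfies $(\mathscr Eu)|_\Omega=u$ for all $u\in M^s_{p,q}(\Omega)$. 4. If $s<\mathrm{ind}(X,\rho)$, then 1, 2 and 3 also hold with $M^s_{p,q}$ replaced by $N^s_{p,q}$ throughout. -/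

import Mathlib

open MeasureTheory
open scoped ENNReal NNReal

noncomputable section

namespace HajlaszExt

variable {X : Type*}

/-! ### Quasi-metrics and the lower smoothness index -/

/-- A quasi-metric: nonnegative, vanishing exactly on the diagonal, quasi-symmetric, and satisfying
the quasi-ultrametric inequality. -/
structure IsQuasiMetric (ρ : X → X → ℝ) : Prop where
  nonneg : ∀ x y, 0 ≤ ρ x y
  eq_zero_iff : ∀ x y, ρ x y = 0 ↔ x = y
  quasi_symm : ∃ C₀ : ℝ, 0 < C₀ ∧ ∀ x y, ρ y x ≤ C₀ * ρ x y
  quasi_triangle : ∃ C₁ : ℝ, 0 < C₁ ∧ ∀ x y z, ρ x y ≤ C₁ * max (ρ x z) (ρ z y)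

/-- The ball `B_ρ(x,r) = {y : ρ(x,y) < r}` (the order of the arguments matters). -/
def qball (ρ : X → X → ℝ) (x : X) (r : ℝ) : Set X := {y | ρ x y < r}

/-- The topology `τ_ρ`: a set is open iff it contains a `ρ`-ball around each of its points. -/
@[reducible]
def qtopology (ρ : X → X → ℝ) : TopologicalSpace X where
  IsOpen O := ∀ x ∈ O, ∃ r : ℝ, 0 < r ∧ qball ρ x r ⊆ O
  isOpen_univ := fun _ _ => ⟨1, one_pos, Set.subset_univ _⟩
  isOpen_inter := by
    rintro O U hO hU x ⟨hxO, hxU⟩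
    obtain ⟨r, hr, hrO⟩ := hO x hxO
    obtain ⟨t, ht, htU⟩ := hU x hxU
    refine ⟨min r t, lt_min hr ht, fun y hy => ⟨hrO ?_, htU ?_⟩⟩
    · exact lt_of_lt_of_le (show ρ x y < min r t from hy) (min_le_left _ _)
    · exact lt_of_lt_of_le (show ρ x y < min r t from hy) (min_le_right _ _)
  isOpen_sUnion := by
    rintro S hS x ⟨O, hOS, hxO⟩
    obtain ⟨r, hr, hrO⟩ := hS O hOS x hxO
    exact ⟨r, hr, hrO.trans (Set.subset_sUnion_of_mem hOS)⟩

/-- `C_ρ`, the supremum of `ρ(x,y) / max {ρ(x,z), ρ(z,y)}` over `x, y, z` not all equal. -/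
def quasiConst (ρ : X → X → ℝ) : ℝ :=
  sSup {t : ℝ | ∃ x y z : X, ¬(x = y ∧ y = z) ∧ t = ρ x y / max (ρ x z) (ρ z y)}

/-- Bi-Lipschitz equivalence `ϱ ≈ ρ`. -/
def QEquiv (ϱ ρ : X → X → ℝ) : Prop :=
  ∃ c : ℝ, 0 < c ∧ ∀ x y, c⁻¹ * ϱ x y ≤ ρ x y ∧ ρ x y ≤ c * ϱ x y

/-- `(log₂ C_ϱ)⁻¹ ∈ (0,∞]`, equal to `∞` when `C_ϱ = 1`. -/
def indexValue (ϱ : X → X → ℝ) : ℝ≥0∞ :=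
  (ENNReal.ofReal (Real.logb 2 (quasiConst ϱ)))⁻¹

/-- The lower smoothness index `ind (X,ρ)`. -/
def lowerIndex (ρ : X → X → ℝ) : ℝ≥0∞ :=
  ⨆ (ϱ : X → X → ℝ) (_ : IsQuasiMetric ϱ ∧ QEquiv ϱ ρ), indexValue ϱ

/-- The supremum defining `ind (X,ρ)` is attained. -/
def IndexAttained (ρ : X → X → ℝ) : Prop :=
  ∃ ϱ : X → X → ℝ, IsQuasiMetric ϱ ∧ QEquiv ϱ ρ ∧ indexValue ϱ = lowerIndex ρ

/-- `s ≼_q ind (X,ρ)`. -/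
def SmoothnessAdmissible (s : ℝ) (q : ℝ≥0∞) (ρ : X → X → ℝ) : Prop :=
  ENNReal.ofReal s ≤ lowerIndex ρ ∧
    (ENNReal.ofReal s = lowerIndex ρ → q = ∞ ∧ IndexAttained ρ)

/-! ### Quasi-metric measure spaces -/

/-- The `μ`-measurable sets are those of the ambient σ-algebra, which contains the Borel sets of
`τ_ρ` and all `ρ`-balls; balls have positive and finite measure. -/
structure IsQuasiMetricMeasureSpace [MeasurableSpace X] (ρ : X → X → ℝ) (μ : Measure X) :
    Prop where
  quasiMetric : IsQuasiMetric ρ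
  borel_le : @borel X (qtopology ρ) ≤ ‹MeasurableSpace X›
  measurableSet_ball : ∀ x r, 0 < r → MeasurableSet (qball ρ x r)
  ball_pos : ∀ x r, 0 < r → 0 < μ (qball ρ x r)
  ball_lt_top : ∀ x r, 0 < r → μ (qball ρ x r) < ∞

/-- Every `μ`-measurable set is contained in a Borel set of equal measure. -/
def IsBorelRegular [MeasurableSpace X] (ρ : X → X → ℝ) (μ : Measure X) : Prop :=
  ∀ A : Set X, MeasurableSet A →
    ∃ B : Set X, MeasurableSet[@borel X (qtopology ρ)] B ∧ A ⊆ B ∧ μ B = μ A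

/-- The `Q`-doubling property. -/
def IsQDoubling [MeasurableSpace X] (Q : ℝ) (ρ : X → X → ℝ) (μ : Measure X) : Prop :=
  ∃ κ : ℝ, 0 < κ ∧ ∀ (x y : X) (r R : ℝ), 0 < r → r ≤ R → qball ρ x r ⊆ qball ρ y R →
    ENNReal.ofReal (κ * (r / R) ^ Q) ≤ μ (qball ρ x r) / μ (qball ρ y R)

/-- The measure density condition for `Ω ⊆ X`. -/
def MeasureDensity [MeasurableSpace X] (ρ : X → X → ℝ) (μ : Measure X) (Ω : Set X) : Prop :=
  ∃ C : ℝ, 0 < C ∧ ∀ x ∈ Ω, ∀ r : ℝ, 0 < r → r ≤ 1 →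
    μ (qball ρ x r) ≤ ENNReal.ofReal C * μ (qball ρ x r ∩ Ω)

/-- The restriction of `ρ` to a subset. -/
def subDist (ρ : X → X → ℝ) (Ω : Set X) : Ω → Ω → ℝ := fun x y => ρ x y

/-- The restriction of `μ` to a (measurable) subset, as a measure on the subtype. -/
def subMeasure [MeasurableSpace X] (μ : Measure X) (Ω : Set X) : Measure Ω :=
  μ.comap Subtype.val

/-! ### Fractional gradients and mixed norms -/

variable [MeasurableSpace X]

/-- The set of all fractional `s`-gradients of `u`. -/
def fracGradients (s : ℝ) (ρ : X → X → ℝ) (μ : Measure X) (u : X → ℝ) : Set (ℤ → X → ℝ) :=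
  {g | (∀ k, Measurable (g k)) ∧ (∀ k x, 0 ≤ g k x) ∧
    ∃ E : Set X, μ E = 0 ∧ ∀ (k : ℤ) (x y : X), x ∉ E → y ∉ E →
      (2 : ℝ) ^ (-k - 1) ≤ ρ x y → ρ x y < (2 : ℝ) ^ (-k) →
        |u x - u y| ≤ ρ x y ^ s * (g k x + g k y)}

/-- The `ℓ^q(ℤ)` (quasi-)norm of a sequence of numbers, `q ∈ (0,∞]`. -/
def seqNorm {ε : Type*} [ENorm ε] (q : ℝ≥0∞) (a : ℤ → ε) : ℝ≥0∞ := eLpNorm a q Measure.count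

/-- `‖g‖_{L^p(X, ℓ^q)}`. -/
def normLpSeq (p q : ℝ≥0∞) (μ : Measure X) (g : ℤ → X → ℝ) : ℝ≥0∞ :=
  eLpNorm (fun x => seqNorm q (fun k => g k x)) p μ

/-- `‖g‖_{ℓ^q(L^p(X))}`. -/
def normSeqLp (p q : ℝ≥0∞) (μ : Measure X) (g : ℤ → X → ℝ) : ℝ≥0∞ :=
  seqNorm q (fun k => eLpNorm (g k) p μ)

/-- The homogeneous Hajłasz–Triebel–Lizorkin (quasi-)seminorm (`∞` if there is no gradient). -/
def homNormM (s : ℝ) (p q : ℝ≥0∞) (ρ : X → X → ℝ) (μ : Measure X) (u : X → ℝ) : ℝ≥0∞ :=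
  ⨅ g ∈ fracGradients s ρ μ u, normLpSeq p q μ g

/-- The homogeneous Hajłasz–Besov (quasi-)seminorm (`∞` if there is no gradient). -/
def homNormN (s : ℝ) (p q : ℝ≥0∞) (ρ : X → X → ℝ) (μ : Measure X) (u : X → ℝ) : ℝ≥0∞ :=
  ⨅ g ∈ fracGradients s ρ μ u, normSeqLp p q μ g

/-- The (quasi-)norm of `M^s_{p,q}(X,ρ,μ)`. -/
def normM (s : ℝ) (p q : ℝ≥0∞) (ρ : X → X → ℝ) (μ : Measure X) (u : X → ℝ) : ℝ≥0∞ :=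
  homNormM s p q ρ μ u + eLpNorm u p μ

/-- The (quasi-)norm of `N^s_{p,q}(X,ρ,μ)`. -/
def normN (s : ℝ) (p q : ℝ≥0∞) (ρ : X → X → ℝ) (μ : Measure X) (u : X → ℝ) : ℝ≥0∞ :=
  homNormN s p q ρ μ u + eLpNorm u p μ

/-! ### The spaces are vector spaces -/

lemma zero_mem_fracGradients (s : ℝ) (ρ : X → X → ℝ) (μ : Measure X) :
    (0 : ℤ → X → ℝ) ∈ fracGradients s ρ μ (0 : X → ℝ) :=
  ⟨fun _ => measurable_const, fun _ _ => le_rfl, ∅, measure_empty, by simp⟩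

lemma add_mem_fracGradients {s : ℝ} {ρ : X → X → ℝ} {μ : Measure X} {u v : X → ℝ}
    {g h : ℤ → X → ℝ} (hg : g ∈ fracGradients s ρ μ u) (hh : h ∈ fracGradients s ρ μ v) :
    g + h ∈ fracGradients s ρ μ (u + v) := by
  obtain ⟨gm, g0, E, hE, gE⟩ := hg
  obtain ⟨hm, h0, F, hF, hF'⟩ := hh
  refine ⟨fun k => (gm k).add (hm k), fun k x => add_nonneg (g0 k x) (h0 k x), E ∪ F,
    measure_union_null hE hF, fun k x y hx hy h1 h2 => ?_⟩
  have a := gE k x y (fun h => hx (Or.inl h)) (fun h => hy (Or.inl h)) h1 h2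
  have b := hF' k x y (fun h => hx (Or.inr h)) (fun h => hy (Or.inr h)) h1 h2
  have c : |(u + v) x - (u + v) y| ≤ |u x - u y| + |v x - v y| := by
    have := abs_add_le (u x - u y) (v x - v y)
    simpa [add_sub_add_comm] using this
  calc |(u + v) x - (u + v) y| ≤ |u x - u y| + |v x - v y| := c
    _ ≤ _ := add_le_add a b
    _ = ρ x y ^ s * ((g + h) k x + (g + h) k y) := by simp only [Pi.add_apply]; ring

lemma smul_mem_fracGradients {s : ℝ} {ρ : X → X → ℝ} {μ : Measure X} {u : X → ℝ}
    {g : ℤ → X → ℝ} (c : ℝ) (hg : g ∈ fracGradients s ρ μ u) :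
    (fun k x => |c| * g k x) ∈ fracGradients s ρ μ (c • u) := by
  obtain ⟨gm, g0, E, hE, gE⟩ := hg
  refine ⟨fun k => (gm k).const_mul _, fun k x => mul_nonneg (abs_nonneg c) (g0 k x), E, hE,
    fun k x y hx hy h1 h2 => ?_⟩
  have a := mul_le_mul_of_nonneg_left (gE k x y hx hy h1 h2) (abs_nonneg c)
  calc |(c • u) x - (c • u) y| = |c| * |u x - u y| := by
        simp [← mul_sub, abs_mul]
    _ ≤ _ := a
    _ = _ := by ring

lemma measurable_seqNorm (q : ℝ≥0∞) {g : ℤ → X → ℝ} (hg : ∀ k, Measurable (g k)) :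
    Measurable (fun x => seqNorm q (fun k => g k x)) := by
  unfold seqNorm
  by_cases h0 : q = 0
  · simp [h0]
  by_cases ht : q = ∞
  · simp only [ht, eLpNorm_exponent_top, eLpNormEssSup_eq_essSup_enorm, essSup_count]
    exact Measurable.iSup fun k => (hg k).enorm
  · simp only [eLpNorm_eq_lintegral_rpow_enorm_toReal h0 ht, lintegral_count]
    exact (Measurable.tsum fun k => (hg k).enorm.pow_const _).pow_const _

lemma seqNorm_add_le (q : ℝ≥0∞) {ε : Type*} [TopologicalSpace ε] [ESeminormedAddMonoid ε]
    [ContinuousAdd ε] (a b : ℤ → ε) :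
    seqNorm q (a + b) ≤ ENNReal.LpAddConst q * (seqNorm q a + seqNorm q b) :=
  eLpNorm_add_le' (StronglyMeasurable.of_discrete).aestronglyMeasurable
    (StronglyMeasurable.of_discrete).aestronglyMeasurable q

lemma eLpNorm_le_const_mul {Y : Type*} [MeasurableSpace Y] {ν : Measure Y} {ε ε' : Type*}
    [TopologicalSpace ε] [ESeminormedAddMonoid ε] [TopologicalSpace ε'] [ESeminormedAddMonoid ε']
    {f : Y → ε} {g : Y → ε'} {c : ℝ≥0∞} (hc : c ≠ ∞)
    (h : ∀ y, ‖f y‖ₑ ≤ c * ‖g y‖ₑ) (p : ℝ≥0∞) : eLpNorm f p ν ≤ c * eLpNorm g p ν := by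
  lift c to ℝ≥0 using hc
  have := eLpNorm_le_nnreal_smul_eLpNorm_of_ae_le_mul' (μ := ν) (Filter.Eventually.of_forall h) p
  simpa [ENNReal.smul_def] using this

lemma normLpSeq_add_lt_top {p q : ℝ≥0∞} {μ : Measure X} {g h : ℤ → X → ℝ}
    (gm : ∀ k, Measurable (g k)) (hm : ∀ k, Measurable (h k))
    (hg : normLpSeq p q μ g < ∞) (hh : normLpSeq p q μ h < ∞) :
    normLpSeq p q μ (g + h) < ∞ := by
  have h1 : normLpSeq p q μ (g + h) ≤ ENNReal.LpAddConst q *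
      eLpNorm ((fun x => seqNorm q (fun k => g k x)) + fun x => seqNorm q (fun k => h k x)) p μ :=
    eLpNorm_le_const_mul (ENNReal.LpAddConst_lt_top q).ne
      (fun x => seqNorm_add_le q (fun k => g k x) (fun k => h k x)) p
  have h2 := eLpNorm_add_le' (μ := μ)
    (measurable_seqNorm q gm).aestronglyMeasurable
    (measurable_seqNorm q hm).aestronglyMeasurable p
  refine h1.trans_lt (ENNReal.mul_lt_top (ENNReal.LpAddConst_lt_top q) (h2.trans_lt ?_))
  exact ENNReal.mul_lt_top (ENNReal.LpAddConst_lt_top p) (ENNReal.add_lt_top.2 ⟨hg, hh⟩)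

lemma normLpSeq_smul_lt_top {p q : ℝ≥0∞} {μ : Measure X} {g : ℤ → X → ℝ} (c : ℝ)
    (hg : normLpSeq p q μ g < ∞) : normLpSeq p q μ (fun k x => |c| * g k x) < ∞ := by
  have h1 : normLpSeq p q μ (fun k x => |c| * g k x) ≤ ‖c‖ₑ * normLpSeq p q μ g :=
    eLpNorm_le_const_mul enorm_ne_top
      (fun x => eLpNorm_le_const_mul enorm_ne_top (fun k => by simp [enorm_mul]) q) p
  exact h1.trans_lt (ENNReal.mul_lt_top enorm_lt_top hg)

lemma normSeqLp_add_lt_top {p q : ℝ≥0∞} {μ : Measure X} {g h : ℤ → X → ℝ}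
    (gm : ∀ k, Measurable (g k)) (hm : ∀ k, Measurable (h k))
    (hg : normSeqLp p q μ g < ∞) (hh : normSeqLp p q μ h < ∞) :
    normSeqLp p q μ (g + h) < ∞ := by
  have h1 : normSeqLp p q μ (g + h) ≤ ENNReal.LpAddConst p *
      seqNorm q ((fun k => eLpNorm (g k) p μ) + fun k => eLpNorm (h k) p μ) :=
    eLpNorm_le_const_mul (ENNReal.LpAddConst_lt_top p).ne
      (fun k => eLpNorm_add_le' (gm k).aestronglyMeasurable (hm k).aestronglyMeasurable p) q
  refine h1.trans_lt (ENNReal.mul_lt_top (ENNReal.LpAddConst_lt_top p)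
    ((seqNorm_add_le q _ _).trans_lt ?_))
  exact ENNReal.mul_lt_top (ENNReal.LpAddConst_lt_top q) (ENNReal.add_lt_top.2 ⟨hg, hh⟩)

lemma normSeqLp_smul_lt_top {p q : ℝ≥0∞} {μ : Measure X} {g : ℤ → X → ℝ} (c : ℝ)
    (hg : normSeqLp p q μ g < ∞) : normSeqLp p q μ (fun k x => |c| * g k x) < ∞ := by
  have h1 : normSeqLp p q μ (fun k x => |c| * g k x) ≤ ‖c‖ₑ * normSeqLp p q μ g :=
    eLpNorm_le_const_mul enorm_ne_top
      (fun k => eLpNorm_le_const_mul enorm_ne_top (fun x => by simp [enorm_mul]) p) q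
  exact h1.trans_lt (ENNReal.mul_lt_top enorm_lt_top hg)

lemma eLpNorm_smul_lt_top {p : ℝ≥0∞} {μ : Measure X} {u : X → ℝ} (c : ℝ)
    (hu : eLpNorm u p μ < ∞) : eLpNorm (c • u) p μ < ∞ :=
  (eLpNorm_le_const_mul (c := ‖c‖ₑ) enorm_ne_top (fun x => by simp [enorm_mul]) p).trans_lt
    (ENNReal.mul_lt_top enorm_lt_top hu)

lemma eLpNorm_add_lt_top' {p : ℝ≥0∞} {μ : Measure X} {u v : X → ℝ} (um : Measurable u)
    (vm : Measurable v) (hu : eLpNorm u p μ < ∞) (hv : eLpNorm v p μ < ∞) :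
    eLpNorm (u + v) p μ < ∞ :=
  (eLpNorm_add_le' um.aestronglyMeasurable vm.aestronglyMeasurable p).trans_lt
    (ENNReal.mul_lt_top (ENNReal.LpAddConst_lt_top p) (ENNReal.add_lt_top.2 ⟨hu, hv⟩))

/-- The Hajłasz–Triebel–Lizorkin space `M^s_{p,q}(X,ρ,μ)`, as a vector space of `μ`-measurable
real functions. -/
def spaceM (s : ℝ) (p q : ℝ≥0∞) (ρ : X → X → ℝ) (μ : Measure X) : Submodule ℝ (X → ℝ) where
  carrier := {u | Measurable u ∧ homNormM s p q ρ μ u < ∞ ∧ eLpNorm u p μ < ∞}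
  zero_mem' := by
    refine ⟨measurable_const, ?_, by simp⟩
    refine (iInf₂_le _ (zero_mem_fracGradients s ρ μ)).trans_lt ?_
    simp [normLpSeq, seqNorm, ← Pi.zero_def]
  add_mem' := by
    rintro u v ⟨um, hu, hu'⟩ ⟨vm, hv, hv'⟩
    refine ⟨um.add vm, ?_, eLpNorm_add_lt_top' um vm hu' hv'⟩
    simp only [homNormM, iInf_lt_iff] at hu hv
    obtain ⟨g, hg, hgt⟩ := hu
    obtain ⟨h, hh, hht⟩ := hv
    exact (iInf₂_le _ (add_mem_fracGradients hg hh)).trans_lt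
      (normLpSeq_add_lt_top hg.1 hh.1 hgt hht)
  smul_mem' := by
    rintro c u ⟨um, hu, hu'⟩
    refine ⟨um.const_smul c, ?_, eLpNorm_smul_lt_top c hu'⟩
    simp only [homNormM, iInf_lt_iff] at hu
    obtain ⟨g, hg, hgt⟩ := hu
    exact (iInf₂_le _ (smul_mem_fracGradients c hg)).trans_lt (normLpSeq_smul_lt_top c hgt)

/-- The Hajłasz–Besov space `N^s_{p,q}(X,ρ,μ)`, as a vector space of `μ`-measurable real
functions. -/
def spaceN (s : ℝ) (p q : ℝ≥0∞) (ρ : X → X → ℝ) (μ : Measure X) : Submodule ℝ (X → ℝ) where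
  carrier := {u | Measurable u ∧ homNormN s p q ρ μ u < ∞ ∧ eLpNorm u p μ < ∞}
  zero_mem' := by
    refine ⟨measurable_const, ?_, by simp⟩
    refine (iInf₂_le _ (zero_mem_fracGradients s ρ μ)).trans_lt ?_
    simp [normSeqLp, seqNorm, ← Pi.zero_def]
  add_mem' := by
    rintro u v ⟨um, hu, hu'⟩ ⟨vm, hv, hv'⟩
    refine ⟨um.add vm, ?_, eLpNorm_add_lt_top' um vm hu' hv'⟩
    simp only [homNormN, iInf_lt_iff] at hu hv
    obtain ⟨g, hg, hgt⟩ := hu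
    obtain ⟨h, hh, hht⟩ := hv
    exact (iInf₂_le _ (add_mem_fracGradients hg hh)).trans_lt
      (normSeqLp_add_lt_top hg.1 hh.1 hgt hht)
  smul_mem' := by
    rintro c u ⟨um, hu, hu'⟩
    refine ⟨um.const_smul c, ?_, eLpNorm_smul_lt_top c hu'⟩
    simp only [homNormN, iInf_lt_iff] at hu
    obtain ⟨g, hg, hgt⟩ := hu
    exact (iInf₂_le _ (smul_mem_fracGradients c hg)).trans_lt (normSeqLp_smul_lt_top c hgt)

end HajlaszExt

end

open HajlaszExt

/-! The quasi-metric is traded for a metric. If `s` is admissible, some `ϱ ≈ ρ` satisfies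
`quasiConst ϱ ^ β ≤ 2` with `β ≥ s`, and Frink's chain argument makes `ρ ^ β` comparable to a
pseudometric `d`. Here `s < β`, unless `q = ∞` and the index is attained. For `d` the measure is
doubling with dimension `Q / β`, the density condition survives, and Lipschitz functions have
smoothness `β` with respect to `ρ`. Distances are then measured in powers of `b = 2 ^ β`, gradients
weighted by powers of `l = 2 ^ s`.

A fractional gradient controls one annulus at a time; a supremum over finer annuli turns it into a
ball gradient `W k`, controlling all distances below `b ^ (-k)` (`IsSnowflake.isBallGradient`).
`IsSnowflake.exists_fracGradient` goes back.

A point at distance `δ > 0` from `Ω` is assigned the reference value of a nearby member of a dense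
sequence, and the resulting step function is smoothed by a Lipschitz kernel of width `δ / 8`. This
replaces a Whitney covering and its partition of unity. The set `closure Ω \ Ω` is null by the
Lebesgue density theorem. For two points at distance below `b ^ (-k)` there are three regimes, which
are the terms of `extGrad` (`IsReference.edist_extendBy_le`). If `δ` is at most comparable to `b ^
(-k)`, averages of `W` at a comparable scale suffice. If `δ` is about `b ^ n * b ^ (-k)`, the
Lipschitz bound gains `b ^ (-n)` on averages of `W (k - N - n)`. Far from `Ω`, where reference
values are cut to `0`, the size of `u` takes over. After weighting by `l ^ k` the middle regime is a
convolution with `(l / b) ^ n`, bounded when `s < β`; for `s = β` it survives in `L^p(ℓ^∞)` only.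

All averages are power means of an exponent `t < p`, `t ≤ q` over parts of `Ω` of positive density.
The scalar maximal theorem bounds them on `L^p`, and Minkowski's inequality carries the bound to
`L^p(ℓ^q)`.

The value of `u` at a well chosen point is a reference value for all `p` and `q`, but depends
nonlinearly on `u`. The linear operator uses mean values instead. For these the mean oscillation of
`u` must be controlled by a power mean with `t < 1` (`laverage_edist_le`), a chaining argument for
gradients decaying like `θ ^ n`. Such decay can be arranged precisely when `Q / t < Q + s`, hence
the threshold `Q / (Q + s)`.

Both scales enter only through `IsMixedNorm`, so `extension_restriction` proves the two halves at
once. -/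

/-! ### Metrization of quasi-metrics -/

namespace HajlaszExt

/-- Frink's chain inequality. -/
lemma chain_le_of_le_two_mul_max {X : Type*} {f : X → X → ℝ} (h0 : ∀ x y, 0 ≤ f x y)
    (hf : ∀ x y z, f x y ≤ 2 * max (f x z) (f z y)) (x : ℕ → X) (n : ℕ) : ∀ m,
    f (x m) (x (m + n + 2)) + 2 * f (x m) (x (m + 1)) + 2 * f (x (m + n + 1)) (x (m + n + 2)) ≤
      4 * ∑ i ∈ Finset.Ico m (m + n + 2), f (x i) (x (i + 1)) := by
  induction n using Nat.strong_induction_on with | h n ih =>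
  intro m
  set F := f (x m) (x (m + n + 2)) with hF
  set P : ℕ → Prop := fun r => F ≤ 2 * f (x (m + r)) (x (m + n + 2)) with hP
  classical
  have hsum : ∀ a b, a ≤ b → 0 ≤ ∑ i ∈ Finset.Ico a b, f (x i) (x (i + 1)) :=
    fun a b _ => Finset.sum_nonneg fun i _ => h0 _ _
  have hP0 : P 0 := by
    have := h0 (x m) (x (m + n + 2))
    simp only [hP, add_zero]
    linarith
  -- The last vertex still far from the endpoint. Since the next vertex is not far from the
  -- endpoint, it must be far from the starting point.
  set r := Nat.findGreatest P (n + 1) with hr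
  have hrle : r ≤ n + 1 := Nat.findGreatest_le _
  have hPr : P r := Nat.findGreatest_spec (Nat.zero_le _) hP0
  have split1 : ∑ i ∈ Finset.Ico m (m + n + 2), f (x i) (x (i + 1)) =
      f (x m) (x (m + 1)) + ∑ i ∈ Finset.Ico (m + 1) (m + n + 1), f (x i) (x (i + 1)) +
        f (x (m + n + 1)) (x (m + n + 2)) := by
    rw [show m + n + 2 = (m + n + 1) + 1 by ring, Finset.sum_Ico_succ_top (by omega),
      Finset.sum_eq_sum_Ico_succ_bot (by omega)]
  have hmid := hsum (m + 1) (m + n + 1) (by omega)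
  rcases hrle.eq_or_lt with h | h
  · have h1 : F ≤ 2 * f (x (m + n + 1)) (x (m + n + 2)) := by
      have := hPr
      rw [h] at this
      exact this
    have h2 := h0 (x m) (x (m + 1))
    linarith
  · have hnot : ¬ P (r + 1) := Nat.findGreatest_is_greatest (lt_add_one r) (by omega)
    have hnot' : 2 * f (x (m + (r + 1))) (x (m + n + 2)) < F := not_le.1 hnot
    have hq : F ≤ 2 * f (x m) (x (m + (r + 1))) := by
      have := hf (x m) (x (m + n + 2)) (x (m + (r + 1)))
      rcases max_cases (f (x m) (x (m + (r + 1)))) (f (x (m + (r + 1))) (x (m + n + 2))) with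
        h | h
      · rw [h.1] at this; exact this
      · rw [h.1] at this; linarith
    rcases Nat.eq_zero_or_pos r with h3 | h3
    · rw [h3] at hq
      have h2 := h0 (x (m + n + 1)) (x (m + n + 2))
      simp only [zero_add] at hq
      linarith
    · obtain ⟨r', hr'⟩ : ∃ r', r = r' + 1 := ⟨r - 1, by omega⟩
      -- The two subchains overlap in the link from `m + r` to `m + r + 1`. Its double count on the
      -- right is cancelled by the end-link terms on the left, which is why these terms are part of
      -- the induction hypothesis. Averaging the two bounds on `F` removes the factor 2.
      have i1 := ih r' (by omega) m
      have i2 := ih (n - r) (by omega) (m + r)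
      rw [show m + r + (n - r) + 2 = m + n + 2 by omega,
        show m + r + (n - r) + 1 = m + n + 1 by omega] at i2
      rw [show m + r' + 2 = m + r + 1 by omega, show m + r' + 1 = m + r by omega] at i1
      have hPr' : F ≤ 2 * f (x (m + r)) (x (m + n + 2)) := hPr
      have e1 : ∑ i ∈ Finset.Ico m (m + r + 1), f (x i) (x (i + 1)) =
          ∑ i ∈ Finset.Ico m (m + r), f (x i) (x (i + 1)) + f (x (m + r)) (x (m + r + 1)) :=
        Finset.sum_Ico_succ_top (by omega) _
      have e2 := Finset.sum_Ico_consecutive (fun i => f (x i) (x (i + 1)))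
        (show m ≤ m + r by omega) (show m + r ≤ m + n + 2 by omega)
      rw [← add_assoc] at hq
      linarith

lemma exists_chain_of_list {X : Type*} (d : X → X → ℝ≥0) (l : List X) : ∀ x y : X,
    ∃ z : ℕ → X, z 0 = x ∧ z (l.length + 1) = y ∧
      (List.zipWith d (x :: l) (l ++ [y])).sum =
        ∑ i ∈ Finset.range (l.length + 1), d (z i) (z (i + 1)) := by
  induction l with
  | nil => exact fun x y => ⟨fun n => Nat.casesOn n x (fun _ => y), rfl, rfl, by simp⟩
  | cons a l ih =>
    intro x y
    obtain ⟨z, h0, h1, h2⟩ := ih a y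
    refine ⟨fun n => Nat.casesOn n x z, rfl, h1, ?_⟩
    rw [List.length_cons, Finset.sum_range_succ', ← h2]
    simp [h0, add_comm]

/-- A symmetric function with `f x y ≤ 2 max (f x z) (f z y)` is comparable to a pseudometric. -/
lemma exists_pseudoMetric {X : Type*} (f : X → X → ℝ≥0) (hself : ∀ x, f x x = 0)
    (hcomm : ∀ x y, f x y = f y x) (hf : ∀ x y z, f x y ≤ 2 * max (f x z) (f z y)) :
    ∃ I : PseudoMetricSpace X, ∀ x y, I.dist x y ≤ f x y ∧ (f x y : ℝ) ≤ 4 * I.dist x y := by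
  refine ⟨PseudoMetricSpace.ofPreNNDist f hself hcomm, fun x y =>
    ⟨PseudoMetricSpace.dist_ofPreNNDist_le f hself hcomm x y, ?_⟩⟩
  have : ((4 : ℝ≥0) : ℝ) = 4 := rfl
  rw [PseudoMetricSpace.dist_ofPreNNDist, ← this, ← NNReal.coe_mul, NNReal.mul_iInf,
    NNReal.coe_le_coe]
  refine le_ciInf fun l => ?_
  obtain ⟨z, h0, h1, h2⟩ := exists_chain_of_list f l x y
  rw [h2]
  rcases Nat.eq_zero_or_pos l.length with h | h
  · rw [h] at h1 ⊢
    simp only [zero_add, Finset.range_one, Finset.sum_singleton] at h1 ⊢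
    rw [h0, h1]
    exact le_mul_of_one_le_left (by positivity) (by norm_num)
  · have key := chain_le_of_le_two_mul_max (f := fun x y => (f x y : ℝ)) (fun _ _ => by positivity)
      (fun x y z => by exact_mod_cast hf x y z) z (l.length - 1) 0
    rw [show 0 + (l.length - 1) + 2 = l.length + 1 by omega,
      show 0 + (l.length - 1) + 1 = l.length by omega, h0, h1,
      Nat.Ico_zero_eq_range] at key
    have a1 : (0:ℝ) ≤ f x (z (0 + 1)) := by positivity
    have a2 : (0:ℝ) ≤ f (z l.length) y := by positivity
    rw [← NNReal.coe_le_coe]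
    push_cast
    linarith

/-- A real `sSup` carries information only for bounded sets; any admissible quasi-triangle constant
is a bound. -/
lemma bddAbove_quasiConst {X : Type*} {ϱ : X → X → ℝ} (h : IsQuasiMetric ϱ) :
    BddAbove {t : ℝ | ∃ x y z : X, ¬(x = y ∧ y = z) ∧ t = ϱ x y / max (ϱ x z) (ϱ z y)} := by
  obtain ⟨C, hC, hC'⟩ := h.quasi_triangle
  refine ⟨C, ?_⟩
  rintro t ⟨x, y, z, -, rfl⟩
  exact div_le_of_le_mul₀ (le_max_of_le_left (h.nonneg _ _)) hC.le (hC' x y z)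

lemma le_quasiConst_mul {X : Type*} {ϱ : X → X → ℝ} (h : IsQuasiMetric ϱ) (x y z : X) :
    ϱ x y ≤ quasiConst ϱ * max (ϱ x z) (ϱ z y) := by
  by_cases hxyz : x = y ∧ y = z
  · obtain ⟨rfl, rfl⟩ := hxyz
    simp [(h.eq_zero_iff x x).2 rfl]
  · have h1 : 0 < max (ϱ x z) (ϱ z y) := by
      by_contra hcon
      have h2 := (max_le_iff.1 (not_lt.1 hcon))
      have h3 := (h.eq_zero_iff _ _).1 (le_antisymm h2.1 (h.nonneg _ _))
      have h4 := (h.eq_zero_iff _ _).1 (le_antisymm h2.2 (h.nonneg _ _))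
      exact hxyz ⟨h3.trans h4, h4.symm⟩
    rw [← div_le_iff₀ h1]
    exact le_csSup (bddAbove_quasiConst h) ⟨x, y, z, hxyz, rfl⟩

lemma one_le_quasiConst {X : Type*} [Nontrivial X] {ϱ : X → X → ℝ} (h : IsQuasiMetric ϱ) :
    1 ≤ quasiConst ϱ := by
  obtain ⟨x, y, hxy⟩ := exists_pair_ne X
  have h1 : 0 < ϱ x y := lt_of_le_of_ne (h.nonneg _ _) fun h' => hxy ((h.eq_zero_iff _ _).1 h'.symm)
  have h2 := le_quasiConst_mul h x y y
  rw [(h.eq_zero_iff y y).2 rfl, max_eq_left h1.le] at h2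
  exact le_of_mul_le_mul_right (by linarith) h1

/-- A quasi-metric whose constant satisfies `C ^ β ≤ 2` has its `β`-th power comparable to a
pseudometric. -/
lemma exists_pseudoMetric_rpow {X : Type*} [Nontrivial X] {ϱ ρ : X → X → ℝ} (hϱ : IsQuasiMetric ϱ)
    (he : QEquiv ϱ ρ) {β : ℝ} (hβ : 0 < β) (hC : quasiConst ϱ ^ β ≤ 2) :
    ∃ (I : PseudoMetricSpace X) (c : ℝ), 1 ≤ c ∧
      ∀ x y, I.dist x y ≤ c * ρ x y ^ β ∧ ρ x y ^ β ≤ c * I.dist x y := by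
  -- Symmetrizing by the maximum does not increase the quasi-triangle constant, and the power `β`
  -- brings it down to at most 2, as the chain argument needs.
  set f : X → X → ℝ≥0 := fun x y => (max (ϱ x y) (ϱ y x)).toNNReal ^ β with hf
  have hC1 := one_le_quasiConst hϱ
  have hC0 : 0 ≤ quasiConst ϱ := zero_le_one.trans hC1
  have fcoe : ∀ x y, (f x y : ℝ) = max (ϱ x y) (ϱ y x) ^ β := fun x y => by
    simp only [hf, NNReal.coe_rpow]
    rw [Real.coe_toNNReal _ (le_max_of_le_left (hϱ.nonneg _ _))]
  obtain ⟨I, hI⟩ := exists_pseudoMetric f (fun x => by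
      simp [hf, (hϱ.eq_zero_iff x x).2 rfl, hβ.ne']) (fun x y => by simp only [hf, max_comm]) (by
    intro x y z
    rw [← NNReal.coe_le_coe]
    push_cast
    simp only [fcoe]
    have h1 : max (ϱ x y) (ϱ y x) ≤
        quasiConst ϱ * max (max (ϱ x z) (ϱ z x)) (max (ϱ z y) (ϱ y z)) := by
      refine max_le ((le_quasiConst_mul hϱ x y z).trans ?_)
        ((le_quasiConst_mul hϱ y x z).trans ?_)
      · exact mul_le_mul_of_nonneg_left (max_le_max (le_max_left _ _) (le_max_left _ _)) hC0
      · exact mul_le_mul_of_nonneg_left (max_le (le_max_of_le_right (le_max_right _ _))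
          (le_max_of_le_left (le_max_right _ _))) hC0
    have h0 : ∀ x y, 0 ≤ max (ϱ x y) (ϱ y x) := fun x y => le_max_of_le_left (hϱ.nonneg _ _)
    calc max (ϱ x y) (ϱ y x) ^ β
        ≤ (quasiConst ϱ * max (max (ϱ x z) (ϱ z x)) (max (ϱ z y) (ϱ y z))) ^ β :=
          Real.rpow_le_rpow (h0 _ _) h1 hβ.le
      _ = quasiConst ϱ ^ β * (max (max (ϱ x z) (ϱ z x)) (max (ϱ z y) (ϱ y z))) ^ β :=
          Real.mul_rpow hC0 (le_max_of_le_left (h0 _ _))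
      _ ≤ 2 * (max (max (ϱ x z) (ϱ z x)) (max (ϱ z y) (ϱ y z))) ^ β := by
          gcongr
          exact Real.rpow_nonneg (le_max_of_le_left (h0 _ _)) _
      _ = _ := by
          rw [(Real.monotoneOn_rpow_Ici_of_exponent_nonneg hβ.le).map_max (h0 _ _) (h0 _ _)])
  obtain ⟨C₀, hC₀, hsym⟩ := hϱ.quasi_symm
  obtain ⟨c, hc, hcc⟩ := he
  have hdist : ∀ x y, 0 ≤ I.dist x y := fun x y => @dist_nonneg X I x y
  set A : ℝ := max 1 C₀ * c with hA
  have hA0 : 0 < A := by positivity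
  refine ⟨I, max 1 (max (A ^ β) (4 * c ^ β)), le_max_left _ _, fun x y => ⟨?_, ?_⟩⟩
  · have h1 : max (ϱ x y) (ϱ y x) ≤ A * ρ x y := by
      have h2 : ϱ x y ≤ c * ρ x y := by
        have := (hcc x y).1
        rwa [inv_mul_le_iff₀ hc] at this
      have h3 : max (ϱ x y) (ϱ y x) ≤ max 1 C₀ * ϱ x y := by
        refine max_le (le_mul_of_one_le_left (hϱ.nonneg _ _) (le_max_left _ _))
          ((hsym x y).trans ?_)
        gcongr
        · exact hϱ.nonneg _ _
        · exact le_max_right _ _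
      rw [hA, mul_assoc]
      exact h3.trans (by gcongr)
    have hρ : 0 ≤ ρ x y := by
      have := (mul_nonneg (inv_nonneg.2 hc.le) (hϱ.nonneg x y)).trans (hcc x y).1
      exact this
    calc I.dist x y ≤ f x y := (hI x y).1
      _ = max (ϱ x y) (ϱ y x) ^ β := fcoe x y
      _ ≤ (A * ρ x y) ^ β :=
        Real.rpow_le_rpow (le_max_of_le_left (hϱ.nonneg _ _)) h1 hβ.le
      _ = A ^ β * ρ x y ^ β := Real.mul_rpow hA0.le hρ
      _ ≤ _ := by
        gcongr
        exact (le_max_left _ _).trans (le_max_right _ _)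
  · have hρ : 0 ≤ ρ x y := by
      have := (mul_nonneg (inv_nonneg.2 hc.le) (hϱ.nonneg x y)).trans (hcc x y).1
      exact this
    calc ρ x y ^ β ≤ (c * max (ϱ x y) (ϱ y x)) ^ β := by
          refine Real.rpow_le_rpow hρ ((hcc x y).2.trans ?_) hβ.le
          gcongr
          exact le_max_left _ _
      _ = c ^ β * f x y := by
          rw [Real.mul_rpow hc.le (le_max_of_le_left (hϱ.nonneg _ _)), fcoe]
      _ ≤ c ^ β * (4 * I.dist x y) := by
          gcongr
          exact (hI x y).2
      _ = 4 * c ^ β * I.dist x y := by ring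
      _ ≤ _ := by
        have := hdist x y
        gcongr
        exact (le_max_right _ _).trans (le_max_right _ _)

/-- Admissible smoothness: an exponent `β ≥ s`, strictly larger below the index. -/
lemma SmoothnessAdmissible.exists_rpow {X : Type*} [Nontrivial X] {ρ : X → X → ℝ} {s : ℝ}
    (hs : 0 < s) {q : ℝ≥0∞} (h : SmoothnessAdmissible s q ρ) :
    ∃ (ϱ : X → X → ℝ) (β : ℝ), IsQuasiMetric ϱ ∧ QEquiv ϱ ρ ∧ 0 < β ∧ quasiConst ϱ ^ β ≤ 2 ∧
      s ≤ β ∧ (ENNReal.ofReal s < lowerIndex ρ → s < β) ∧ (s = β → q = ∞) := by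
  have key : ∀ (ϱ : X → X → ℝ) (β : ℝ), IsQuasiMetric ϱ → 0 < β →
      β * Real.logb 2 (quasiConst ϱ) ≤ 1 → quasiConst ϱ ^ β ≤ 2 := by
    intro ϱ β hϱ hβ hL
    have hC : 0 < quasiConst ϱ := zero_lt_one.trans_le (one_le_quasiConst hϱ)
    have := Real.rpow_le_rpow_of_exponent_le (x := 2) one_le_two hL
    rwa [Real.rpow_one, mul_comm, Real.rpow_mul zero_le_two,
      Real.rpow_logb two_pos (by norm_num) hC]
      at this
  have hL0 : ∀ ϱ : X → X → ℝ, IsQuasiMetric ϱ → 0 ≤ Real.logb 2 (quasiConst ϱ) := fun ϱ hϱ =>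
    Real.logb_nonneg one_lt_two (one_le_quasiConst hϱ)
  rcases h.1.lt_or_eq with hlt | heq
  · obtain ⟨ϱ, hϱ, hlt'⟩ : ∃ ϱ, ∃ _ : IsQuasiMetric ϱ ∧ QEquiv ϱ ρ,
        ENNReal.ofReal s < indexValue ϱ := by
      unfold lowerIndex at hlt
      simpa only [lt_iSup_iff] using hlt
    have hβ : ∃ β, s < β ∧ β * Real.logb 2 (quasiConst ϱ) ≤ 1 := by
      -- If the constant is 1, every exponent is allowed and `s + 1` is taken. Otherwise the
      -- exponent with `quasiConst ϱ ^ β = 2` is the index value itself.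
      rcases (hL0 ϱ hϱ.1).eq_or_lt with h0 | h0
      · exact ⟨s + 1, by linarith, by rw [← h0]; simp⟩
      · refine ⟨(Real.logb 2 (quasiConst ϱ))⁻¹, ?_, by rw [inv_mul_cancel₀ h0.ne']⟩
        unfold indexValue at hlt'
        rw [← ENNReal.ofReal_inv_of_pos h0] at hlt'
        exact (ENNReal.ofReal_lt_ofReal_iff (by positivity)).1 hlt'
    obtain ⟨β, hsβ, hβ⟩ := hβ
    exact ⟨ϱ, β, hϱ.1, hϱ.2, hs.trans hsβ, key _ _ hϱ.1 (hs.trans hsβ) hβ, hsβ.le, fun _ => hsβ,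
      fun h => absurd h hsβ.ne⟩
  · obtain ⟨hq, ϱ, hϱ, he, hi⟩ := h.2 heq
    -- At the endpoint nothing can be gained: `β = s`, realized by the quasi-metric attaining the
    -- index.
    refine ⟨ϱ, s, hϱ, he, hs, key _ _ hϱ hs ?_, le_rfl, fun h => absurd heq h.ne, fun _ => hq⟩
    rw [← heq] at hi
    unfold indexValue at hi
    rcases (hL0 ϱ hϱ).eq_or_lt with h0 | h0
    · rw [← h0]; simp
    · rw [← ENNReal.ofReal_inv_of_pos h0, ENNReal.ofReal_eq_ofReal_iff (by positivity) hs.le] at hi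
      rw [← hi, inv_mul_cancel₀ h0.ne']

end HajlaszExt

/-! ### Doubling measures on pseudometric spaces and the maximal theorem -/

namespace HajlaszExt

open Metric

/-- Balls have positive finite measure, which grows at most like the `D`-th power of the radius. -/
structure IsDoublingSpace {X : Type*} [PseudoMetricSpace X] [MeasurableSpace X]
    (μ : Measure X) (C D : ℝ) : Prop where
  const_pos : 0 < C
  dim_pos : 0 < D
  ball_pos : ∀ x r, 0 < r → 0 < μ (ball x r)
  ball_lt_top : ∀ x r, μ (ball x r) < ∞
  doubling : ∀ x r R, 0 < r → r ≤ R →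
    μ (ball x R) ≤ ENNReal.ofReal (C * (R / r) ^ D) * μ (ball x r)

namespace IsDoublingSpace

variable {X : Type*} [PseudoMetricSpace X] [MeasurableSpace X]
  {μ : Measure X} {C D : ℝ}

lemma ball_le_ball (h : IsDoublingSpace μ C D) {x y : X} {r R L : ℝ} (hr : 0 < r) (hL : 1 ≤ L)
    (hR : dist x y + R ≤ L * r) : μ (ball x R) ≤ ENNReal.ofReal (C * L ^ D) * μ (ball y r) := by
  have h1 := h.doubling y r (L * r) hr (le_mul_of_one_le_left hr.le hL)
  rw [mul_div_cancel_right₀ _ hr.ne'] at h1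
  refine (measure_mono fun z hz => ?_).trans h1
  rw [mem_ball] at hz ⊢
  linarith [dist_triangle z x y]

lemma sigmaFinite (h : IsDoublingSpace μ C D) : SigmaFinite μ := by
  rcases isEmpty_or_nonempty X with hX | ⟨⟨x⟩⟩
  · have : μ = 0 := Measure.eq_zero_of_isEmpty μ
    rw [this]; infer_instance
  · exact ⟨⟨⟨fun n => ball x n, fun _ => trivial, fun n => h.ball_lt_top x n,
      iUnion_ball_nat x⟩⟩⟩

/-- Disjoint balls of radius `ε / 4` have positive measure, so a σ-finite measure admits only
countably many of them; the centres of a Vitali family are `ε`-dense. -/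
lemma secondCountable [OpensMeasurableSpace X] (h : IsDoublingSpace μ C D) :
    SecondCountableTopology X := by
  have := h.sigmaFinite
  refine secondCountable_of_almost_dense_set fun ε hε => ?_
  obtain ⟨u, -, hu, hcov⟩ := Vitali.exists_disjoint_subfamily_covering_enlargement_ball
    (Set.univ : Set X) id (fun _ => ε / 4) (ε / 4) (fun _ _ => le_rfl) 4 (by norm_num)
  refine ⟨u, ?_, fun x => ?_⟩
  · have := Measure.countable_meas_pos_of_disjoint_iUnion (μ := μ)
      (As := fun a : u => ball (a : X) (ε / 4)) (fun _ => isOpen_ball.measurableSet)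
      (fun a b hab => hu a.2 b.2 fun h => hab (Subtype.ext h))
    have h2 : {i : u | 0 < μ (ball (i : X) (ε / 4))} = Set.univ :=
      Set.eq_univ_of_forall fun i => h.ball_pos _ _ (by positivity)
    rw [h2] at this
    exact Set.countable_coe_iff.1 (Set.countable_univ_iff.1 this)
  · obtain ⟨y, hy, hxy⟩ := hcov x trivial
    refine ⟨y, hy, ?_⟩
    have := hxy (mem_ball_self (x := x) (by positivity))
    rw [mem_ball] at this
    simp only [id] at this
    linarith

end IsDoublingSpace

/-! ### The maximal function of a countable family of balls: weak type bound and strong type bound.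
-/

section Maximal

variable {X : Type*} [PseudoMetricSpace X] [MeasurableSpace X]

/-- The maximal function over a countable family of balls. -/
noncomputable def maxFn (μ : Measure X) (c : ℕ → X) (r : ℕ → ℝ) (I : Set ℕ) (f : X → ℝ≥0∞)
    (x : X) : ℝ≥0∞ :=
  ⨆ i ∈ I, (ball (c i) (r i)).indicator (fun _ => ⨍⁻ y in ball (c i) (r i), f y ∂μ) x

lemma lt_maxFn_iff {μ : Measure X} {c : ℕ → X} {r : ℕ → ℝ} {I : Set ℕ} {f : X → ℝ≥0∞} {x : X}
    {l : ℝ≥0∞} : l < maxFn μ c r I f x ↔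
      ∃ i ∈ I, x ∈ ball (c i) (r i) ∧ l < ⨍⁻ y in ball (c i) (r i), f y ∂μ := by
  unfold maxFn
  simp only [lt_iSup_iff, exists_prop]
  refine exists_congr fun i => and_congr_right fun _ => ?_
  by_cases hx : x ∈ ball (c i) (r i) <;> simp [hx]

lemma le_maxFn {μ : Measure X} {c : ℕ → X} {r : ℕ → ℝ} {I : Set ℕ} {f : X → ℝ≥0∞} {x : X}
    {i : ℕ} (hi : i ∈ I) (hx : x ∈ ball (c i) (r i)) :
    ⨍⁻ y in ball (c i) (r i), f y ∂μ ≤ maxFn μ c r I f x := by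
  refine le_iSup₂_of_le i hi ?_
  rw [Set.indicator_of_mem hx]

variable [OpensMeasurableSpace X]

lemma measurable_maxFn (μ : Measure X) (c : ℕ → X) (r : ℕ → ℝ) (I : Set ℕ) (f : X → ℝ≥0∞) :
    Measurable (maxFn μ c r I f) :=
  Measurable.iSup fun _ => Measurable.iSup fun _ =>
    measurable_const.indicator isOpen_ball.measurableSet

/-- Weak type `(1,1)` bound for the maximal function. -/
lemma IsDoublingSpace.measure_lt_maxFn {μ : Measure X} {C D : ℝ} (h : IsDoublingSpace μ C D)
    {c : ℕ → X} {r : ℕ → ℝ} {I : Set ℕ} {R : ℝ} (hI : ∀ i ∈ I, 0 < r i ∧ r i ≤ R)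
    (f : X → ℝ≥0∞) (l : ℝ≥0∞) :
    l * μ {x | l < maxFn μ c r I f x} ≤ ENNReal.ofReal (C * 4 ^ D) * ∫⁻ x, f x ∂μ := by
  set t : Set ℕ := {i ∈ I | l < ⨍⁻ y in ball (c i) (r i), f y ∂μ} with ht
  -- The common bound `R` on the radii permits Vitali selection: the disjoint selected balls,
  -- enlarged four times, cover the superlevel set.
  obtain ⟨u, hut, hu, hcov⟩ := Vitali.exists_disjoint_subfamily_covering_enlargement_ball
    t c r R (fun i hi => (hI i hi.1).2) 4 (by norm_num)
  have hsub : {x | l < maxFn μ c r I f x} ⊆ ⋃ i ∈ u, ball (c i) (4 * r i) := by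
    intro x hx
    obtain ⟨i, hi, hxi, hl⟩ := lt_maxFn_iff.1 hx
    obtain ⟨j, hj, hij⟩ := hcov i ⟨hi, hl⟩
    exact Set.mem_biUnion hj (hij hxi)
  have hbound : ∀ i ∈ u, l * μ (ball (c i) (4 * r i)) ≤
      ENNReal.ofReal (C * 4 ^ D) * ∫⁻ y in ball (c i) (r i), f y ∂μ := by
    intro i hi
    obtain ⟨hiI, hl⟩ := hut hi
    have hr := (hI i hiI).1
    have h1 : μ (ball (c i) (4 * r i)) ≤ ENNReal.ofReal (C * 4 ^ D) * μ (ball (c i) (r i)) :=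
      h.ball_le_ball hr (by norm_num) (by simp)
    have h2 : l * μ (ball (c i) (r i)) ≤ ∫⁻ y in ball (c i) (r i), f y ∂μ := by
      rw [← measure_mul_setLAverage f (h.ball_lt_top _ _).ne, mul_comm]
      gcongr
    calc l * μ (ball (c i) (4 * r i))
        ≤ l * (ENNReal.ofReal (C * 4 ^ D) * μ (ball (c i) (r i))) := by
          gcongr
      _ = ENNReal.ofReal (C * 4 ^ D) * (l * μ (ball (c i) (r i))) := by ring
      _ ≤ _ := by gcongr
  calc l * μ {x | l < maxFn μ c r I f x} ≤ l * ∑' i : u, μ (ball (c i) (4 * r i)) := by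
        gcongr
        exact (measure_mono hsub).trans (measure_biUnion_le μ u.to_countable _)
    _ = ∑' i : u, l * μ (ball (c i) (4 * r i)) := ENNReal.tsum_mul_left.symm
    _ ≤ ∑' i : u, ENNReal.ofReal (C * 4 ^ D) * ∫⁻ y in ball (c i) (r i), f y ∂μ :=
        ENNReal.tsum_le_tsum fun i => hbound i i.2
    _ = ENNReal.ofReal (C * 4 ^ D) * ∫⁻ y in ⋃ i ∈ u, ball (c i) (r i), f y ∂μ := by
        rw [ENNReal.tsum_mul_left, lintegral_biUnion u.to_countable
          (fun i _ => isOpen_ball.measurableSet) hu]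
    _ ≤ _ := by
        gcongr
        exact Measure.restrict_le_self

/-- A dyadic layer-cake bound: if `2 ^ n < a ≤ 2 ^ (n + 1)`, the single term `j = n - 1` dominates.
The threshold is `j + 1` because the maximal function will be tested at twice the truncation height
`2 ^ j` of `f`. -/
lemma rpow_le_tsum_two_zpow (a : ℝ≥0∞) {τ : ℝ} (hτ : 0 < τ) :
    a ^ τ ≤ ∑' j : ℤ, if (2 : ℝ≥0∞) ^ (j + 1) < a then ((2 : ℝ≥0∞) ^ (j + 2)) ^ τ else 0 := by
  rcases eq_or_ne a 0 with rfl | h0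
  · simp [hτ]
  rcases eq_or_ne a ∞ with rfl | ht
  · suffices h : ∑' j : ℤ, (if (2 : ℝ≥0∞) ^ (j + 1) < ∞ then ((2 : ℝ≥0∞) ^ (j + 2)) ^ τ else 0) = ∞
      by rw [h]; exact le_top
    refine eq_top_iff.2 ?_
    refine le_trans (ENNReal.tsum_const_eq_top_of_ne_zero (α := ℕ) one_ne_zero).ge ?_
    refine le_trans (ENNReal.tsum_le_tsum fun n => ?_)
      (ENNReal.tsum_comp_le_tsum_of_injective (f := fun n : ℕ => (n : ℤ)) Nat.cast_injective _)
    rw [if_pos (ENNReal.zpow_lt_top (by norm_num) (by norm_num) _)]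
    refine ENNReal.one_le_rpow ?_ hτ
    have : (2 : ℝ≥0∞) ^ ((n : ℤ) + 2) = 2 ^ (n + 2) := by
      rw [← zpow_natCast]; norm_cast
    rw [this]
    exact one_le_pow₀ (by norm_num)
  · obtain ⟨n, hn⟩ := ENNReal.exists_mem_Ioc_zpow h0 ht ENNReal.one_lt_two (by norm_num)
    refine le_trans ?_ (ENNReal.le_tsum (n - 1))
    rw [if_pos (by rw [sub_add_cancel]; exact hn.1), show n - 1 + 2 = n + 1 by ring]
    exact ENNReal.rpow_le_rpow hn.2 hτ.le

/-- The terms grow like `2 ^ (j * (τ - 1))`, so for `τ > 1` the sum over `2 ^ j < a` is comparable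
to its largest term. This resums the levels once the weak type bound has been applied at each of
them. -/
lemma mul_tsum_two_zpow_le {τ : ℝ} (hτ : 1 < τ) : ∃ K : ℝ≥0∞, K ≠ ∞ ∧ ∀ a : ℝ≥0∞,
    a * ∑' j : ℤ, (if (2 : ℝ≥0∞) ^ j < a then
      ((2 : ℝ≥0∞) ^ (j + 2)) ^ τ * ((2 : ℝ≥0∞) ^ j)⁻¹ else 0) ≤
      K * a ^ τ := by
  have h20 : (2 : ℝ≥0∞) ≠ 0 := by norm_num
  have h2t : (2 : ℝ≥0∞) ≠ ∞ := by norm_num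
  set x : ℝ≥0∞ := 2 ^ (-(τ - 1)) with hx
  have hx1 : x < 1 := by
    rw [hx]
    exact ENNReal.rpow_lt_one_of_one_lt_of_neg (by norm_num) (by linarith)
  have ht0 : (2 : ℝ≥0∞) ^ (2 * τ) ≠ 0 := by positivity
  have htt : (2 : ℝ≥0∞) ^ (2 * τ) ≠ ∞ := ENNReal.rpow_ne_top_of_nonneg (by linarith) h2t
  refine ⟨2 ^ (2 * τ) * (1 - x)⁻¹, ENNReal.mul_ne_top htt
    (ENNReal.inv_ne_top.2 (tsub_pos_iff_lt.2 hx1).ne'), fun a => ?_⟩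
  rcases eq_or_ne a 0 with rfl | h0
  · simp
  rcases eq_or_ne a ∞ with rfl | ht
  · rw [ENNReal.top_rpow_of_pos (by linarith), ENNReal.mul_top]
    · exact le_top
    · refine mul_ne_zero ht0 (ENNReal.inv_ne_zero.2 (ne_top_of_le_ne_top ENNReal.one_ne_top
        tsub_le_self))
  obtain ⟨n, hn⟩ := ENNReal.exists_mem_Ioc_zpow h0 ht ENNReal.one_lt_two h2t
  have hterm : ∀ j : ℤ, ((2 : ℝ≥0∞) ^ (j + 2)) ^ τ * ((2 : ℝ≥0∞) ^ j)⁻¹ =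
      2 ^ (2 * τ) * 2 ^ ((j : ℝ) * (τ - 1)) := by
    intro j
    rw [← ENNReal.rpow_intCast, ← ENNReal.rpow_intCast, ← ENNReal.rpow_mul, ← ENNReal.rpow_neg,
      ← ENNReal.rpow_add _ _ h20 h2t, ← ENNReal.rpow_add _ _ h20 h2t]
    congr 1
    push_cast
    ring
  set F : ℤ → ℝ≥0∞ := fun j => if (2 : ℝ≥0∞) ^ j < a then
    ((2 : ℝ≥0∞) ^ (j + 2)) ^ τ * ((2 : ℝ≥0∞) ^ j)⁻¹ else 0 with hF
  have hinj : Function.Injective (fun m : ℕ => n - (m : ℤ)) := fun a b h => by simpa using h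
  have hsupp : Function.support F ⊆ Set.range (fun m : ℕ => n - (m : ℤ)) := by
    intro j hj
    have hja : (2 : ℝ≥0∞) ^ j < a := by
      by_contra hc
      exact hj (if_neg hc)
    have hjn : j ≤ n := by
      by_contra hc
      have : (2 : ℝ≥0∞) ^ (n + 1) ≤ 2 ^ j := ENNReal.zpow_le_of_le (by norm_num) (by omega)
      exact absurd (hja.trans_le (hn.2.trans this)) (lt_irrefl _)
    exact ⟨(n - j).toNat, by simp [Int.toNat_of_nonneg (sub_nonneg.2 hjn)]⟩
  have hsum : ∑' j, F j ≤ 2 ^ (2 * τ) * (1 - x)⁻¹ * 2 ^ ((n : ℝ) * (τ - 1)) := by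
    rw [← hinj.tsum_eq hsupp, mul_assoc, mul_comm (1 - x)⁻¹, ← mul_assoc, ← ENNReal.tsum_geometric,
      ← ENNReal.tsum_mul_left]
    refine ENNReal.tsum_le_tsum fun m => ?_
    have h1 : F (n - (m : ℤ)) ≤
        ((2 : ℝ≥0∞) ^ (n - (m : ℤ) + 2)) ^ τ * ((2 : ℝ≥0∞) ^ (n - (m : ℤ)))⁻¹ := by
      simp only [hF]
      split_ifs
      · exact le_rfl
      · exact zero_le
    refine h1.trans (le_of_eq ?_)
    rw [hterm, mul_assoc, hx, ← ENNReal.rpow_natCast, ← ENNReal.rpow_mul,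
      ← ENNReal.rpow_add ((n : ℝ) * (τ - 1)) _ h20 h2t]
    congr 2
    push_cast
    ring
  have hn' : (2 : ℝ≥0∞) ^ ((n : ℝ) * (τ - 1)) ≤ a ^ (τ - 1) := by
    rw [ENNReal.rpow_mul, ENNReal.rpow_intCast]
    exact ENNReal.rpow_le_rpow hn.1.le (by linarith)
  calc a * ∑' j, F j ≤ a * (2 ^ (2 * τ) * (1 - x)⁻¹ * a ^ (τ - 1)) := by
        gcongr
        exact hsum.trans (by gcongr)
    _ = 2 ^ (2 * τ) * (1 - x)⁻¹ * (a ^ (1:ℝ) * a ^ (τ - 1)) := by rw [ENNReal.rpow_one]; ring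
    _ = _ := by
        rw [← ENNReal.rpow_add _ _ h0 ht]
        congr 2
        ring

/-- The Hardy–Littlewood maximal theorem. -/
lemma IsDoublingSpace.exists_lintegral_maxFn_le {μ : Measure X} {C D : ℝ}
    (h : IsDoublingSpace μ C D) {τ : ℝ} (hτ : 1 < τ) : ∃ K : ℝ≥0∞, K ≠ ∞ ∧
    ∀ (c : ℕ → X) (r : ℕ → ℝ) (I : Set ℕ) (R : ℝ), (∀ i ∈ I, 0 < r i ∧ r i ≤ R) →
      ∀ f : X → ℝ≥0∞, Measurable f →
        ∫⁻ x, maxFn μ c r I f x ^ τ ∂μ ≤ K * ∫⁻ x, f x ^ τ ∂μ := by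
  obtain ⟨K, hK, hK'⟩ := mul_tsum_two_zpow_le hτ
  set A := ENNReal.ofReal (C * 4 ^ D) with hA
  refine ⟨A * K, ENNReal.mul_ne_top ENNReal.ofReal_ne_top hK, fun c r I R hI f hf => ?_⟩
  have hz0 : ∀ j : ℤ, (2 : ℝ≥0∞) ^ j ≠ 0 := fun j =>
    (ENNReal.zpow_pos (by norm_num) (by norm_num) j).ne'
  have hzt : ∀ j : ℤ, (2 : ℝ≥0∞) ^ j ≠ ∞ := fun j =>
    (ENNReal.zpow_lt_top (by norm_num) (by norm_num) j).ne
  have hms : ∀ j : ℤ, MeasurableSet {x | (2 : ℝ≥0∞) ^ j < f x} := fun j =>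
    measurableSet_lt measurable_const hf
  -- The part of `f` below `2 ^ j` contributes at most `2 ^ j` to any average, so an average above
  -- `2 ^ (j + 1)` leaves more than `2 ^ j` to the part of `f` above that height.
  have hsub : ∀ j : ℤ, {x | (2 : ℝ≥0∞) ^ (j + 1) < maxFn μ c r I f x} ⊆
      {x | (2 : ℝ≥0∞) ^ j < maxFn μ c r I ({x | (2 : ℝ≥0∞) ^ j < f x}.indicator f) x} := by
    intro j x hx
    obtain ⟨i, hi, hxi, hl⟩ := lt_maxFn_iff.1 hx
    refine lt_maxFn_iff.2 ⟨i, hi, hxi, ?_⟩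
    by_contra hcon
    have hpos := (h.ball_pos (c i) (r i) (hI i hi).1).ne'
    have hfin := (h.ball_lt_top (c i) (r i)).ne
    have h1 : ⨍⁻ y in ball (c i) (r i), f y ∂μ ≤
        ⨍⁻ y in ball (c i) (r i), {x | (2 : ℝ≥0∞) ^ j < f x}.indicator f y ∂μ + 2 ^ j := by
      refine le_trans ?_ (add_le_add_right (setLAverage_const hpos hfin ((2 : ℝ≥0∞) ^ j)).le _)
      rw [setLAverage_eq, setLAverage_eq,
        setLAverage_eq, ← ENNReal.add_div, ← lintegral_add_right _ measurable_const]
      gcongr with y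
      by_cases hy : (2 : ℝ≥0∞) ^ j < f y
      · rw [Set.indicator_of_mem (show y ∈ {x | (2 : ℝ≥0∞) ^ j < f x} from hy)]
        exact le_self_add
      · exact (not_lt.1 hy).trans le_add_self
    have h2 : (2 : ℝ≥0∞) ^ (j + 1) = 2 ^ j + 2 ^ j := by
      rw [ENNReal.zpow_add (by norm_num) (by norm_num), zpow_one, mul_two]
    rw [h2] at hl
    exact absurd (hl.trans_le (h1.trans (add_le_add_left (not_lt.1 hcon) _))) (lt_irrefl _)
  have hmeas : ∀ j : ℤ, μ {x | (2 : ℝ≥0∞) ^ (j + 1) < maxFn μ c r I f x} ≤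
      A * ∫⁻ x, ((2 : ℝ≥0∞) ^ j)⁻¹ * {x | (2 : ℝ≥0∞) ^ j < f x}.indicator f x ∂μ := by
    intro j
    have := h.measure_lt_maxFn (c := c) hI ({x | (2 : ℝ≥0∞) ^ j < f x}.indicator f) ((2 : ℝ≥0∞) ^ j)
    rw [lintegral_const_mul _ (hf.indicator (hms j)), mul_left_comm,
      ← ENNReal.mul_le_iff_le_inv (hz0 j) (hzt j)]
    exact (mul_le_mul' le_rfl (measure_mono (hsub j))).trans this
  calc ∫⁻ x, maxFn μ c r I f x ^ τ ∂μ
      ≤ ∫⁻ x, ∑' j : ℤ, (if (2 : ℝ≥0∞) ^ (j + 1) < maxFn μ c r I f x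
          then ((2 : ℝ≥0∞) ^ (j + 2)) ^ τ else 0) ∂μ :=
        lintegral_mono fun x => rpow_le_tsum_two_zpow _ (by linarith)
    _ = ∑' j : ℤ, ((2 : ℝ≥0∞) ^ (j + 2)) ^ τ *
          μ {x | (2 : ℝ≥0∞) ^ (j + 1) < maxFn μ c r I f x} := by
        have hm : ∀ j : ℤ, MeasurableSet {x | (2 : ℝ≥0∞) ^ (j + 1) < maxFn μ c r I f x} :=
          fun j => measurableSet_lt measurable_const (measurable_maxFn μ c r I f)
        rw [lintegral_tsum fun j => (Measurable.ite (hm j) measurable_const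
          measurable_const).aemeasurable]
        refine tsum_congr fun j => ?_
        rw [← lintegral_indicator_const (hm j)]
        refine lintegral_congr fun x => ?_
        by_cases hx : (2 : ℝ≥0∞) ^ (j + 1) < maxFn μ c r I f x <;> simp [hx]
    _ ≤ ∑' j : ℤ, ((2 : ℝ≥0∞) ^ (j + 2)) ^ τ *
          (A * ∫⁻ x, ((2 : ℝ≥0∞) ^ j)⁻¹ * {x | (2 : ℝ≥0∞) ^ j < f x}.indicator f x ∂μ) := by
        gcongr with j
        exact hmeas j
    _ = A * ∫⁻ x, f x * ∑' j : ℤ, (if (2 : ℝ≥0∞) ^ j < f x then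
          ((2 : ℝ≥0∞) ^ (j + 2)) ^ τ * ((2 : ℝ≥0∞) ^ j)⁻¹ else 0) ∂μ := by
        simp_rw [← ENNReal.tsum_mul_left]
        have hm : ∀ j : ℤ, AEMeasurable (fun x => f x * if (2 : ℝ≥0∞) ^ j < f x then
            ((2 : ℝ≥0∞) ^ (j + 2)) ^ τ * ((2 : ℝ≥0∞) ^ j)⁻¹ else 0) μ := fun j =>
          (hf.mul (Measurable.ite (hms j) measurable_const measurable_const)).aemeasurable
        rw [lintegral_tsum hm, ← ENNReal.tsum_mul_left]
        refine tsum_congr fun j => ?_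
        rw [mul_left_comm, ← lintegral_const_mul _ ((hf.indicator (hms j)).const_mul _)]
        congr 2
        ext x
        by_cases hx : (2 : ℝ≥0∞) ^ j < f x
        · rw [if_pos hx, Set.indicator_of_mem (show x ∈ {x | (2 : ℝ≥0∞) ^ j < f x} from hx)]
          ring
        · rw [if_neg hx, Set.indicator_of_notMem (show x ∉ {x | (2 : ℝ≥0∞) ^ j < f x} from hx)]
          simp
    _ ≤ A * ∫⁻ x, K * f x ^ τ ∂μ := by
        gcongr A * ?_
        exact lintegral_mono fun x => hK' (f x)
    _ = _ := by rw [lintegral_const_mul _ (hf.pow_const _), mul_assoc]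

end Maximal

end HajlaszExt

/-! ### Mixed norms of sequences of `[0,∞]`-valued functions -/

namespace HajlaszExt

lemma le_rpow_one_div_iff {x y : ℝ≥0∞} {z : ℝ} (hz : 0 < z) : x ≤ y ^ (1 / z) ↔ x ^ z ≤ y := by
  rw [one_div, ENNReal.le_rpow_inv_iff hz]

lemma rpow_one_div_le_iff {x y : ℝ≥0∞} {z : ℝ} (hz : 0 < z) : x ^ (1 / z) ≤ y ↔ x ≤ y ^ z := by
  rw [one_div, ENNReal.rpow_inv_le_iff hz]

lemma seqNorm_top (a : ℤ → ℝ≥0∞) : seqNorm ∞ a = ⨆ k, a k := by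
  simp [seqNorm, eLpNorm_exponent_top, eLpNormEssSup_eq_essSup_enorm]

lemma seqNorm_eq_tsum {q : ℝ≥0∞} (h0 : q ≠ 0) (ht : q ≠ ∞) (a : ℤ → ℝ≥0∞) :
    seqNorm q a = (∑' k, a k ^ q.toReal) ^ (1 / q.toReal) := by
  simp [seqNorm, eLpNorm_eq_lintegral_rpow_enorm_toReal h0 ht, lintegral_count]

lemma seqNorm_mono (q : ℝ≥0∞) {a b : ℤ → ℝ≥0∞} (h : ∀ k, a k ≤ b k) :
    seqNorm q a ≤ seqNorm q b :=
  eLpNorm_mono_enorm fun k => by simpa using h k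

lemma seqNorm_const_mul_le (q : ℝ≥0∞) {c : ℝ≥0∞} (hc : c ≠ ∞) (a : ℤ → ℝ≥0∞) :
    seqNorm q (fun k => c * a k) ≤ c * seqNorm q a :=
  eLpNorm_le_const_mul hc (fun k => by simp) q

lemma seqNorm_mul_const_le {q : ℝ≥0∞} (hq : q ≠ 0) (c : ℝ≥0∞) (a : ℤ → ℝ≥0∞) :
    seqNorm q (fun k => a k * c) ≤ seqNorm q a * c := by
  by_cases ht : q = ∞
  · subst ht
    rw [seqNorm_top, seqNorm_top, ENNReal.iSup_mul]
  · have hq' : 0 < q.toReal := ENNReal.toReal_pos hq ht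
    rw [seqNorm_eq_tsum hq ht, seqNorm_eq_tsum hq ht]
    simp_rw [ENNReal.mul_rpow_of_nonneg _ _ hq'.le]
    rw [ENNReal.tsum_mul_right, ENNReal.mul_rpow_of_nonneg _ _ (by positivity), ← ENNReal.rpow_mul,
      mul_one_div_cancel hq'.ne', ENNReal.rpow_one]

lemma le_seqNorm {q : ℝ≥0∞} (hq : q ≠ 0) (a : ℤ → ℝ≥0∞) (k : ℤ) : a k ≤ seqNorm q a := by
  by_cases ht : q = ∞
  · subst ht
    rw [seqNorm_top]
    exact le_iSup a k
  · have hq' : 0 < q.toReal := ENNReal.toReal_pos hq ht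
    rw [seqNorm_eq_tsum hq ht, le_rpow_one_div_iff hq']
    exact ENNReal.le_tsum (f := fun k => a k ^ q.toReal) k

lemma seqNorm_shift (q : ℝ≥0∞) (a : ℤ → ℝ≥0∞) (N : ℤ) :
    seqNorm q (fun k => a (k + N)) = seqNorm q a := by
  by_cases h0 : q = 0
  · simp [seqNorm, h0]
  by_cases ht : q = ∞
  · subst ht
    rw [seqNorm_top, seqNorm_top]
    exact (Equiv.addRight N).iSup_comp (g := a)
  · rw [seqNorm_eq_tsum h0 ht, seqNorm_eq_tsum h0 ht]
    congr 1
    exact (Equiv.addRight N).tsum_eq (fun k => a k ^ q.toReal)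

lemma iSup_le_rpow_tsum {ι : Type*} {τ : ℝ} (hτ : 0 < τ) (a : ι → ℝ≥0∞) :
    ⨆ n, a n ≤ (∑' n, a n ^ τ) ^ (1 / τ) := by
  refine iSup_le fun n => ?_
  rw [le_rpow_one_div_iff hτ]
  exact ENNReal.le_tsum (f := fun n => a n ^ τ) n

lemma tsum_pow_rpow_ne_top {θ : ℝ≥0∞} (hθ : θ < 1) {τ : ℝ} (hτ : 0 < τ) :
    ∑' n : ℕ, (θ ^ n) ^ τ ≠ ∞ := by
  have : ∀ n : ℕ, (θ ^ n) ^ τ = (θ ^ τ) ^ n := fun n => by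
    rw [← ENNReal.rpow_natCast, ← ENNReal.rpow_mul, mul_comm, ENNReal.rpow_mul,
      ENNReal.rpow_natCast]
  simp_rw [this]
  rw [ENNReal.tsum_geometric]
  exact ENNReal.inv_ne_top.2 (tsub_pos_iff_lt.2 (ENNReal.rpow_lt_one hθ hτ)).ne'

/-- Geometric convolution is bounded on `ℓ^q`. -/
lemma exists_seqNorm_conv_le {q : ℝ≥0∞} (hq : q ≠ 0) (e : ℤ) {θ : ℝ≥0∞} (hθ : θ < 1) :
    ∃ K : ℝ≥0∞, K ≠ ∞ ∧ ∀ a : ℤ → ℝ≥0∞,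
      seqNorm q (fun k => ⨆ n : ℕ, θ ^ n * a (k + e * n)) ≤ K * seqNorm q a := by
  by_cases ht : q = ∞
  · subst ht
    refine ⟨1, ENNReal.one_ne_top, fun a => ?_⟩
    rw [seqNorm_top, seqNorm_top, one_mul]
    refine iSup_le fun k => iSup_le fun n => ?_
    calc θ ^ n * a (k + e * n) ≤ 1 * a (k + e * n) := by
          gcongr
          exact pow_le_one₀ (zero_le) hθ.le
      _ ≤ _ := by rw [one_mul]; exact le_iSup a _
  · have hq' : 0 < q.toReal := ENNReal.toReal_pos hq ht
    refine ⟨(∑' n : ℕ, (θ ^ n) ^ q.toReal) ^ (1 / q.toReal),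
      ENNReal.rpow_ne_top_of_nonneg (by positivity) (tsum_pow_rpow_ne_top hθ hq'), fun a => ?_⟩
    rw [seqNorm_eq_tsum hq ht, seqNorm_eq_tsum hq ht,
      ← ENNReal.mul_rpow_of_nonneg _ _ (by positivity)]
    refine ENNReal.rpow_le_rpow ?_ (by positivity)
    -- Dominating the supremum by an `ℓ^q` sum before exchanging the sums avoids the triangle
    -- inequality, so `q < 1` needs no separate treatment.
    calc ∑' k, (⨆ n : ℕ, θ ^ n * a (k + e * n)) ^ q.toReal
        ≤ ∑' k, ∑' n : ℕ, (θ ^ n * a (k + e * n)) ^ q.toReal := by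
          refine ENNReal.tsum_le_tsum fun k => ?_
          rw [← le_rpow_one_div_iff hq']
          exact iSup_le_rpow_tsum hq' _
      _ = ∑' n : ℕ, (θ ^ n) ^ q.toReal * ∑' k, a (k + e * n) ^ q.toReal := by
          rw [ENNReal.tsum_comm]
          refine tsum_congr fun n => ?_
          rw [← ENNReal.tsum_mul_left]
          exact tsum_congr fun k => ENNReal.mul_rpow_of_nonneg _ _ hq'.le
      _ = ∑' n : ℕ, (θ ^ n) ^ q.toReal * ∑' k, a k ^ q.toReal := by
          refine tsum_congr fun n => ?_
          congr 1
          exact (Equiv.addRight (e * (n : ℤ))).tsum_eq (fun k => a k ^ q.toReal)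
      _ = _ := ENNReal.tsum_mul_right

/-! ### Minkowski's integral inequality for sequences. -/

section Minkowski

variable {X : Type*} [MeasurableSpace X]

/-- Duality: one factor of each `r`-th power is written as an integral, and Hölder's inequality
under the integral gives `S ≤ S ^ (1 - 1 / r) * J`. Dividing requires `S` finite and nonzero;
finiteness holds because each integral is at most `J`. -/
lemma finset_sum_lintegral_rpow_le {ι : Type*} (ν : Measure X) {r : ℝ} (hr : 1 ≤ r) (s : Finset ι)
    {F : ι → X → ℝ≥0∞} (hF : ∀ k, Measurable (F k)) :
    (∑ k ∈ s, (∫⁻ y, F k y ∂ν) ^ r) ^ (1 / r) ≤ ∫⁻ y, (∑ k ∈ s, F k y ^ r) ^ (1 / r) ∂ν := by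
  rcases hr.eq_or_lt with rfl | hr1
  · simp only [ENNReal.rpow_one, div_one]
    rw [lintegral_finsetSum _ fun k _ => hF k]
  have hr0 : 0 < r := by linarith
  set S := ∑ k ∈ s, (∫⁻ y, F k y ∂ν) ^ r with hS
  set J := ∫⁻ y, (∑ k ∈ s, F k y ^ r) ^ (1 / r) ∂ν with hJ
  have hle : ∀ k ∈ s, ∫⁻ y, F k y ∂ν ≤ J := fun k hk => lintegral_mono fun y => by
    rw [le_rpow_one_div_iff hr0]
    exact Finset.single_le_sum (f := fun k => F k y ^ r) (fun _ _ => zero_le) hk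
  by_cases hJt : J = ∞
  · rw [hJt]; exact le_top
  by_cases hS0 : S = 0
  · rw [hS0, ENNReal.zero_rpow_of_pos (by positivity)]; exact zero_le
  have hSt : S ≠ ∞ := ENNReal.sum_ne_top.2 fun k hk =>
    ENNReal.rpow_ne_top_of_nonneg hr0.le (ne_top_of_le_ne_top hJt (hle k hk))
  have hconj : (Real.conjExponent r).HolderConjugate r :=
    (Real.HolderConjugate.conjExponent hr1).symm
  have hexp : (r - 1) * Real.conjExponent r = r := by
    rw [Real.conjExponent]
    field_simp [sub_ne_zero.2 hr1.ne']
  have hexp' : 1 / Real.conjExponent r = 1 - 1 / r := by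
    have := hconj.inv_add_inv_eq_one
    rw [one_div, one_div]
    linarith
  have key : S ≤ S ^ (1 - 1 / r) * J := by
    calc S = ∑ k ∈ s, ∫⁻ y, (∫⁻ y, F k y ∂ν) ^ (r - 1) * F k y ∂ν := by
          refine Finset.sum_congr rfl fun k hk => ?_
          rw [lintegral_const_mul _ (hF k)]
          by_cases h0 : ∫⁻ y, F k y ∂ν = 0
          · rw [h0, mul_zero, ENNReal.zero_rpow_of_pos hr0]
          · conv_lhs => rw [show r = (r - 1) + 1 by ring]
            rw [ENNReal.rpow_add _ _ h0 (ne_top_of_le_ne_top hJt (hle k hk)), ENNReal.rpow_one]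
      _ = ∫⁻ y, ∑ k ∈ s, (∫⁻ y, F k y ∂ν) ^ (r - 1) * F k y ∂ν := by
          rw [lintegral_finsetSum _ fun k _ => (hF k).const_mul _]
      _ ≤ ∫⁻ y, S ^ (1 - 1 / r) * (∑ k ∈ s, F k y ^ r) ^ (1 / r) ∂ν := by
          refine lintegral_mono fun y => ?_
          have := ENNReal.inner_le_Lp_mul_Lq s (fun k => (∫⁻ y, F k y ∂ν) ^ (r - 1))
            (fun k => F k y) hconj
          simp_rw [← ENNReal.rpow_mul, hexp, hexp'] at this
          exact this
      _ = _ := by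
          rw [lintegral_const_mul _ ((Finset.measurable_sum s fun k _ =>
            (hF k).pow_const r).pow_const _)]
  have hSx0 : S ^ (1 - 1 / r) ≠ 0 := by
    rw [Ne, ENNReal.rpow_eq_zero_iff]
    tauto
  have hSxt : S ^ (1 - 1 / r) ≠ ∞ := ENNReal.rpow_ne_top_of_ne_zero hS0 hSt
  have : S ^ (1 - 1 / r) * S ^ (1 / r) ≤ S ^ (1 - 1 / r) * J := by
    rw [← ENNReal.rpow_add _ _ hS0 hSt, sub_add_cancel, ENNReal.rpow_one]
    exact key
  exact (ENNReal.mul_le_mul_iff_right hSx0 hSxt).1 this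

/-- Minkowski's integral inequality for power means of sequences. -/
lemma seqNorm_lintegral_rpow_le (ν : Measure X) {q : ℝ≥0∞} {t : ℝ} (ht : 0 < t)
    (htq : ENNReal.ofReal t ≤ q) {f : ℤ → X → ℝ≥0∞} (hf : ∀ k, Measurable (f k)) :
    seqNorm q (fun k => (∫⁻ y, f k y ^ t ∂ν) ^ (1 / t)) ≤
      (∫⁻ y, seqNorm q (fun k => f k y) ^ t ∂ν) ^ (1 / t) := by
  have hq0 : q ≠ 0 := (lt_of_lt_of_le (ENNReal.ofReal_pos.2 ht) htq).ne'
  by_cases hqt : q = ∞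
  · subst hqt
    rw [seqNorm_top]
    refine iSup_le fun k => ?_
    gcongr with y
    exact le_seqNorm (by simp) (fun k => f k y) k
  · have hq' : 0 < q.toReal := ENNReal.toReal_pos hq0 hqt
    have htq' : t ≤ q.toReal := (ENNReal.ofReal_le_iff_le_toReal hqt).1 htq
    set r := q.toReal / t with hr
    have hr1 : 1 ≤ r := (one_le_div ht).2 htq'
    have hr0 : 0 < r := by positivity
    have h1 : ∑' k, (∫⁻ y, f k y ^ t ∂ν) ^ r ≤
        (∫⁻ y, (∑' k, f k y ^ q.toReal) ^ (1 / r) ∂ν) ^ r := by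
      rw [ENNReal.tsum_eq_iSup_sum]
      refine iSup_le fun s => ?_
      rw [← rpow_one_div_le_iff hr0]
      refine (finset_sum_lintegral_rpow_le ν hr1 s fun k => (hf k).pow_const t).trans ?_
      gcongr with y
      simp_rw [← ENNReal.rpow_mul, hr, mul_div_cancel₀ _ ht.ne']
      exact ENNReal.sum_le_tsum s
    rw [seqNorm_eq_tsum hq0 hqt]
    have e1 : ∀ k, ((∫⁻ y, f k y ^ t ∂ν) ^ (1 / t)) ^ q.toReal = (∫⁻ y, f k y ^ t ∂ν) ^ r :=
      fun k => by rw [← ENNReal.rpow_mul, hr, one_div_mul_eq_div]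
    have e2 : ∀ y, seqNorm q (fun k => f k y) ^ t = (∑' k, f k y ^ q.toReal) ^ (1 / r) :=
      fun y => by
        rw [seqNorm_eq_tsum hq0 hqt, ← ENNReal.rpow_mul, hr, one_div_mul_eq_div, one_div_div]
    simp_rw [e1, e2]
    rw [rpow_one_div_le_iff hq', ← ENNReal.rpow_mul, one_div_mul_eq_div]
    exact h1

end Minkowski

/-- The common properties of the `L^p(ℓ^q)` and `ℓ^q(L^p)` norms. -/
structure IsMixedNorm {X : Type*} [MeasurableSpace X] (μ : Measure X) (p q : ℝ≥0∞)
    (Φ : (ℤ → X → ℝ≥0∞) → ℝ≥0∞) : Prop where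
  mono : ∀ f g : ℤ → X → ℝ≥0∞, (∀ k x, f k x ≤ g k x) → Φ f ≤ Φ g
  add : ∃ K : ℝ≥0∞, K ≠ ∞ ∧ ∀ f g : ℤ → X → ℝ≥0∞, (∀ k, Measurable (f k)) →
    (∀ k, Measurable (g k)) → Φ (fun k x => f k x + g k x) ≤ K * (Φ f + Φ g)
  const_mul : ∀ c : ℝ≥0∞, c ≠ ∞ → ∀ f : ℤ → X → ℝ≥0∞, Φ (fun k x => c * f k x) ≤ c * Φ f
  shift : ∀ (f : ℤ → X → ℝ≥0∞) (N : ℤ), Φ (fun k => f (k + N)) = Φ f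
  conv : ∀ (e : ℤ) (θ : ℝ≥0∞), θ < 1 → ∃ K : ℝ≥0∞, K ≠ ∞ ∧ ∀ f : ℤ → X → ℝ≥0∞,
    (∀ k, Measurable (f k)) → Φ (fun k x => ⨆ n : ℕ, θ ^ n * f (k + e * n) x) ≤ K * Φ f
  single : ∀ (c : ℤ → ℝ≥0∞) (F : X → ℝ≥0∞), seqNorm q c ≠ ∞ →
    Φ (fun k x => c k * F x) ≤ seqNorm q c * eLpNorm F p μ
  coord : ∀ (f : ℤ → X → ℝ≥0∞) (k : ℤ), eLpNorm (f k) p μ ≤ Φ f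
  average : ∀ (ν : X → Measure X) (t : ℝ) (K : ℝ≥0∞), 0 < t → ENNReal.ofReal t ≤ q →
    (∀ f : X → ℝ≥0∞, Measurable f →
      eLpNorm (fun x => (∫⁻ y, f y ^ t ∂ν x) ^ (1 / t)) p μ ≤ K * eLpNorm f p μ) → K ≠ ∞ →
    ∀ f : ℤ → X → ℝ≥0∞, (∀ k, Measurable (f k)) →
      Φ (fun k x => (∫⁻ y, f k y ^ t ∂ν x) ^ (1 / t)) ≤ K * Φ f

section MixedNorms

variable {X : Type*} [MeasurableSpace X]

/-- The `L^p(ℓ^q)` norm. -/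
noncomputable def mixedM (p q : ℝ≥0∞) (μ : Measure X) (f : ℤ → X → ℝ≥0∞) : ℝ≥0∞ :=
  eLpNorm (fun x => seqNorm q (fun k => f k x)) p μ

/-- The `ℓ^q(L^p)` norm. -/
noncomputable def mixedN (p q : ℝ≥0∞) (μ : Measure X) (f : ℤ → X → ℝ≥0∞) : ℝ≥0∞ :=
  seqNorm q (fun k => eLpNorm (f k) p μ)

lemma measurable_seqNorm_ennreal (q : ℝ≥0∞) {f : ℤ → X → ℝ≥0∞} (hf : ∀ k, Measurable (f k)) :
    Measurable (fun x => seqNorm q (fun k => f k x)) := by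
  by_cases h0 : q = 0
  · simp [seqNorm, h0]
  by_cases ht : q = ∞
  · subst ht
    simp only [seqNorm_top]
    exact Measurable.iSup hf
  · simp only [seqNorm_eq_tsum h0 ht]
    exact (Measurable.tsum fun k => (hf k).pow_const _).pow_const _

lemma eLpNorm_mono_ennreal {f g : X → ℝ≥0∞} (p : ℝ≥0∞) (μ : Measure X) (h : ∀ x, f x ≤ g x) :
    eLpNorm f p μ ≤ eLpNorm g p μ :=
  eLpNorm_mono_enorm fun x => by simpa using h x

lemma eLpNorm_eq_lintegral_ennreal {p : ℝ≥0∞} (h0 : p ≠ 0) (ht : p ≠ ∞) (μ : Measure X)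
    (f : X → ℝ≥0∞) : eLpNorm f p μ = (∫⁻ x, f x ^ p.toReal ∂μ) ^ (1 / p.toReal) := by
  simp [eLpNorm_eq_lintegral_rpow_enorm_toReal h0 ht]

lemma isMixedNorm_mixedM (μ : Measure X) {p q : ℝ≥0∞} (hq : q ≠ 0) :
    IsMixedNorm μ p q (mixedM p q μ) where
  mono f g h := eLpNorm_mono_ennreal _ _ fun x => seqNorm_mono q fun k => h k x
  add := by
    refine ⟨ENNReal.LpAddConst q * ENNReal.LpAddConst p, ENNReal.mul_ne_top
      (ENNReal.LpAddConst_lt_top q).ne (ENNReal.LpAddConst_lt_top p).ne, fun f g hf hg => ?_⟩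
    have h1 : mixedM p q μ (fun k x => f k x + g k x) ≤ ENNReal.LpAddConst q *
        eLpNorm ((fun x => seqNorm q (fun k => f k x)) + fun x => seqNorm q (fun k => g k x)) p μ :=
      eLpNorm_le_const_mul (ENNReal.LpAddConst_lt_top q).ne
        (fun x => seqNorm_add_le q (fun k => f k x) (fun k => g k x)) p
    refine h1.trans ?_
    rw [mul_assoc]
    gcongr
    exact eLpNorm_add_le' (measurable_seqNorm_ennreal q hf).aestronglyMeasurable
      (measurable_seqNorm_ennreal q hg).aestronglyMeasurable p
  const_mul c hc f := eLpNorm_le_const_mul hc (fun x => seqNorm_const_mul_le q hc _) p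
  shift f N := by
    unfold mixedM
    congr 1
    ext x
    exact seqNorm_shift q (fun k => f k x) N
  conv e θ hθ := by
    obtain ⟨K, hK, hK'⟩ := exists_seqNorm_conv_le hq e hθ
    exact ⟨K, hK, fun f _ => eLpNorm_le_const_mul hK (fun x => hK' fun k => f k x) p⟩
  single c F hc := eLpNorm_le_const_mul hc (fun x => seqNorm_mul_const_le hq (F x) c) p
  coord f k := eLpNorm_mono_ennreal _ _ fun x => le_seqNorm hq (fun k => f k x) k
  -- The measure `ν x` is the same for all `k`. Minkowski's inequality therefore moves the `ℓ^q`
  -- norm inside at each `x`, and the scalar bound finishes; no vector-valued maximal inequality is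
  -- involved.
  average ν t K ht htq hK _ f hf :=
    (eLpNorm_mono_ennreal _ _ fun x => seqNorm_lintegral_rpow_le (ν x) ht htq hf).trans
      (hK _ (measurable_seqNorm_ennreal q hf))

/-- One factor `θ ^ n` pays for replacing the supremum by a sum of `p`-th powers; the other stays
inside the supremum of the norms, ready for the outer `ℓ^q` norm. -/
lemma exists_eLpNorm_iSup_le (μ : Measure X) {p : ℝ≥0∞} (h0 : p ≠ 0) (ht : p ≠ ∞) {θ : ℝ≥0∞}
    (hθ : θ < 1) : ∃ K : ℝ≥0∞, K ≠ ∞ ∧ ∀ g : ℕ → X → ℝ≥0∞, (∀ n, Measurable (g n)) →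
      eLpNorm (fun x => ⨆ n, (θ ^ n * θ ^ n) * g n x) p μ ≤ K * ⨆ n, θ ^ n * eLpNorm (g n) p μ := by
  have hp : 0 < p.toReal := ENNReal.toReal_pos h0 ht
  refine ⟨(∑' n : ℕ, (θ ^ n) ^ p.toReal) ^ (1 / p.toReal),
    ENNReal.rpow_ne_top_of_nonneg (by positivity) (tsum_pow_rpow_ne_top hθ hp), fun g hg => ?_⟩
  set S := ⨆ n, θ ^ n * eLpNorm (g n) p μ with hS
  rw [eLpNorm_eq_lintegral_ennreal h0 ht, rpow_one_div_le_iff hp,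
    ENNReal.mul_rpow_of_nonneg _ _ hp.le, ← ENNReal.rpow_mul, one_div_mul_cancel hp.ne',
    ENNReal.rpow_one]
  calc ∫⁻ x, (⨆ n, (θ ^ n * θ ^ n) * g n x) ^ p.toReal ∂μ
      ≤ ∫⁻ x, ∑' n, ((θ ^ n * θ ^ n) * g n x) ^ p.toReal ∂μ := by
        refine lintegral_mono fun x => ?_
        rw [← le_rpow_one_div_iff hp]
        exact iSup_le_rpow_tsum hp _
    _ = ∑' n, (θ ^ n) ^ p.toReal * (θ ^ n * eLpNorm (g n) p μ) ^ p.toReal := by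
        rw [lintegral_tsum fun n => (((hg n).const_mul _).pow_const _).aemeasurable]
        refine tsum_congr fun n => ?_
        simp_rw [ENNReal.mul_rpow_of_nonneg _ _ hp.le]
        rw [lintegral_const_mul _ ((hg n).pow_const _), eLpNorm_eq_lintegral_ennreal h0 ht,
          ← ENNReal.rpow_mul, one_div_mul_cancel hp.ne', ENNReal.rpow_one, mul_assoc]
    _ ≤ ∑' n, (θ ^ n) ^ p.toReal * S ^ p.toReal := by
        gcongr with n
        exact le_iSup (fun n => θ ^ n * eLpNorm (g n) p μ) n
    _ = _ := ENNReal.tsum_mul_right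

lemma isMixedNorm_mixedN (μ : Measure X) {p q : ℝ≥0∞} (h0 : p ≠ 0) (ht : p ≠ ∞) (hq : q ≠ 0) :
    IsMixedNorm μ p q (mixedN p q μ) where
  mono f g h := seqNorm_mono q fun k => eLpNorm_mono_ennreal _ _ fun x => h k x
  add := by
    refine ⟨ENNReal.LpAddConst p * ENNReal.LpAddConst q, ENNReal.mul_ne_top
      (ENNReal.LpAddConst_lt_top p).ne (ENNReal.LpAddConst_lt_top q).ne, fun f g hf hg => ?_⟩
    have h1 : mixedN p q μ (fun k x => f k x + g k x) ≤ ENNReal.LpAddConst p *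
        seqNorm q ((fun k => eLpNorm (f k) p μ) + fun k => eLpNorm (g k) p μ) :=
      eLpNorm_le_const_mul (ENNReal.LpAddConst_lt_top p).ne
        (fun k => eLpNorm_add_le' (hf k).aestronglyMeasurable (hg k).aestronglyMeasurable p) q
    refine h1.trans ?_
    rw [mul_assoc]
    gcongr
    exact seqNorm_add_le q _ _
  const_mul c hc f := eLpNorm_le_const_mul hc
    (fun k => eLpNorm_le_const_mul hc (fun x => by simp) p) q
  shift f N := seqNorm_shift q (fun k => eLpNorm (f k) p μ) N
  conv e θ hθ := by
    -- Half of the decay is spent inside `L^p`, the other half in the convolution on `ℓ^q`.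
    set ϑ : ℝ≥0∞ := θ ^ (1 / 2 : ℝ) with hϑ
    have hϑ1 : ϑ < 1 := ENNReal.rpow_lt_one hθ (by norm_num)
    have hϑ2 : θ = ϑ * ϑ := by
      rw [hϑ, ← ENNReal.rpow_add_of_nonneg _ _ (by norm_num) (by norm_num)]
      norm_num
    obtain ⟨K₁, hK₁, hK₁'⟩ := exists_eLpNorm_iSup_le μ h0 ht hϑ1
    obtain ⟨K₂, hK₂, hK₂'⟩ := exists_seqNorm_conv_le hq e hϑ1
    refine ⟨K₁ * K₂, ENNReal.mul_ne_top hK₁ hK₂, fun f hf => ?_⟩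
    calc mixedN p q μ (fun k x => ⨆ n : ℕ, θ ^ n * f (k + e * n) x)
        ≤ seqNorm q (fun k => K₁ * ⨆ n : ℕ, ϑ ^ n * eLpNorm (f (k + e * n)) p μ) := by
          refine seqNorm_mono q fun k => ?_
          have := hK₁' (fun n => f (k + e * n)) fun n => hf _
          simpa only [hϑ2, mul_pow] using this
      _ ≤ K₁ * seqNorm q (fun k => ⨆ n : ℕ, ϑ ^ n * eLpNorm (f (k + e * n)) p μ) :=
          seqNorm_const_mul_le q hK₁ _
      _ ≤ K₁ * (K₂ * seqNorm q (fun k => eLpNorm (f k) p μ)) := by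
          gcongr
          exact hK₂' fun k => eLpNorm (f k) p μ
      _ = _ := by rw [mul_assoc]; rfl
  single c F hc := by
    have hct : ∀ k, c k ≠ ∞ := fun k => ne_top_of_le_ne_top hc (le_seqNorm hq c k)
    refine le_trans (seqNorm_mono q fun k => ?_) (seqNorm_mul_const_le hq (eLpNorm F p μ) c)
    exact eLpNorm_le_const_mul (hct k) (fun x => by simp) p
  coord f k := le_seqNorm hq (fun k => eLpNorm (f k) p μ) k
  average ν t K _ _ hK hKt f hf :=
    le_trans (seqNorm_mono q fun k => hK _ (hf k)) (seqNorm_const_mul_le q hKt _)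

/-- The endpoint substitute for geometric decay: with the supremum over `k` taken pointwise, a
further supremum over shifts changes nothing. In `ℓ^∞(L^p)` the supremum stands outside the
integral, and this argument is not available. -/
lemma mixedM_top_iSup_le (μ : Measure X) (p : ℝ≥0∞) (f : ℤ → X → ℝ≥0∞) :
    mixedM p ∞ μ (fun k x => ⨆ n : ℕ, f (k - n) x) ≤ mixedM p ∞ μ f := by
  refine eLpNorm_mono_ennreal _ _ fun x => ?_
  rw [seqNorm_top, seqNorm_top]
  exact iSup_le fun k => iSup_le fun n => le_iSup (fun k => f k x) _

end MixedNorms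

end HajlaszExt

/-! ### Reflected balls and averages over them -/

namespace HajlaszExt

open Metric

/-- The `t`-power mean of `f` over `S`. -/
noncomputable def powAvg {X : Type*} [MeasurableSpace X] (μ : Measure X) (t : ℝ) (S : Set X)
    (f : X → ℝ≥0∞) : ℝ≥0∞ :=
  (⨍⁻ y in S, f y ^ t ∂μ) ^ (1 / t)

section PowAvg

variable {X : Type*} [MeasurableSpace X] {μ : Measure X} {t : ℝ}

lemma powAvg_mono (ht : 0 < t) (S : Set X) {f g : X → ℝ≥0∞} (h : ∀ x, f x ≤ g x) :
    powAvg μ t S f ≤ powAvg μ t S g := by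
  unfold powAvg
  rw [setLAverage_eq, setLAverage_eq]
  gcongr with x
  exact h x

lemma powAvg_le_of_subset (ht : 0 < t) {S T : Set X} (hST : S ⊆ T) {K : ℝ≥0∞} (hS : μ S ≠ 0)
    (hT : μ T ≠ ∞) (hK : μ T ≤ K * μ S) (f : X → ℝ≥0∞) :
    powAvg μ t S f ≤ K ^ (1 / t) * powAvg μ t T f := by
  unfold powAvg
  rw [← ENNReal.mul_rpow_of_nonneg _ _ (by positivity)]
  refine ENNReal.rpow_le_rpow ?_ (by positivity)
  rw [setLAverage_eq, setLAverage_eq]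
  have hS' : μ S ≠ ∞ := ne_top_of_le_ne_top hT (measure_mono hST)
  have hT' : μ T ≠ 0 := fun h => hS (measure_mono_null hST h)
  have h1 : (μ S)⁻¹ ≤ K * (μ T)⁻¹ := by
    calc (μ S)⁻¹ = μ T * (μ T)⁻¹ * (μ S)⁻¹ := by rw [ENNReal.mul_inv_cancel hT' hT, one_mul]
      _ ≤ K * μ S * (μ T)⁻¹ * (μ S)⁻¹ := by gcongr
      _ = K * (μ T)⁻¹ * (μ S * (μ S)⁻¹) := by ring
      _ = K * (μ T)⁻¹ := by rw [ENNReal.mul_inv_cancel hS hS', mul_one]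
  calc (∫⁻ y in S, f y ^ t ∂μ) / μ S ≤ (∫⁻ y in T, f y ^ t ∂μ) * (K * (μ T)⁻¹) := by
        rw [div_eq_mul_inv]
        gcongr
    _ = _ := by rw [div_eq_mul_inv]; ring

/-- A function cannot exceed its mean almost everywhere. This supplies points where a gradient is
under control, for every `t > 0` and away from the exceptional null set. -/
lemma exists_mem_le_powAvg (ht : 0 < t) {S : Set X} (hSm : MeasurableSet S) (hS : μ S ≠ 0)
    (hS' : μ S ≠ ∞) {E : Set X} (hE : μ E = 0) {f : X → ℝ≥0∞} (hf : Measurable f) :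
    ∃ z ∈ S, z ∉ E ∧ f z ≤ powAvg μ t S f := by
  have : IsFiniteMeasure (μ.restrict S) := isFiniteMeasure_restrict.2 hS'
  have h0 : μ.restrict S ≠ 0 := by rwa [Ne, Measure.restrict_eq_zero]
  have hN : μ.restrict S (E ∪ Sᶜ) = 0 := by
    refine measure_union_null (le_antisymm ?_ zero_le) ?_
    · exact (Measure.restrict_apply_le _ _).trans hE.le
    · rw [Measure.restrict_apply hSm.compl, Set.compl_inter_self, measure_empty]
  obtain ⟨z, hz, hz'⟩ := exists_notMem_null_le_laverage h0 (hf.pow_const t).aemeasurable hN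
  simp only [Set.mem_union, not_or, Set.mem_compl_iff, not_not] at hz
  exact ⟨z, hz.2, hz.1, (le_rpow_one_div_iff ht).2 hz'⟩

end PowAvg

/-! ### Measurable choice of a nearby point, reflected balls and their averages. -/

section Whitney

variable {X : Type*} [PseudoMetricSpace X]

/-- The first index of a point of the sequence `pt` lying much closer to `x` than `Ω` does. -/
noncomputable def whitneyIndex (Ω : Set X) (pt : ℕ → X) (x : X) : ℕ :=
  sInf {i | dist x (pt i) < infDist x Ω / 8 ∨ infDist x Ω ≤ 0}

/-- The part of `Ω` near the point `pt i`, at the scale of the distance to `Ω`. -/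
def reflBall (Ω : Set X) (pt : ℕ → X) (K : ℝ) (i : ℕ) : Set X :=
  ball (pt i) (K * infDist (pt i) Ω) ∩ Ω

variable {Ω : Set X} {pt : ℕ → X}

/-- The second alternative covers the points of `closure Ω`, so that the index is a genuine minimum
everywhere; measurability relies on this. -/
lemma exists_whitneyIndex (hpt : DenseRange pt) (x : X) :
    ∃ i, dist x (pt i) < infDist x Ω / 8 ∨ infDist x Ω ≤ 0 := by
  by_cases h : infDist x Ω ≤ 0
  · exact ⟨0, Or.inr h⟩
  · obtain ⟨i, hi⟩ := hpt.exists_dist_lt x (ε := infDist x Ω / 8) (by linarith [not_le.1 h])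
    exact ⟨i, Or.inl hi⟩

lemma dist_whitneyIndex (hpt : DenseRange pt) {x : X} (hx : 0 < infDist x Ω) :
    dist x (pt (whitneyIndex Ω pt x)) < infDist x Ω / 8 := by
  have := Nat.sInf_mem (exists_whitneyIndex (Ω := Ω) hpt x)
  rcases this with h | h
  · exact h
  · exact absurd hx (not_lt.2 h)

lemma measurable_whitneyIndex [MeasurableSpace X] [OpensMeasurableSpace X] (hpt : DenseRange pt) :
    Measurable (whitneyIndex Ω pt) := by
  classical
  have : whitneyIndex Ω pt = fun x => Nat.find (exists_whitneyIndex (Ω := Ω) hpt x) := by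
    ext x
    have hex := exists_whitneyIndex (Ω := Ω) hpt x
    exact le_antisymm (Nat.sInf_le (Nat.find_spec hex)) (Nat.find_min' hex (Nat.sInf_mem hex))
  rw [this]
  refine measurable_find _ fun i => ?_
  have h1 : MeasurableSet {x | dist x (pt i) < infDist x Ω / 8} :=
    (isOpen_lt (by fun_prop) ((continuous_infDist_pt Ω).div_const 8)).measurableSet
  have h2 : MeasurableSet {x | infDist x Ω ≤ 0} :=
    (isClosed_le (continuous_infDist_pt Ω) continuous_const).measurableSet
  exact h1.union h2

lemma reflBall_mono {K L : ℝ} (h : K ≤ L) (i : ℕ) : reflBall Ω pt K i ⊆ reflBall Ω pt L i :=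
  Set.inter_subset_inter_left _ (ball_subset_ball
    (mul_le_mul_of_nonneg_right h infDist_nonneg))

lemma measurableSet_reflBall [MeasurableSpace X] [OpensMeasurableSpace X] (hΩ : MeasurableSet Ω)
    (K : ℝ) (i : ℕ) : MeasurableSet (reflBall Ω pt K i) :=
  isOpen_ball.measurableSet.inter hΩ

lemma abs_infDist_sub_le (x y : X) : |infDist x Ω - infDist y Ω| ≤ dist x y := by
  rw [abs_le]
  constructor
  · linarith [infDist_le_infDist_add_dist (s := Ω) (x := y) (y := x), dist_comm x y]
  · linarith [infDist_le_infDist_add_dist (s := Ω) (x := x) (y := y)]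

variable [MeasurableSpace X]

/-- The measure density condition at radii up to `R`. -/
def HasDensity (μ : Measure X) (Ω : Set X) (M : ℝ≥0∞) (R : ℝ) : Prop :=
  ∀ x ∈ Ω, ∀ r, 0 < r → r ≤ R → μ (ball x r) ≤ M * μ (ball x r ∩ Ω)

variable {μ : Measure X} {C D : ℝ} {M : ℝ≥0∞} {R : ℝ}

/-- With `δ` the distance from `pt i` to `Ω`, some `z ∈ Ω` lies within `2 * δ`. The density
condition on the ball of radius `δ` about `z` fills a fixed part of `reflBall Ω pt 3 i`, as `2 + 1 =
3`, and doubling compares the other balls with it. -/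
lemma measure_ball_le_reflBall (h : IsDoublingSpace μ C D) (hd : HasDensity μ Ω M R)
    (hne : Ω.Nonempty) {i : ℕ} (hi : 0 < infDist (pt i) Ω) (hiR : infDist (pt i) Ω ≤ R) {y : X}
    {r L : ℝ} (hL : 0 ≤ L) (hr : dist y (pt i) + r ≤ L * infDist (pt i) Ω) :
    μ (ball y r) ≤ (ENNReal.ofReal (C * (L + 2) ^ D) * M) * μ (reflBall Ω pt 3 i) := by
  obtain ⟨z, hz, hiz⟩ :=
    (infDist_lt_iff hne (x := pt i) (r := 2 * infDist (pt i) Ω)).1 (by linarith)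
  have h1 : μ (ball y r) ≤ ENNReal.ofReal (C * (L + 2) ^ D) * μ (ball z (infDist (pt i) Ω)) :=
    h.ball_le_ball hi (by linarith) (by nlinarith [dist_triangle y (pt i) z])
  refine h1.trans ?_
  rw [mul_assoc]
  gcongr
  refine (hd z hz _ hi hiR).trans ?_
  gcongr
  rintro w ⟨hw, hwΩ⟩
  refine ⟨?_, hwΩ⟩
  rw [mem_ball] at hw ⊢
  linarith [dist_triangle w z (pt i), dist_comm z (pt i)]

lemma measure_reflBall_ne_zero (h : IsDoublingSpace μ C D) (hd : HasDensity μ Ω M R)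
    (hne : Ω.Nonempty) {i : ℕ} (hi : 0 < infDist (pt i) Ω) (hiR : infDist (pt i) Ω ≤ R) {K : ℝ}
    (hK : 3 ≤ K) : μ (reflBall Ω pt K i) ≠ 0 := by
  intro h0
  have h1 : μ (reflBall Ω pt 3 i) = 0 := measure_mono_null (reflBall_mono hK i) h0
  have h2 := measure_ball_le_reflBall h hd hne hi hiR (y := pt i) (r := infDist (pt i) Ω) (L := 1)
    zero_le_one (by simp)
  rw [h1, mul_zero] at h2
  exact absurd (h.ball_pos (pt i) _ hi) (not_lt.2 h2)

lemma measure_reflBall_ne_top (h : IsDoublingSpace μ C D) (K : ℝ) (i : ℕ) :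
    μ (reflBall Ω pt K i) ≠ ∞ :=
  ne_top_of_le_ne_top (h.ball_lt_top (pt i) _).ne (measure_mono Set.inter_subset_left)

/-- Averages over reflected balls of points near `x` are comparable. -/
lemma powAvg_reflBall_le (h : IsDoublingSpace μ C D) (hd : HasDensity μ Ω M R)
    (hne : Ω.Nonempty) {t : ℝ} (ht : 0 < t) {x : X} (hx : 0 < infDist x Ω)
    (hxR : 2 * infDist x Ω ≤ R) {L K : ℝ} (hL : 3 ≤ L) (hLK : L ≤ K) {i j : ℕ}
    (hi : dist x (pt i) < infDist x Ω / 2) (hj : dist x (pt j) < infDist x Ω / 2)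
    (f : X → ℝ≥0∞) :
    powAvg μ t (reflBall Ω pt L i) f ≤
      (ENNReal.ofReal (C * (9 * K + 10) ^ D) * M) ^ (1 / t) *
        powAvg μ t (reflBall Ω pt (3 * K + 2) j) f := by
  -- With `δ = infDist x Ω`, both `pt i` and `pt j` have distance to `Ω` between `δ / 2` and `3 * δ
  -- / 2`, so these distances differ by a factor of at most 3, while `dist (pt i) (pt j) < δ`. Hence
  -- the enlargements `3 * K + 2` and, going back, `3 * (3 * K + 2) + 2 = 9 * K + 8`.
  have ai := abs_le.1 (abs_infDist_sub_le (Ω := Ω) x (pt i))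
  have aj := abs_le.1 (abs_infDist_sub_le (Ω := Ω) x (pt j))
  have hij : dist (pt i) (pt j) < infDist x Ω := by
    linarith [dist_triangle_left (pt i) (pt j) x]
  have hi0 : 0 < infDist (pt i) Ω := by linarith
  have hiR : infDist (pt i) Ω ≤ R := by linarith
  have hLi : L * infDist (pt i) Ω ≤ K * infDist (pt i) Ω := mul_le_mul_of_nonneg_right hLK hi0.le
  refine powAvg_le_of_subset ht ?_ (measure_reflBall_ne_zero h hd hne hi0 hiR hL)
    (measure_reflBall_ne_top h _ _) ?_ f
  · rintro y ⟨hy, hyΩ⟩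
    refine ⟨?_, hyΩ⟩
    rw [mem_ball] at hy ⊢
    nlinarith [dist_triangle y (pt i) (pt j)]
  · refine (measure_mono Set.inter_subset_left).trans ((measure_ball_le_reflBall h hd hne hi0 hiR
      (L := 9 * K + 8) (by linarith) ?_).trans ?_)
    · rw [dist_comm]
      nlinarith
    · rw [show 9 * K + 8 + 2 = 9 * K + 10 by ring]
      gcongr
      exact reflBall_mono hL i

/-- Averages over the reflected ball attached to a point near `Ω`, and `0` far from `Ω`. -/
noncomputable def whitneyAvg (μ : Measure X) (Ω : Set X) (pt : ℕ → X) (K t : ℝ) (f : X → ℝ≥0∞)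
    (x : X) : ℝ≥0∞ :=
  open Classical in
  if 0 < infDist x Ω ∧ infDist x Ω < 4 then
    powAvg μ t (reflBall Ω pt K (whitneyIndex Ω pt x)) f else 0

lemma whitneyAvg_mono {t : ℝ} (ht : 0 < t) (K : ℝ) {f g : X → ℝ≥0∞} (hfg : ∀ x, f x ≤ g x)
    (x : X) : whitneyAvg μ Ω pt K t f x ≤ whitneyAvg μ Ω pt K t g x := by
  unfold whitneyAvg
  split_ifs
  · exact powAvg_mono ht _ hfg
  · exact le_rfl

/-- Puts the averages into the form required by `IsMixedNorm.average`, with a measure depending on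
`x` only. -/
lemma whitneyAvg_eq_lintegral {t : ℝ} (ht : 0 < t) (K : ℝ) : ∃ ν : X → Measure X,
    ∀ f x, whitneyAvg μ Ω pt K t f x = (∫⁻ y, f y ^ t ∂ν x) ^ (1 / t) := by
  classical
  refine ⟨fun x => if 0 < infDist x Ω ∧ infDist x Ω < 4 then
    (μ (reflBall Ω pt K (whitneyIndex Ω pt x)))⁻¹ •
      μ.restrict (reflBall Ω pt K (whitneyIndex Ω pt x)) else 0, fun f x => ?_⟩
  unfold whitneyAvg powAvg
  by_cases hx : 0 < infDist x Ω ∧ infDist x Ω < 4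
  · simp only [if_pos hx, setLAverage_eq']
  · simp [hx, ht]

variable [OpensMeasurableSpace X]

lemma measurable_whitneyAvg (hpt : DenseRange pt) (K t : ℝ) (f : X → ℝ≥0∞) :
    Measurable (whitneyAvg μ Ω pt K t f) := by
  classical
  unfold whitneyAvg
  refine Measurable.ite ?_ ?_ measurable_const
  · exact (isOpen_lt continuous_const (continuous_infDist_pt Ω)).measurableSet.inter
      (isOpen_lt (continuous_infDist_pt Ω) continuous_const).measurableSet
  · exact (measurable_from_nat (f := fun i => powAvg μ t (reflBall Ω pt K i) f)).comp
      (measurable_whitneyIndex hpt)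

/-- A reflected ball fills a fixed part of the full ball containing it, so the `t`-th power of the
average at `x` is at most a multiple of the maximal function of `f ^ t`. The maximal theorem applies
with exponent `p / t > 1`; the cutoff at distance 4 keeps the radii bounded. -/
lemma exists_eLpNorm_whitneyAvg_le (h : IsDoublingSpace μ C D) (hd : HasDensity μ Ω M R)
    (hM : M ≠ ∞) (hne : Ω.Nonempty) (hpt : DenseRange pt) (hR : 8 ≤ R) {K : ℝ} (hK : 3 ≤ K)
    {t : ℝ} (ht : 0 < t) {p : ℝ≥0∞} (hp : p ≠ ∞) (htp : ENNReal.ofReal t < p) :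
    ∃ A : ℝ≥0∞, A ≠ ∞ ∧ ∀ f : X → ℝ≥0∞, Measurable f →
      eLpNorm (whitneyAvg μ Ω pt K t f) p μ ≤ A * eLpNorm f p μ := by
  have hp0 : p ≠ 0 := (lt_of_le_of_lt zero_le htp).ne'
  have htp' : t < p.toReal := (ENNReal.ofReal_lt_iff_lt_toReal ht.le hp).1 htp
  have hp' : 0 < p.toReal := ht.trans htp'
  obtain ⟨A, hA, hA'⟩ := h.exists_lintegral_maxFn_le ((one_lt_div ht).2 htp')
  set B := ENNReal.ofReal (C * (K + 2) ^ D) * M with hB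
  have hBt : B ≠ ∞ := ENNReal.mul_ne_top ENNReal.ofReal_ne_top hM
  set I : Set ℕ := {i | 0 < infDist (pt i) Ω ∧ infDist (pt i) Ω ≤ 8} with hI
  have hI' : ∀ i ∈ I, 0 < K * infDist (pt i) Ω ∧ K * infDist (pt i) Ω ≤ K * 8 := by
    rintro i ⟨h1, h2⟩
    constructor
    · have : 0 < K := by linarith
      positivity
    · gcongr
  have hpow : ∀ f x, whitneyAvg μ Ω pt K t f x ^ t ≤
      B * maxFn μ pt (fun i => K * infDist (pt i) Ω) I (fun y => f y ^ t) x := by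
    intro f x
    unfold whitneyAvg
    split_ifs with hx
    · have hi := dist_whitneyIndex hpt hx.1
      set i := whitneyIndex Ω pt x with hi'
      have ai := abs_le.1 (abs_infDist_sub_le (Ω := Ω) x (pt i))
      have hi0 : 0 < infDist (pt i) Ω := by linarith
      have hi8 : infDist (pt i) Ω ≤ 8 := by linarith
      refine le_trans ?_ (mul_le_mul' le_rfl (le_maxFn (r := fun i => K * infDist (pt i) Ω)
        (i := i) ⟨hi0, hi8⟩ (by rw [mem_ball]; nlinarith)))
      have h1 := powAvg_le_of_subset ht (μ := μ) (S := reflBall Ω pt K i)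
        (T := ball (pt i) (K * infDist (pt i) Ω)) Set.inter_subset_left
        (measure_reflBall_ne_zero h hd hne hi0 (hi8.trans hR) hK) (h.ball_lt_top _ _).ne
        (K := B) ((measure_ball_le_reflBall h hd hne hi0 (hi8.trans hR) (L := K) (by linarith)
          (by simp)).trans (mul_le_mul' le_rfl (measure_mono (reflBall_mono hK i)))) f
      have h2 := ENNReal.rpow_le_rpow h1 ht.le
      rw [ENNReal.mul_rpow_of_nonneg _ _ ht.le, ← ENNReal.rpow_mul, one_div_mul_cancel ht.ne',
        ENNReal.rpow_one] at h2
      refine h2.trans (le_of_eq ?_)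
      congr 1
      rw [powAvg, ← ENNReal.rpow_mul, one_div_mul_cancel ht.ne', ENNReal.rpow_one]
    · simp [ht]
  refine ⟨(B ^ (p.toReal / t) * A) ^ (1 / p.toReal), ENNReal.rpow_ne_top_of_nonneg (by positivity)
    (ENNReal.mul_ne_top (ENNReal.rpow_ne_top_of_nonneg (by positivity) hBt) hA), fun f hf => ?_⟩
  rw [eLpNorm_eq_lintegral_ennreal hp0 hp, eLpNorm_eq_lintegral_ennreal hp0 hp,
    ← ENNReal.mul_rpow_of_nonneg _ _ (by positivity)]
  refine ENNReal.rpow_le_rpow ?_ (by positivity)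
  have hexp : t * (p.toReal / t) = p.toReal := mul_div_cancel₀ _ ht.ne'
  calc ∫⁻ x, whitneyAvg μ Ω pt K t f x ^ p.toReal ∂μ
      ≤ ∫⁻ x, B ^ (p.toReal / t) * maxFn μ pt (fun i => K * infDist (pt i) Ω) I
          (fun y => f y ^ t) x ^ (p.toReal / t) ∂μ := by
        refine lintegral_mono fun x => ?_
        have := ENNReal.rpow_le_rpow (hpow f x) (z := p.toReal / t) (by positivity)
        rwa [← ENNReal.rpow_mul, hexp, ENNReal.mul_rpow_of_nonneg _ _ (by positivity)] at this
    _ = B ^ (p.toReal / t) * ∫⁻ x, maxFn μ pt (fun i => K * infDist (pt i) Ω) I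
          (fun y => f y ^ t) x ^ (p.toReal / t) ∂μ :=
        lintegral_const_mul _ ((measurable_maxFn _ _ _ _ _).pow_const _)
    _ ≤ B ^ (p.toReal / t) * (A * ∫⁻ x, (f x ^ t) ^ (p.toReal / t) ∂μ) := by
        gcongr
        exact hA' _ _ _ _ hI' _ (hf.pow_const t)
    _ = _ := by
        simp_rw [← ENNReal.rpow_mul, hexp, mul_assoc]

end Whitney

end HajlaszExt

/-! ### Smoothing at the scale of the distance to a set -/

namespace HajlaszExt

open Metric

section Kernel

variable {X : Type*} [PseudoMetricSpace X]

/-- A Lipschitz bump around `x` supported in the ball of radius `dist(x, Ω) / 8`. -/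
noncomputable def bump (Ω : Set X) (x w : X) : ℝ := max 0 (infDist x Ω / 8 - dist x w)

/-- Averages of `m` against the bump functions. -/
noncomputable def smoothAvg [MeasurableSpace X] (μ : Measure X) (Ω : Set X) (m : X → ℝ) (x : X) :
    ℝ := (∫ w, bump Ω x w * m w ∂μ) / ∫ w, bump Ω x w ∂μ

variable {Ω : Set X}

lemma bump_nonneg (x w : X) : 0 ≤ bump Ω x w := le_max_left _ _

lemma bump_le (x w : X) : bump Ω x w ≤ infDist x Ω / 8 :=
  max_le (div_nonneg infDist_nonneg (by norm_num)) (by linarith [dist_nonneg (x := x) (y := w)])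

lemma bump_eq_zero {x w : X} (h : ¬ dist x w < infDist x Ω / 8) : bump Ω x w = 0 :=
  max_eq_left (by linarith [not_lt.1 h])

lemma abs_bump_sub_le (x y w : X) : |bump Ω x w - bump Ω y w| ≤ 2 * dist x y := by
  have h1 := abs_max_sub_max_le_abs (infDist x Ω / 8 - dist x w) (infDist y Ω / 8 - dist y w) 0
  rw [max_comm _ (0 : ℝ), max_comm _ (0 : ℝ)] at h1
  have h2 := abs_le.1 (abs_infDist_sub_le (Ω := Ω) x y)
  have h3 := abs_le.1 (abs_dist_sub_le x y w)
  have h4 := dist_nonneg (x := x) (y := y)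
  exact h1.trans (abs_le.2 ⟨by linarith, by linarith⟩)

lemma continuous_bump : Continuous (Function.uncurry (bump Ω)) := by
  unfold bump Function.uncurry
  exact continuous_const.max ((((continuous_infDist_pt Ω).comp continuous_fst).div_const 8).sub
    (continuous_fst.dist continuous_snd))

variable [MeasurableSpace X] {μ : Measure X} {C D : ℝ}

lemma real_ball_pos (h : IsDoublingSpace μ C D) (x : X) {r : ℝ} (hr : 0 < r) :
    0 < μ.real (ball x r) :=
  ENNReal.toReal_pos (h.ball_pos x r hr).ne' (h.ball_lt_top x r).ne

variable [OpensMeasurableSpace X]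

lemma measurable_bump (x : X) : Measurable (bump Ω x) :=
  (continuous_bump.comp (Continuous.prodMk_right x)).measurable

lemma integrable_bump_mul (h : IsDoublingSpace μ C D) {m : X → ℝ} (hm : Measurable m) {x : X}
    {B : ℝ} (hB : ∀ w, dist x w < infDist x Ω / 8 → |m w| ≤ B) :
    Integrable (fun w => bump Ω x w * m w) μ := by
  have h1 : Integrable ((ball x (infDist x Ω / 8)).indicator fun _ => infDist x Ω / 8 * B) μ :=
    (integrable_indicator_iff isOpen_ball.measurableSet).2
      (integrableOn_const (h.ball_lt_top _ _).ne)
  refine h1.mono' ((measurable_bump x).mul hm).aestronglyMeasurable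
    (Filter.Eventually.of_forall fun w => ?_)
  by_cases hw : dist x w < infDist x Ω / 8
  · rw [Set.indicator_of_mem (by rwa [mem_ball, dist_comm]), norm_mul, Real.norm_eq_abs,
      abs_of_nonneg (bump_nonneg x w), Real.norm_eq_abs]
    exact mul_le_mul (bump_le x w) (hB w hw) (abs_nonneg _)
      (div_nonneg infDist_nonneg (by norm_num))
  · rw [Set.indicator_of_notMem (by rwa [mem_ball, dist_comm]), bump_eq_zero hw]
    simp

lemma integrable_bump (h : IsDoublingSpace μ C D) (x : X) : Integrable (bump Ω x) μ := by
  simpa using integrable_bump_mul (Ω := Ω) h (m := fun _ => 1) measurable_const (x := x) (B := 1)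
    (by simp)

lemma integral_bump_ge (h : IsDoublingSpace μ C D) (x : X) :
    infDist x Ω / 16 * μ.real (ball x (infDist x Ω / 16)) ≤ ∫ w, bump Ω x w ∂μ := by
  have h1 : ∫ w in ball x (infDist x Ω / 16), (infDist x Ω / 16) ∂μ ≤ ∫ w, bump Ω x w ∂μ := by
    rw [← integral_indicator isOpen_ball.measurableSet]
    refine integral_mono ((integrable_indicator_iff isOpen_ball.measurableSet).2
      (integrableOn_const (h.ball_lt_top _ _).ne)) (integrable_bump h x) fun w => ?_
    by_cases hw : w ∈ ball x (infDist x Ω / 16)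
    · rw [Set.indicator_of_mem hw]
      refine le_max_of_le_right ?_
      rw [mem_ball, dist_comm] at hw
      linarith
    · rw [Set.indicator_of_notMem hw]
      exact bump_nonneg x w
  rwa [setIntegral_const, smul_eq_mul, mul_comm] at h1

lemma integral_bump_pos (h : IsDoublingSpace μ C D) {x : X} (hx : 0 < infDist x Ω) :
    0 < ∫ w, bump Ω x w ∂μ :=
  lt_of_lt_of_le (mul_pos (by positivity) (real_ball_pos h x (by positivity)))
    (integral_bump_ge h x)

/-- Constants are reproduced by the smoothing. Subtracting `c` first means that only the oscillation
of `m` about `c` enters the later estimates. -/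
lemma integral_bump_mul_sub (h : IsDoublingSpace μ C D) {m : X → ℝ} (hm : Measurable m) {x : X}
    (hx : 0 < infDist x Ω) {c B : ℝ} (hB : ∀ w, dist x w < infDist x Ω / 8 → |m w - c| ≤ B) :
    ∫ w, bump Ω x w * (m w - c) ∂μ = (∫ w, bump Ω x w ∂μ) * (smoothAvg μ Ω m x - c) := by
  have hZ := (integral_bump_pos h hx).ne'
  have hi : Integrable (fun w => bump Ω x w * m w) μ :=
    integrable_bump_mul h hm (B := B + |c|) fun w hw => by
      have h1 := abs_add_le (m w - c) c
      rw [sub_add_cancel] at h1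
      linarith [hB w hw]
  simp_rw [mul_sub]
  rw [integral_sub hi ((integrable_bump h x).mul_const c), integral_mul_const, smoothAvg,
    mul_div_cancel₀ _ hZ]

lemma abs_smoothAvg_sub_le (h : IsDoublingSpace μ C D) {m : X → ℝ} (hm : Measurable m) {x : X}
    (hx : 0 < infDist x Ω) {c B : ℝ} (hB : ∀ w, dist x w < infDist x Ω / 8 → |m w - c| ≤ B) :
    |smoothAvg μ Ω m x - c| ≤ B := by
  have hZ := integral_bump_pos h hx
  have h1 : |∫ w, bump Ω x w * (m w - c) ∂μ| ≤ ∫ w, bump Ω x w * B ∂μ := by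
    refine abs_integral_le_integral_abs.trans (integral_mono
      (integrable_bump_mul h (hm.sub_const c) hB).abs ((integrable_bump h x).mul_const B)
      fun w => ?_)
    simp only [abs_mul, abs_of_nonneg (bump_nonneg x w)]
    by_cases hw : dist x w < infDist x Ω / 8
    · exact mul_le_mul_of_nonneg_left (hB w hw) (bump_nonneg x w)
    · rw [bump_eq_zero hw]; simp
  rw [integral_bump_mul_sub h hm hx hB, integral_mul_const, abs_mul, abs_of_pos hZ] at h1
  exact le_of_mul_le_mul_left h1 hZ

/-- Lipschitz bound for the smoothing in terms of the oscillation of `m`. -/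
lemma abs_smoothAvg_sub_smoothAvg_le (h : IsDoublingSpace μ C D) {m : X → ℝ} (hm : Measurable m)
    {x y : X} (hx : 0 < infDist x Ω) (hxy : dist x y ≤ infDist x Ω / 8) {B : ℝ}
    (hB : ∀ w w', dist x w < infDist x Ω / 3 → dist x w' < infDist x Ω / 3 → |m w - m w'| ≤ B) :
    |smoothAvg μ Ω m x - smoothAvg μ Ω m y| ≤ 32 * (C * 8 ^ D) * (dist x y / infDist x Ω * B) := by
  have a := abs_le.1 (abs_infDist_sub_le (Ω := Ω) x y)
  have hy : 0 < infDist y Ω := by linarith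
  have hB0 : 0 ≤ B := (abs_nonneg _).trans (hB x x (by simpa using hx) (by simpa using hx))
  set c := smoothAvg μ Ω m y with hc
  have hmc : ∀ w, dist x w < infDist x Ω / 3 → |m w - c| ≤ B := by
    intro w hw
    rw [abs_sub_comm]
    refine abs_smoothAvg_sub_le h hm hy fun w' hw' => hB w' w ?_ hw
    linarith [dist_triangle x y w']
  have e1 := integral_bump_mul_sub h hm hx (c := c) (B := B) fun w hw => hmc w (by linarith)
  have e2 := integral_bump_mul_sub h hm hy (c := c) (B := B) fun w hw => hmc w (by
    linarith [dist_triangle x y w])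
  -- Since `c` is the smoothed value at `y`, the kernel at `y` annihilates `m - c`. It may be
  -- subtracted freely, which exposes the difference of the two kernels.
  rw [← hc, sub_self, mul_zero] at e2
  have hix := integrable_bump_mul (Ω := Ω) h (hm.sub_const c) (x := x) (B := B)
    fun w hw => hmc w (by linarith)
  have hiy := integrable_bump_mul (Ω := Ω) h (hm.sub_const c) (x := y) (B := B)
    fun w hw => hmc w (by linarith [dist_triangle x y w])
  have hZ := integral_bump_pos h hx
  have h1 : |∫ w, bump Ω x w * (m w - c) ∂μ| ≤
      μ.real (ball x (infDist x Ω / 2)) * (2 * dist x y * B) := by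
    have : ∫ w, bump Ω x w * (m w - c) ∂μ =
        ∫ w, (bump Ω x w * (m w - c) - bump Ω y w * (m w - c)) ∂μ := by
      rw [integral_sub hix hiy, e2, sub_zero]
    rw [this]
    have h2 : ∫ w, (ball x (infDist x Ω / 2)).indicator (fun _ => 2 * dist x y * B) w ∂μ =
        μ.real (ball x (infDist x Ω / 2)) * (2 * dist x y * B) := by
      rw [integral_indicator isOpen_ball.measurableSet, setIntegral_const, smul_eq_mul]
    rw [← h2]
    refine abs_integral_le_integral_abs.trans (integral_mono (hix.sub hiy).abs
      ((integrable_indicator_iff isOpen_ball.measurableSet).2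
        (integrableOn_const (h.ball_lt_top _ _).ne)) fun w => ?_)
    by_cases hw : dist x w < infDist x Ω / 3
    · rw [Set.indicator_of_mem (by rw [mem_ball, dist_comm]; linarith)]
      simp only [← sub_mul, abs_mul]
      exact mul_le_mul (abs_bump_sub_le x y w) (hmc w hw) (abs_nonneg _) (by positivity)
    · have h3 : bump Ω x w = 0 := bump_eq_zero (by linarith [not_lt.1 hw])
      have h4 : bump Ω y w = 0 := bump_eq_zero (by linarith [not_lt.1 hw, dist_triangle x y w])
      simp only [h3, h4, zero_mul, sub_self, abs_zero]
      exact Set.indicator_nonneg (fun _ _ => by positivity) _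
  rw [e1, abs_mul, abs_of_pos hZ] at h1
  have hdoub : μ.real (ball x (infDist x Ω / 2)) ≤
      C * 8 ^ D * μ.real (ball x (infDist x Ω / 16)) := by
    have h5 := h.ball_le_ball (x := x) (y := x) (r := infDist x Ω / 16) (R := infDist x Ω / 2)
      (L := 8) (by positivity) (by norm_num) (by rw [dist_self]; linarith)
    have h6 := ENNReal.toReal_mono (ENNReal.mul_ne_top ENNReal.ofReal_ne_top
      (h.ball_lt_top _ _).ne) h5
    have := h.const_pos
    rwa [ENNReal.toReal_mul, ENNReal.toReal_ofReal (by positivity)] at h6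
  have hge := integral_bump_ge (Ω := Ω) h x
  have hb := real_ball_pos h x (r := infDist x Ω / 16) (by positivity)
  set Z := ∫ w, bump Ω x w ∂μ with hZdef
  set b := μ.real (ball x (infDist x Ω / 16)) with hbdef
  set δ := infDist x Ω with hδ
  have h7 : δ / 16 * b * |smoothAvg μ Ω m x - c| ≤ C * 8 ^ D * b * (2 * dist x y * B) := by
    refine le_trans (mul_le_mul_of_nonneg_right hge (abs_nonneg _)) (h1.trans ?_)
    exact mul_le_mul_of_nonneg_right hdoub (by positivity)
  -- The 32 is the Lipschitz constant 2 of the bumps times the 16 from the lower bound for the mass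
  -- of the kernel; the 8 is the ratio of the radii `δ / 2` and `δ / 16`.
  have h8 : δ / 16 * b * (32 * (C * 8 ^ D) * (dist x y / δ * B)) =
      C * 8 ^ D * b * (2 * dist x y * B) := by
    field_simp
    ring
  rw [← h8] at h7
  exact le_of_mul_le_mul_left h7 (by positivity)

lemma measurable_smoothAvg [SecondCountableTopology X] [SFinite μ] {m : X → ℝ}
    (hm : Measurable m) : Measurable (smoothAvg μ Ω m) := by
  have hb : Measurable (Function.uncurry (bump Ω)) := continuous_bump.measurable
  refine Measurable.div ?_ ?_
  · exact (StronglyMeasurable.integral_prod_right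
      (f := fun x w => bump Ω x w * m w)
      (hb.mul (hm.comp measurable_snd)).stronglyMeasurable).measurable
  · exact (StronglyMeasurable.integral_prod_right (f := bump Ω) hb.stronglyMeasurable).measurable

end Kernel

end HajlaszExt

/-! ### The extension and its gradient -/

namespace HajlaszExt

open Metric

section Smooth

variable {X : Type*} [PseudoMetricSpace X] [MeasurableSpace X] [OpensMeasurableSpace X]
  {μ : Measure X} {C D : ℝ} {Ω : Set X}

lemma edist_smoothAvg_le (h : IsDoublingSpace μ C D) {m : X → ℝ} (hm : Measurable m) {x : X}
    (hx : 0 < infDist x Ω) {c : ℝ} {B : ℝ≥0∞}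
    (hB : ∀ w, dist x w < infDist x Ω / 8 → edist (m w) c ≤ B) :
    edist (smoothAvg μ Ω m x) c ≤ B := by
  by_cases hBt : B = ∞
  · rw [hBt]; exact le_top
  have : ∀ w, dist x w < infDist x Ω / 8 → |m w - c| ≤ B.toReal := fun w hw => by
    have := hB w hw
    rwa [edist_dist, ENNReal.ofReal_le_iff_le_toReal hBt, Real.dist_eq] at this
  rw [edist_dist, ENNReal.ofReal_le_iff_le_toReal hBt, Real.dist_eq]
  exact abs_smoothAvg_sub_le h hm hx this

lemma edist_smoothAvg_smoothAvg_le (h : IsDoublingSpace μ C D) {m : X → ℝ} (hm : Measurable m)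
    {x y : X} (hx : 0 < infDist x Ω) (hxy : dist x y ≤ infDist x Ω / 8) {B : ℝ≥0∞} {η : ℝ}
    (hη : 0 < η) (hη' : dist x y / infDist x Ω ≤ η)
    (hB : ∀ w w', dist x w < infDist x Ω / 3 → dist x w' < infDist x Ω / 3 →
      edist (m w) (m w') ≤ B) :
    edist (smoothAvg μ Ω m x) (smoothAvg μ Ω m y) ≤
      ENNReal.ofReal (32 * (C * 8 ^ D)) * (ENNReal.ofReal η * B) := by
  have hC := h.const_pos
  by_cases hBt : B = ∞
  · rw [hBt, ENNReal.mul_top (ENNReal.ofReal_pos.2 hη).ne',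
      ENNReal.mul_top (ENNReal.ofReal_pos.2 (by positivity)).ne']
    exact le_top
  have : ∀ w w', dist x w < infDist x Ω / 3 → dist x w' < infDist x Ω / 3 →
      |m w - m w'| ≤ B.toReal := fun w w' hw hw' => by
    have := hB w w' hw hw'
    rwa [edist_dist, ENNReal.ofReal_le_iff_le_toReal hBt, Real.dist_eq] at this
  have key := abs_smoothAvg_sub_smoothAvg_le h hm hx hxy this
  rw [edist_dist, Real.dist_eq, ← ENNReal.ofReal_toReal hBt, ← ENNReal.ofReal_mul hη.le,
    ← ENNReal.ofReal_mul (by positivity)]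
  refine ENNReal.ofReal_le_ofReal (key.trans ?_)
  gcongr

end Smooth

/-! ### Ball gradients, reference values and the gradient estimate for the extension. -/

section Extension

variable {X : Type*} [PseudoMetricSpace X]

/-- `W k` controls the oscillation of `u` on `Ω` at scale `b ^ (-k)`, outside of `E`. -/
structure IsBallGradient [MeasurableSpace X] (Ω : Set X) (b : ℝ) (u : X → ℝ) (W : ℤ → X → ℝ≥0∞)
    (E : Set X) : Prop where
  measurable : ∀ k, Measurable (W k)
  antitone : ∀ (k : ℤ) (n : ℕ) x, W (k + n) x ≤ W k x
  bound : ∀ (k : ℤ) (x y : X), x ∈ Ω → y ∈ Ω → x ∉ E → y ∉ E → dist x y < b ^ (-k) →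
    edist (u x) (u y) ≤ W k x + W k y

/-- Reference values for `u` on the reflected balls. -/
structure IsReference [MeasurableSpace X] (μ : Measure X) (Ω : Set X) (pt : ℕ → X) (b K t : ℝ)
    (A : ℝ≥0∞) (u : X → ℝ) (W : ℤ → X → ℝ≥0∞) (E : Set X) (a : ℕ → ℝ) : Prop where
  far : ∀ i, 1 ≤ infDist (pt i) Ω → a i = 0
  near : ∀ i, 0 < infDist (pt i) Ω → infDist (pt i) Ω < 1 → ∀ k : ℤ,
    12 * infDist (pt i) Ω ≤ b ^ (-k) → ∀ y ∈ reflBall Ω pt 3 i, y ∉ E →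
      edist (a i) (u y) ≤ A * (powAvg μ t (reflBall Ω pt K i) (W k) + W k y)

/-- The extension of `u` from `Ω` built from reference values. -/
noncomputable def extendBy [MeasurableSpace X] (μ : Measure X) (Ω : Set X) (pt : ℕ → X)
    (a : ℕ → ℝ) (u : X → ℝ) (x : X) : ℝ :=
  open Classical in
  if x ∈ Ω then u x else if 0 < infDist x Ω then
    smoothAvg μ Ω (fun w => a (whitneyIndex Ω pt w)) x else 0

variable {Ω : Set X} {pt : ℕ → X}

/-- The distance to `Ω` at `w` is at most `4 / 3` of that at `x`, and `1 / 3 + (4 / 3) / 8 = 1 / 2`.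
-/
lemma dist_whitneyIndex_lt (hpt : DenseRange pt) {x w : X} (hx : 0 < infDist x Ω)
    (hw : dist x w < infDist x Ω / 3) : dist x (pt (whitneyIndex Ω pt w)) < infDist x Ω / 2 := by
  have a := abs_le.1 (abs_infDist_sub_le (Ω := Ω) x w)
  have hw0 : 0 < infDist w Ω := by linarith
  linarith [dist_whitneyIndex hpt hw0, dist_triangle x w (pt (whitneyIndex Ω pt w))]

lemma dist_lt_of_mem_reflBall {x z : X} {i : ℕ}
    (hi : dist x (pt i) < infDist x Ω / 2) (hz : z ∈ reflBall Ω pt 3 i) :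
    dist x z < 5 * infDist x Ω := by
  have ai := abs_le.1 (abs_infDist_sub_le (Ω := Ω) x (pt i))
  have := mem_ball.1 hz.1
  linarith [dist_triangle x (pt i) z, dist_comm z (pt i)]

/-- The standing assumptions of the construction. -/
structure WhitneySetup [MeasurableSpace X] (μ : Measure X) (Ω : Set X) (pt : ℕ → X) (C D : ℝ)
    (M : ℝ≥0∞) (R K t : ℝ) : Prop where
  doubling : IsDoublingSpace μ C D
  density : HasDensity μ Ω M R
  density_ne_top : M ≠ ∞
  measurableSet : MeasurableSet Ω
  nonempty : Ω.Nonempty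
  dense : DenseRange pt
  radius : 8 ≤ R
  exponent_pos : 0 < t
  three_le : 3 ≤ K

/-- The comparison constant for averages over nearby reflected balls. -/
noncomputable def avgConst (C D : ℝ) (M : ℝ≥0∞) (K t : ℝ) : ℝ≥0∞ :=
  (ENNReal.ofReal (C * (9 * K + 10) ^ D) * M) ^ (1 / t)

variable [MeasurableSpace X]
  {μ : Measure X} {C D : ℝ} {M : ℝ≥0∞} {R b K t : ℝ} {A : ℝ≥0∞} {u : X → ℝ} {W : ℤ → X → ℝ≥0∞}
  {E : Set X} {a : ℕ → ℝ}

/-- Averages attached to any index near `x` are referred to the canonical index of `x`, so that the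
final bounds are functions of `x` alone. -/
lemma powAvg_le_whitneyAvg (S : WhitneySetup μ Ω pt C D M R K t) {x : X}
    (hx : 0 < infDist x Ω) (hx4 : infDist x Ω < 4) {L : ℝ} (hL : 3 ≤ L) (hLK : L ≤ K) {i : ℕ}
    (hi : dist x (pt i) < infDist x Ω / 2) (f : X → ℝ≥0∞) :
    powAvg μ t (reflBall Ω pt L i) f ≤
      avgConst C D M K t * whitneyAvg μ Ω pt (3 * K + 2) t f x := by
  obtain ⟨h, hd, -, hΩ, hne, hpt, hR, ht, hK⟩ := id S
  unfold whitneyAvg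
  rw [if_pos ⟨hx, hx4⟩]
  exact powAvg_reflBall_le h hd hne ht hx (by linarith) hL hLK hi
    (by linarith [dist_whitneyIndex hpt hx]) f

variable [OpensMeasurableSpace X]

/-- A good point of the reflected ball. -/
lemma exists_good_point (S : WhitneySetup μ Ω pt C D M R K t) {x : X}
    (hx : 0 < infDist x Ω) (hx4 : infDist x Ω < 4) {i : ℕ}
    (hi : dist x (pt i) < infDist x Ω / 2) (hE : μ E = 0) {f : X → ℝ≥0∞} (hf : Measurable f) :
    ∃ z ∈ reflBall Ω pt 3 i, z ∉ E ∧
      f z ≤ avgConst C D M K t * whitneyAvg μ Ω pt (3 * K + 2) t f x := by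
  obtain ⟨h, hd, -, hΩ, hne, hpt, hR, ht, hK⟩ := id S
  have ai := abs_le.1 (abs_infDist_sub_le (Ω := Ω) x (pt i))
  have hi0 : 0 < infDist (pt i) Ω := by linarith
  have hi8 : infDist (pt i) Ω ≤ R := by linarith
  obtain ⟨z, hz, hzE, hzf⟩ := exists_mem_le_powAvg ht (measurableSet_reflBall hΩ 3 i)
    (measure_reflBall_ne_zero h hd hne hi0 hi8 le_rfl) (measure_reflBall_ne_top h _ _) hE hf
  exact ⟨z, hz, hzE, hzf.trans (powAvg_le_whitneyAvg S hx hx4 le_rfl hK hi f)⟩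

/-- The path goes from the reference value to `u y` through a good point of the reflected ball,
which lies within 5 times the distance from `x` to `Ω`. The factor 18 comes from `12 * (3 / 2)`, the
scale required in `IsReference.near`. -/
lemma IsReference.edist_apply_le (ha : IsReference μ Ω pt b K t A u W E a)
    (hW : IsBallGradient Ω b u W E) (S : WhitneySetup μ Ω pt C D M R K t)
    (hE : μ E = 0) {x y : X} (hx : 0 < infDist x Ω) (hy : y ∈ Ω) (hyE : y ∉ E)
    {i : ℕ} (hi : dist x (pt i) < infDist x Ω / 2) (hi1 : infDist (pt i) Ω < 1) {k : ℤ}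
    (hk : dist x y + 18 * infDist x Ω ≤ b ^ (-k)) :
    edist (a i) (u y) ≤ ((2 * A + 1) * avgConst C D M K t) *
      whitneyAvg μ Ω pt (3 * K + 2) t (W k) x + W k y := by
  obtain ⟨h, hd, -, hΩ, hne, hpt, hR, ht, hK⟩ := id S
  have ai := abs_le.1 (abs_infDist_sub_le (Ω := Ω) x (pt i))
  have hi0 : 0 < infDist (pt i) Ω := by linarith
  have hx4 : infDist x Ω < 4 := by linarith
  obtain ⟨z, hz, hzE, hzW⟩ := exists_good_point S hx hx4 hi hE
    (hW.measurable k)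
  have hd0 := dist_nonneg (x := x) (y := y)
  have h1 := ha.near i hi0 hi1 k (by linarith) z hz hzE
  have h2 := hW.bound k z y hz.2 hy hzE hyE (by
    have := dist_lt_of_mem_reflBall hi hz
    linarith [dist_triangle_left z y x])
  have h3 := powAvg_le_whitneyAvg S hx hx4 hK le_rfl hi (W k)
  set c := avgConst C D M K t
  set V := whitneyAvg μ Ω pt (3 * K + 2) t (W k) x
  calc edist (a i) (u y) ≤ edist (a i) (u z) + edist (u z) (u y) := edist_triangle _ _ _
    _ ≤ A * (c * V + c * V) + (c * V + W k y) :=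
        add_le_add (h1.trans (by gcongr)) (h2.trans (by gcongr))
    _ = _ := by ring

/-- A good point of the second reflected ball lies in `Ω`, so the comparison with a value of `u` on
`Ω` applies to it; the second reference value is then compared with that same value. -/
lemma IsReference.edist_le (ha : IsReference μ Ω pt b K t A u W E a)
    (hW : IsBallGradient Ω b u W E) (S : WhitneySetup μ Ω pt C D M R K t)
    (hE : μ E = 0) {x y : X} (hx : 0 < infDist x Ω) (hy : 0 < infDist y Ω)
    {i j : ℕ} (hi : dist x (pt i) < infDist x Ω / 2) (hi1 : infDist (pt i) Ω < 1)
    (hj : dist y (pt j) < infDist y Ω / 2) (hj1 : infDist (pt j) Ω < 1) {k : ℤ}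
    (hk : dist x y + 18 * infDist x Ω + 18 * infDist y Ω ≤ b ^ (-k)) :
    edist (a i) (a j) ≤ ((2 * A + 1) * avgConst C D M K t) *
      (whitneyAvg μ Ω pt (3 * K + 2) t (W k) x + whitneyAvg μ Ω pt (3 * K + 2) t (W k) y) := by
  obtain ⟨h, hd, -, hΩ, hne, hpt, hR, ht, hK⟩ := id S
  have aj := abs_le.1 (abs_infDist_sub_le (Ω := Ω) y (pt j))
  have hj0 : 0 < infDist (pt j) Ω := by linarith
  have hy4 : infDist y Ω < 4 := by linarith
  obtain ⟨z, hz, hzE, hzW⟩ := exists_good_point S hy hy4 hj hE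
    (hW.measurable k)
  have hd0 := dist_nonneg (x := x) (y := y)
  have h1 := ha.near j hj0 hj1 k (by linarith) z hz hzE
  have h2 := ha.edist_apply_le hW S hE hx hz.2 hzE hi hi1 (k := k) (by
    have := dist_lt_of_mem_reflBall hj hz
    linarith [dist_triangle x y z])
  have h3 := powAvg_le_whitneyAvg S hy hy4 hK le_rfl hj (W k)
  set c := avgConst C D M K t
  set V := whitneyAvg μ Ω pt (3 * K + 2) t (W k) x
  set V' := whitneyAvg μ Ω pt (3 * K + 2) t (W k) y
  calc edist (a i) (a j) ≤ edist (a i) (u z) + edist (u z) (a j) := edist_triangle _ _ _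
    _ ≤ ((2 * A + 1) * c * V + c * V') + A * (c * V' + c * V') := by
        rw [edist_comm (u z)]
        exact add_le_add (h2.trans (by gcongr)) (h1.trans (by gcongr))
    _ = _ := by ring

/-- Far indices carry the value 0. For near ones a good point is chosen for the sum of `‖u‖ₑ` and `W
k`, so that one point controls both. -/
lemma IsReference.enorm_le (ha : IsReference μ Ω pt b K t A u W E a)
    (hW : IsBallGradient Ω b u W E) (hu : Measurable u) (S : WhitneySetup μ Ω pt C D M R K t)
    (hE : μ E = 0) {x : X} (hx : 0 < infDist x Ω) {i : ℕ}
    (hi : dist x (pt i) < infDist x Ω / 2) {k : ℤ}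
    (hk : 12 ≤ b ^ (-k)) :
    edist (a i) 0 ≤ ((2 * A + 1) * avgConst C D M K t) *
      whitneyAvg μ Ω pt (3 * K + 2) t (fun y => ‖u y‖ₑ + W k y) x := by
  obtain ⟨h, hd, -, hΩ, hne, hpt, hR, ht, hK⟩ := id S
  have ai := abs_le.1 (abs_infDist_sub_le (Ω := Ω) x (pt i))
  have hi0 : 0 < infDist (pt i) Ω := by linarith
  rcases le_or_gt 1 (infDist (pt i) Ω) with hi1 | hi1
  · rw [ha.far i hi1, edist_self]; exact zero_le
  have hx4 : infDist x Ω < 4 := by linarith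
  obtain ⟨z, hz, hzE, hzW⟩ := exists_good_point S hx hx4 hi hE
    (hu.enorm.add (hW.measurable k))
  have h1 := ha.near i hi0 hi1 k (by linarith) z hz hzE
  have h3 := powAvg_le_whitneyAvg S hx hx4 hK le_rfl hi (W k)
  have h4 := whitneyAvg_mono (μ := μ) (Ω := Ω) (pt := pt) ht (3 * K + 2) (f := W k)
    (g := fun y => ‖u y‖ₑ + W k y) (fun _ => le_add_self) x
  set c := avgConst C D M K t
  set V := whitneyAvg μ Ω pt (3 * K + 2) t (fun y => ‖u y‖ₑ + W k y) x
  have hzW' : ‖u z‖ₑ + W k z ≤ c * V := hzW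
  calc edist (a i) 0 ≤ edist (a i) (u z) + edist (u z) 0 := edist_triangle _ _ _
    _ ≤ A * (c * V + c * V) + c * V := by
        refine add_le_add (h1.trans ?_) ?_
        · gcongr
          · exact h3.trans (by gcongr)
          · exact le_add_self.trans hzW'
        · rw [edist_zero_right]
          exact le_self_add.trans hzW'
    _ = _ := by ring

/-- The size function controlling the extension. -/
noncomputable def extSize (μ : Measure X) (Ω : Set X) (pt : ℕ → X) (K t : ℝ) (N : ℕ) (u : X → ℝ)
    (W : ℤ → X → ℝ≥0∞) (x : X) : ℝ≥0∞ :=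
  Ω.indicator (fun y => ‖u y‖ₑ) x +
    whitneyAvg μ Ω pt (3 * K + 2) t (fun y => ‖u y‖ₑ + W (-N) y) x

/-- The ball gradient of the extension. -/
noncomputable def extGrad (μ : Measure X) (Ω : Set X) (pt : ℕ → X) (b K t : ℝ) (N : ℕ) (u : X → ℝ)
    (W : ℤ → X → ℝ≥0∞) (k : ℤ) (x : X) : ℝ≥0∞ :=
  Ω.indicator (W (k - N)) x +
    (⨆ n : ℕ, ENNReal.ofReal ((b ^ n)⁻¹) * whitneyAvg μ Ω pt (3 * K + 2) t (W (k - N - n)) x) +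
    ENNReal.ofReal (min 1 (b ^ (-k))) * extSize μ Ω pt K t N u W x

lemma measurable_ref (hpt : DenseRange pt) (a : ℕ → ℝ) :
    Measurable (fun w => a (whitneyIndex Ω pt w)) :=
  (measurable_from_nat (f := a)).comp (measurable_whitneyIndex hpt)

lemma IsReference.enorm_extendBy_le (ha : IsReference μ Ω pt b K t A u W E a)
    (hW : IsBallGradient Ω b u W E) (hu : Measurable u) (S : WhitneySetup μ Ω pt C D M R K t)
    (hE : μ E = 0) {N : ℕ} (hN : 12 ≤ b ^ N) (x : X) :
    ‖extendBy μ Ω pt a u x‖ₑ ≤ (1 + (2 * A + 1) * avgConst C D M K t) *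
      extSize μ Ω pt K t N u W x := by
  obtain ⟨h, hd, -, hΩ, hne, hpt, hR, ht, hK⟩ := id S
  unfold extendBy extSize
  by_cases hx : x ∈ Ω
  · rw [if_pos hx, Set.indicator_of_mem hx]
    have h1 : (1 : ℝ≥0∞) ≤ 1 + (2 * A + 1) * avgConst C D M K t := le_self_add
    exact le_self_add.trans (le_mul_of_one_le_left zero_le h1)
  rw [if_neg hx, Set.indicator_of_notMem hx, zero_add]
  by_cases hx0 : 0 < infDist x Ω
  · rw [if_pos hx0, ← edist_zero_right]
    refine (edist_smoothAvg_le h (measurable_ref hpt a) hx0 fun w hw =>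
      ha.enorm_le hW hu S hE hx0
        (dist_whitneyIndex_lt hpt hx0 (by linarith)) (k := -N) (by simpa using hN)).trans ?_
    exact mul_le_mul' le_add_self le_rfl
  · rw [if_neg hx0]; simp

/-- Estimate for the extension between two points outside `Ω`. -/
lemma IsReference.edist_smoothAvg_le (ha : IsReference μ Ω pt b K t A u W E a)
    (hW : IsBallGradient Ω b u W E) (hu : Measurable u) (S : WhitneySetup μ Ω pt C D M R K t)
    (hE : μ E = 0) (hb : 1 < b) {N : ℕ} (hN : 300 * b ≤ b ^ N) {k : ℤ} (hk : b ^ (-k) < 1 / 32)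
    {x y : X} (hx : 0 < infDist x Ω) (hy : 0 < infDist y Ω) (hxy : dist x y < b ^ (-k))
    (hle : infDist y Ω ≤ infDist x Ω) :
    edist (smoothAvg μ Ω (fun w => a (whitneyIndex Ω pt w)) x)
      (smoothAvg μ Ω (fun w => a (whitneyIndex Ω pt w)) y) ≤
        ((1 + 4 * ENNReal.ofReal (32 * (C * 8 ^ D))) * ((2 * A + 1) * avgConst C D M K t)) *
          (extGrad μ Ω pt b K t N u W k x + extGrad μ Ω pt b K t N u W k y) := by
  obtain ⟨h, hd, -, hΩ, hne, hpt, hR, ht, hK⟩ := id S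
  set c := (2 * A + 1) * avgConst C D M K t with hc
  set C' := ENNReal.ofReal (32 * (C * 8 ^ D)) with hC'
  have hb0 : 0 < b := by linarith
  have hbk : 0 < b ^ (-k) := zpow_pos hb0 _
  have hN1 : 300 ≤ b ^ N := by nlinarith
  have hm := measurable_ref (Ω := Ω) hpt a
  have hscale : ∀ j : ℤ, b ^ (-(j - N)) = b ^ N * b ^ (-j) := fun j => by
    rw [neg_sub, sub_eq_add_neg, zpow_add₀ hb0.ne', zpow_natCast]
  have hterm : ∀ (n : ℕ) (x : X), ENNReal.ofReal ((b ^ n)⁻¹) *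
      whitneyAvg μ Ω pt (3 * K + 2) t (W (k - N - n)) x ≤ extGrad μ Ω pt b K t N u W k x :=
    fun n x => (le_iSup (fun n : ℕ => ENNReal.ofReal ((b ^ n)⁻¹) *
      whitneyAvg μ Ω pt (3 * K + 2) t (W (k - N - n)) x) n).trans
        (le_add_self.trans le_self_add)
  have hone : (1 : ℝ≥0∞) ≤ 1 + 4 * C' := le_self_add
  -- Near `Ω` relative to the scale no smoothness of the kernel is used. All points involved fit
  -- into the scale `289 * b ^ (-k)`, since `1 + 2 * 18 * 8 = 289`, and `300 ≤ b ^ N`. All indices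
  -- involved are near ones because `b ^ (-k) < 1 / 32`.
  rcases le_or_gt (infDist x Ω) (8 * b ^ (-k)) with h8 | h8
  · have hscl : dist x y + 18 * infDist x Ω + 18 * infDist y Ω ≤ b ^ (-(k - N)) := by
      rw [hscale]; nlinarith
    have hB : ∀ w w', dist x w < infDist x Ω / 8 → dist y w' < infDist y Ω / 8 →
        edist (a (whitneyIndex Ω pt w)) (a (whitneyIndex Ω pt w')) ≤
          c * (extGrad μ Ω pt b K t N u W k x + extGrad μ Ω pt b K t N u W k y) := by
      intro w w' hw hw'
      have hi := dist_whitneyIndex_lt hpt hx (w := w) (by linarith)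
      have hj := dist_whitneyIndex_lt hpt hy (w := w') (by linarith)
      have ai := abs_le.1 (abs_infDist_sub_le (Ω := Ω) x (pt (whitneyIndex Ω pt w)))
      have aj := abs_le.1 (abs_infDist_sub_le (Ω := Ω) y (pt (whitneyIndex Ω pt w')))
      refine (ha.edist_le hW S hE hx hy hi (by linarith) hj (by linarith) hscl).trans ?_
      have h1 := hterm 0 x
      have h2 := hterm 0 y
      simp only [pow_zero, inv_one, ENNReal.ofReal_one, one_mul, Nat.cast_zero, sub_zero] at h1 h2
      exact mul_le_mul' le_rfl (add_le_add h1 h2)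
    refine le_trans (HajlaszExt.edist_smoothAvg_le h hm hx fun w hw => ?_)
      (mul_le_mul' (le_mul_of_one_le_left zero_le hone) le_rfl)
    rw [edist_comm]
    exact HajlaszExt.edist_smoothAvg_le h hm hy fun w' hw' => by
      rw [edist_comm]; exact hB w w' hw hw'
  · have hxy8 : dist x y ≤ infDist x Ω / 8 := by linarith
    rcases lt_or_ge (infDist x Ω) (1 / 2) with hx2 | hx2
    -- The distance to `Ω` is between `b ^ n` and `b ^ (n + 1)` times `b ^ (-k)`. The Lipschitz
    -- bound for the smoothing yields the gain `b ^ (-n)`, at the price of reading the gradient at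
    -- the coarser scale `k - N - n`.
    · obtain ⟨n, hn1, hn2⟩ := exists_nat_pow_near (x := infDist x Ω * b ^ k) (y := b) (by
        have : b ^ (-k) * b ^ k = 1 := by rw [← zpow_add₀ hb0.ne']; simp
        nlinarith [zpow_pos hb0 k]) hb
      have hbkk : b ^ (-k) * b ^ k = 1 := by rw [← zpow_add₀ hb0.ne']; simp
      have hbk' := zpow_pos hb0 k
      have hn0 : 0 < b ^ n := pow_pos hb0 n
      have e1 : b ^ (-k) / infDist x Ω ≤ (b ^ n)⁻¹ := by
        rw [div_le_iff₀ hx, ← div_eq_inv_mul, le_div_iff₀ hn0]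
        calc b ^ (-k) * b ^ n ≤ b ^ (-k) * (infDist x Ω * b ^ k) := by gcongr
          _ = infDist x Ω * (b ^ (-k) * b ^ k) := by ring
          _ = infDist x Ω := by rw [hbkk, mul_one]
      have e2 : 40 * infDist x Ω ≤ b ^ (-(k - N - n)) := by
        have : b ^ (-(k - N - n)) = b ^ N * b ^ n * b ^ (-k) := by
          rw [show (-(k - N - n) : ℤ) = N + n + -k by ring, zpow_add₀ hb0.ne', zpow_add₀ hb0.ne',
            zpow_natCast, zpow_natCast]
        rw [this]
        have h1 : infDist x Ω ≤ b ^ (-k) * (b * b ^ n) := by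
          have h2 : b ^ (-k) * (infDist x Ω * b ^ k) ≤ b ^ (-k) * (b * b ^ n) := by
            rw [← pow_succ']; gcongr
          calc infDist x Ω = infDist x Ω * (b ^ (-k) * b ^ k) := by rw [hbkk, mul_one]
            _ = b ^ (-k) * (infDist x Ω * b ^ k) := by ring
            _ ≤ _ := h2
        have h3 : 0 < b ^ (-k) * b ^ n := by positivity
        calc 40 * infDist x Ω ≤ 40 * (b ^ (-k) * (b * b ^ n)) := by gcongr
          _ = (40 * b) * (b ^ (-k) * b ^ n) := by ring
          _ ≤ b ^ N * (b ^ (-k) * b ^ n) := by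
              gcongr
              linarith
          _ = _ := by ring
      have hB : ∀ w w', dist x w < infDist x Ω / 3 → dist x w' < infDist x Ω / 3 →
          edist (a (whitneyIndex Ω pt w)) (a (whitneyIndex Ω pt w')) ≤
            c * (2 * whitneyAvg μ Ω pt (3 * K + 2) t (W (k - N - n)) x) := by
        intro w w' hw hw'
        have hi := dist_whitneyIndex_lt hpt hx hw
        have hj := dist_whitneyIndex_lt hpt hx hw'
        have ai := abs_le.1 (abs_infDist_sub_le (Ω := Ω) x (pt (whitneyIndex Ω pt w)))
        have aj := abs_le.1 (abs_infDist_sub_le (Ω := Ω) x (pt (whitneyIndex Ω pt w')))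
        rw [two_mul]
        exact ha.edist_le hW S hE hx hx hi (by linarith) hj (by linarith)
          (by rw [dist_self]; linarith)
      refine (edist_smoothAvg_smoothAvg_le h hm hx hxy8 (inv_pos.2 hn0) (le_trans (by gcongr) e1)
        hB).trans ?_
      calc C' * (ENNReal.ofReal ((b ^ n)⁻¹) *
            (c * (2 * whitneyAvg μ Ω pt (3 * K + 2) t (W (k - N - n)) x)))
          = (2 * C' * c) * (ENNReal.ofReal ((b ^ n)⁻¹) *
              whitneyAvg μ Ω pt (3 * K + 2) t (W (k - N - n)) x) := by ring
        _ ≤ ((1 + 4 * C') * c) * (extGrad μ Ω pt b K t N u W k x +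
              extGrad μ Ω pt b K t N u W k y) := by
            refine mul_le_mul' (mul_le_mul' (le_trans ?_ le_add_self) le_rfl)
              ((hterm n x).trans le_self_add)
            exact mul_le_mul' (by norm_num) le_rfl
    -- Here the cutoff of the reference values may be felt, so their oscillation is bounded by their
    -- size. The Lipschitz factor is at most `2 * b ^ (-k)` because the distance to `Ω` is at least
    -- `1 / 2`.
    · set V := whitneyAvg μ Ω pt (3 * K + 2) t (fun y => ‖u y‖ₑ + W (-N) y) x with hV
      have hB : ∀ w w', dist x w < infDist x Ω / 3 → dist x w' < infDist x Ω / 3 →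
          edist (a (whitneyIndex Ω pt w)) (a (whitneyIndex Ω pt w')) ≤ c * (2 * V) := by
        intro w w' hw hw'
        have hi := ha.enorm_le hW hu S hE hx (dist_whitneyIndex_lt hpt hx hw) (k := -N)
          (by rw [neg_neg, zpow_natCast]; linarith)
        have hj := ha.enorm_le hW hu S hE hx (dist_whitneyIndex_lt hpt hx hw') (k := -N)
          (by rw [neg_neg, zpow_natCast]; linarith)
        rw [two_mul, mul_add]
        refine (edist_triangle _ 0 _).trans (add_le_add hi ?_)
        rw [edist_comm]; exact hj
      have hη : dist x y / infDist x Ω ≤ 2 * b ^ (-k) := by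
        rw [div_le_iff₀ hx]; nlinarith
      refine (edist_smoothAvg_smoothAvg_le h hm hx hxy8 (η := 2 * b ^ (-k)) (by positivity) hη
        hB).trans ?_
      have hV' : ENNReal.ofReal (b ^ (-k)) * V ≤ extGrad μ Ω pt b K t N u W k x := by
        unfold extGrad
        refine le_trans ?_ le_add_self
        rw [min_eq_right (by linarith)]
        exact mul_le_mul' le_rfl le_add_self
      rw [ENNReal.ofReal_mul zero_le_two, ENNReal.ofReal_ofNat]
      calc C' * (2 * ENNReal.ofReal (b ^ (-k)) * (c * (2 * V)))
          = (4 * C' * c) * (ENNReal.ofReal (b ^ (-k)) * V) := by ring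
        _ ≤ _ := mul_le_mul' (mul_le_mul' le_add_self le_rfl) (hV'.trans le_self_add)

/-- The constant in the gradient estimate for the extension. -/
noncomputable def extConst (C D : ℝ) (M : ℝ≥0∞) (K t : ℝ) (A : ℝ≥0∞) : ℝ≥0∞ :=
  32 * ((1 + 4 * ENNReal.ofReal (32 * (C * 8 ^ D))) * (1 + (2 * A + 1) * avgConst C D M K t))

/-- The gradient estimate for the extension. -/
lemma IsReference.edist_extendBy_le (ha : IsReference μ Ω pt b K t A u W E a)
    (hW : IsBallGradient Ω b u W E) (hu : Measurable u) (S : WhitneySetup μ Ω pt C D M R K t)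
    (hE : μ E = 0) (hb : 1 < b) {N : ℕ} (hN : 300 * b ≤ b ^ N) {k : ℤ} {x y : X}
    (hxE : x ∉ E) (hyE : y ∉ E) (hx : x ∈ Ω ∨ 0 < infDist x Ω) (hy : y ∈ Ω ∨ 0 < infDist y Ω)
    (hxy : dist x y < b ^ (-k)) :
    edist (extendBy μ Ω pt a u x) (extendBy μ Ω pt a u y) ≤ extConst C D M K t A *
      (extGrad μ Ω pt b K t N u W k x + extGrad μ Ω pt b K t N u W k y) := by
  obtain ⟨h, hd, -, hΩ, hne, hpt, hR, ht, hK⟩ := id S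
  set c := (2 * A + 1) * avgConst C D M K t with hc
  set C' := ENNReal.ofReal (32 * (C * 8 ^ D)) with hC'
  have hT : extConst C D M K t A = 32 * ((1 + 4 * C') * (1 + c)) := rfl
  have hone : (1 : ℝ≥0∞) ≤ 1 + 4 * C' := le_self_add
  have hone' : (1 : ℝ≥0∞) ≤ 1 + c := le_self_add
  have h32 : (1 : ℝ≥0∞) ≤ 32 := by norm_num
  have hT1 : (1 + 4 * C') * c ≤ extConst C D M K t A := by
    rw [hT]
    exact (mul_le_mul' le_rfl le_add_self).trans (le_mul_of_one_le_left zero_le h32)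
  have hT2 : 1 + c ≤ extConst C D M K t A := by
    rw [hT]
    exact (le_mul_of_one_le_left zero_le hone).trans (le_mul_of_one_le_left zero_le h32)
  have hT3 : 32 * (1 + c) ≤ extConst C D M K t A := by
    rw [hT]
    exact mul_le_mul' le_rfl (le_mul_of_one_le_left zero_le hone)
  have hb0 : 0 < b := by linarith
  have hbk : 0 < b ^ (-k) := zpow_pos hb0 _
  have hN1 : 300 ≤ b ^ N := by nlinarith
  have hm := measurable_ref (Ω := Ω) hpt a
  -- At coarse scales the difference is bounded by the two sizes, and the factor 32 absorbs `min 1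
  -- (b ^ (-k))`.
  rcases le_or_gt (1 / 32) (b ^ (-k)) with hk | hk
  · have hv := ha.enorm_extendBy_le hW hu S hE (N := N) (by linarith)
    have hmin : 1 ≤ 32 * ENNReal.ofReal (min 1 (b ^ (-k))) := by
      rw [← ENNReal.ofReal_ofNat 32, ← ENNReal.ofReal_mul (by norm_num), ENNReal.one_le_ofReal]
      have : 1 / 32 ≤ min 1 (b ^ (-k)) := le_min (by norm_num) hk
      linarith
    have hv' : ∀ z, ‖extendBy μ Ω pt a u z‖ₑ ≤ extConst C D M K t A *
        extGrad μ Ω pt b K t N u W k z := fun z => by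
      calc ‖extendBy μ Ω pt a u z‖ₑ ≤ (1 + c) * extSize μ Ω pt K t N u W z := hv z
        _ ≤ (1 + c) * ((32 * ENNReal.ofReal (min 1 (b ^ (-k)))) * extSize μ Ω pt K t N u W z) :=
            mul_le_mul' le_rfl (le_mul_of_one_le_left zero_le hmin)
        _ = (32 * (1 + c)) * (ENNReal.ofReal (min 1 (b ^ (-k))) *
              extSize μ Ω pt K t N u W z) := by ring
        _ ≤ _ := mul_le_mul' hT3 le_add_self
    calc edist (extendBy μ Ω pt a u x) (extendBy μ Ω pt a u y)
        ≤ ‖extendBy μ Ω pt a u x‖ₑ + ‖extendBy μ Ω pt a u y‖ₑ := by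
          rw [← edist_zero_right, ← edist_zero_right]
          exact edist_triangle_right _ _ _
      _ ≤ _ := by rw [mul_add]; exact add_le_add (hv' x) (hv' y)
  have hanti : ∀ z, W k z ≤ W (k - N) z := fun z => by
    have := hW.antitone (k - N) N z
    rwa [sub_add_cancel] at this
  have hΩgrad : ∀ z ∈ Ω, W (k - N) z ≤ extGrad μ Ω pt b K t N u W k z := fun z hz => by
    unfold extGrad
    rw [Set.indicator_of_mem hz, add_assoc]
    exact le_self_add
  -- With one point in `Ω`, the other is no farther from `Ω` than the two are from each other, so
  -- again no smoothness of the kernel is needed.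
  have hmixed : ∀ x y, 0 < infDist x Ω → y ∈ Ω → y ∉ E → dist x y < b ^ (-k) →
      edist (smoothAvg μ Ω (fun w => a (whitneyIndex Ω pt w)) x) (u y) ≤
        extConst C D M K t A *
          (extGrad μ Ω pt b K t N u W k x + extGrad μ Ω pt b K t N u W k y) := by
    intro x y hx hy hyE hxy
    have hδ : infDist x Ω ≤ dist x y := infDist_le_dist_of_mem hy
    have hscl : dist x y + 18 * infDist x Ω ≤ b ^ (-(k - N)) := by
      rw [neg_sub, sub_eq_add_neg, zpow_add₀ hb0.ne', zpow_natCast]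
      nlinarith
    have hx' : whitneyAvg μ Ω pt (3 * K + 2) t (W (k - N)) x ≤ extGrad μ Ω pt b K t N u W k x := by
      have := (le_iSup (fun n : ℕ => ENNReal.ofReal ((b ^ n)⁻¹) *
        whitneyAvg μ Ω pt (3 * K + 2) t (W (k - N - n)) x) 0)
      simp only [pow_zero, inv_one, ENNReal.ofReal_one, one_mul, Nat.cast_zero, sub_zero] at this
      exact this.trans (le_add_self.trans le_self_add)
    refine HajlaszExt.edist_smoothAvg_le h hm hx fun w hw => ?_
    have hi := dist_whitneyIndex_lt hpt hx (w := w) (by linarith)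
    have ai := abs_le.1 (abs_infDist_sub_le (Ω := Ω) x (pt (whitneyIndex Ω pt w)))
    refine (ha.edist_apply_le hW S hE hx hy hyE hi (by linarith) hscl).trans ?_
    rw [mul_add]
    refine add_le_add (mul_le_mul' (le_add_self.trans hT2) hx') ?_
    exact (hΩgrad y hy).trans (le_mul_of_one_le_left zero_le (hone'.trans hT2))
  have hnotΩ : ∀ z, 0 < infDist z Ω → z ∉ Ω := fun z hz hzΩ => by
    rw [infDist_zero_of_mem hzΩ] at hz
    exact lt_irrefl _ hz
  have evalU : ∀ z, 0 < infDist z Ω → extendBy μ Ω pt a u z =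
      smoothAvg μ Ω (fun w => a (whitneyIndex Ω pt w)) z := fun z hz => by
    rw [extendBy, if_neg (hnotΩ z hz), if_pos hz]
  have evalΩ : ∀ z, z ∈ Ω → extendBy μ Ω pt a u z = u z := fun z hz => by
    rw [extendBy, if_pos hz]
  rcases hx with hx | hx <;> rcases hy with hy | hy
  · rw [evalΩ x hx, evalΩ y hy]
    refine (hW.bound k x y hx hy hxE hyE hxy).trans (le_trans ?_
      (le_mul_of_one_le_left zero_le (hone'.trans hT2)))
    exact add_le_add ((hanti x).trans (hΩgrad x hx)) ((hanti y).trans (hΩgrad y hy))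
  · rw [evalΩ x hx, evalU y hy, edist_comm, add_comm]
    exact hmixed y x hy hx hxE (by rwa [dist_comm])
  · rw [evalU x hx, evalΩ y hy]
    exact hmixed x y hx hy hyE hxy
  · rw [evalU x hx, evalU y hy]
    rcases le_total (infDist y Ω) (infDist x Ω) with hle | hle
    · exact (ha.edist_smoothAvg_le hW hu S hE hb hN hk hx hy hxy hle).trans
        (mul_le_mul' hT1 le_rfl)
    · rw [edist_comm, add_comm]
      exact (ha.edist_smoothAvg_le hW hu S hE hb hN hk hy hx (by rwa [dist_comm]) hle).trans
        (mul_le_mul' hT1 le_rfl)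

end Extension

end HajlaszExt

/-! ### Norm estimates for the extension -/

namespace HajlaszExt

open Metric

lemma seqNorm_single_zero_ne_top {q : ℝ≥0∞} (hq : q ≠ 0) :
    seqNorm q (fun k : ℤ => if k = 0 then (1 : ℝ≥0∞) else 0) ≠ ∞ := by
  by_cases ht : q = ∞
  · subst ht
    rw [seqNorm_top]
    refine ne_top_of_le_ne_top ENNReal.one_ne_top (iSup_le fun k => ?_)
    split_ifs <;> simp
  · have hq' : 0 < q.toReal := ENNReal.toReal_pos hq ht
    rw [seqNorm_eq_tsum hq ht, tsum_eq_single 0 (fun k hk => by simp [hk, hq'])]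
    simp

/-- The sequence decays like `(l / b) ^ k` on the right and like `l ^ k` on the left, and each half
is a geometric convolution of a unit mass. For `l = b` the right half is constant, whence `q = ∞`.
-/
lemma seqNorm_scale_ne_top {q : ℝ≥0∞} (hq : q ≠ 0) {l b : ℝ} (hl : 1 < l) (hlb : l ≤ b)
    (hq' : l = b → q = ∞) :
    seqNorm q (fun k : ℤ => ENNReal.ofReal (l ^ k) * ENNReal.ofReal (min 1 (b ^ (-k)))) ≠ ∞ := by
  have hl0 : 0 < l := by linarith
  have hb0 : 0 < b := by linarith
  rcases hlb.lt_or_eq with hlt | heq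
  · set θ : ℝ := max (l / b) l⁻¹ with hθ
    have hθ0 : 0 ≤ θ := le_max_of_le_left (by positivity)
    have hθ1 : ENNReal.ofReal θ < 1 := by
      rw [← ENNReal.ofReal_one, ENNReal.ofReal_lt_ofReal_iff one_pos]
      exact max_lt ((div_lt_one hb0).2 hlt) (inv_lt_one_of_one_lt₀ hl)
    set e : ℤ → ℝ≥0∞ := fun k => if k = 0 then 1 else 0 with he
    obtain ⟨K₁, hK₁, hK₁'⟩ := exists_seqNorm_conv_le hq 1 hθ1
    obtain ⟨K₂, hK₂, hK₂'⟩ := exists_seqNorm_conv_le hq (-1) hθ1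
    have hfin := seqNorm_single_zero_ne_top hq
    set f₁ : ℤ → ℝ≥0∞ := fun k => ⨆ n : ℕ, ENNReal.ofReal θ ^ n * e (k + 1 * n)
    set f₂ : ℤ → ℝ≥0∞ := fun k => ⨆ n : ℕ, ENNReal.ofReal θ ^ n * e (k + -1 * n)
    have h1 : seqNorm q (f₁ + f₂) ≠ ∞ := by
      refine ne_top_of_le_ne_top (ENNReal.mul_ne_top (ENNReal.LpAddConst_lt_top q).ne
        (ENNReal.add_ne_top.2 ⟨?_, ?_⟩)) (seqNorm_add_le q f₁ f₂)
      · exact ne_top_of_le_ne_top (ENNReal.mul_ne_top hK₁ hfin) (hK₁' e)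
      · exact ne_top_of_le_ne_top (ENNReal.mul_ne_top hK₂ hfin) (hK₂' e)
    refine ne_top_of_le_ne_top h1 (seqNorm_mono q fun k => ?_)
    rw [← ENNReal.ofReal_mul (by positivity), Pi.add_apply]
    rcases le_total 0 k with hk | hk
    · obtain ⟨n, rfl⟩ := Int.eq_ofNat_of_zero_le hk
      refine le_trans ?_ le_add_self
      refine le_trans ?_ (le_iSup (fun m : ℕ => ENNReal.ofReal θ ^ m * e ((n : ℤ) + -1 * m)) n)
      simp only [he, neg_mul, one_mul, add_neg_cancel, if_true, mul_one]
      rw [← ENNReal.ofReal_pow hθ0]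
      refine ENNReal.ofReal_le_ofReal ?_
      calc l ^ (n : ℤ) * min 1 (b ^ (-(n : ℤ))) ≤ l ^ (n : ℤ) * b ^ (-(n : ℤ)) := by
            gcongr; exact min_le_right _ _
        _ = (l / b) ^ n := by rw [zpow_neg, zpow_natCast, zpow_natCast, div_pow, div_eq_mul_inv]
        _ ≤ θ ^ n := by gcongr; exact le_max_left _ _
    · obtain ⟨n, rfl⟩ := Int.exists_eq_neg_ofNat hk
      refine le_trans ?_ le_self_add
      refine le_trans ?_ (le_iSup (fun m : ℕ => ENNReal.ofReal θ ^ m * e (-(n : ℤ) + 1 * m)) n)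
      simp only [he, one_mul, neg_add_cancel, if_true, mul_one]
      rw [← ENNReal.ofReal_pow hθ0]
      refine ENNReal.ofReal_le_ofReal ?_
      calc l ^ (-(n : ℤ)) * min 1 (b ^ (-(-(n : ℤ)))) ≤ l ^ (-(n : ℤ)) * 1 := by
            gcongr; exact min_le_left _ _
        _ = l⁻¹ ^ n := by rw [mul_one, zpow_neg, zpow_natCast, inv_pow]
        _ ≤ θ ^ n := by gcongr; exact le_max_right _ _
  · rw [hq' heq, seqNorm_top]
    refine ne_top_of_le_ne_top ENNReal.one_ne_top (iSup_le fun k => ?_)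
    rw [← ENNReal.ofReal_mul (by positivity), ← ENNReal.ofReal_one]
    refine ENNReal.ofReal_le_ofReal ?_
    calc l ^ k * min 1 (b ^ (-k)) ≤ l ^ k * b ^ (-k) := by
          gcongr; exact min_le_right _ _
      _ = 1 := by rw [heq, ← zpow_add₀ hb0.ne', add_neg_cancel, zpow_zero]

section

variable {X : Type*} [PseudoMetricSpace X] [MeasurableSpace X]
  {Ω : Set X} {pt : ℕ → X} {μ : Measure X} {C D : ℝ} {M : ℝ≥0∞} {R K t : ℝ}

lemma const_mul_whitneyAvg (ht : 0 < t) {c : ℝ≥0∞} (hc : c ≠ ∞) (f : X → ℝ≥0∞) (x : X) :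
    c * whitneyAvg μ Ω pt K t f x = whitneyAvg μ Ω pt K t (fun y => c * f y) x := by
  obtain ⟨ν, hν⟩ := whitneyAvg_eq_lintegral (μ := μ) (Ω := Ω) (pt := pt) ht K
  rw [hν, hν]
  simp_rw [ENNReal.mul_rpow_of_nonneg _ _ ht.le]
  rw [lintegral_const_mul' _ _ (ENNReal.rpow_ne_top_of_nonneg ht.le hc),
    ENNReal.mul_rpow_of_nonneg _ _ (by positivity), ← ENNReal.rpow_mul, mul_one_div_cancel ht.ne',
    ENNReal.rpow_one]

/-- The weighted sequence `l ^ k W_k`. -/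
noncomputable def weighted (l : ℝ) (W : ℤ → X → ℝ≥0∞) (k : ℤ) (x : X) : ℝ≥0∞ :=
  ENNReal.ofReal (l ^ k) * W k x

variable [OpensMeasurableSpace X]

lemma measurable_extSize (hpt : DenseRange pt) (hΩ : MeasurableSet Ω) {u : X → ℝ}
    (hu : Measurable u) (N : ℕ) (W : ℤ → X → ℝ≥0∞) :
    Measurable (extSize μ Ω pt K t N u W) :=
  (hu.enorm.indicator hΩ).add (measurable_whitneyAvg hpt _ _ _)

lemma measurable_extGrad (hpt : DenseRange pt) (hΩ : MeasurableSet Ω) {u : X → ℝ}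
    (hu : Measurable u) (N : ℕ) {W : ℤ → X → ℝ≥0∞} (hW : ∀ k, Measurable (W k)) (b : ℝ) (k : ℤ) :
    Measurable (extGrad μ Ω pt b K t N u W k) :=
  (((hW _).indicator hΩ).add (Measurable.iSup fun _ =>
    (measurable_whitneyAvg hpt _ _ _).const_mul _)).add
      ((measurable_extSize hpt hΩ hu N W).const_mul _)

/-- Norm bounds for the extension, uniform in the function and its ball gradient. -/
lemma WhitneySetup.exists_norm_le (S : WhitneySetup μ Ω pt C D M R K t) {p q : ℝ≥0∞}
    (hp : p ≠ ∞) (hq : q ≠ 0) (htp : ENNReal.ofReal t < p) (htq : ENNReal.ofReal t ≤ q)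
    {Φ : (ℤ → X → ℝ≥0∞) → ℝ≥0∞} (hΦ : IsMixedNorm μ p q Φ) {l b : ℝ} (hl : 1 < l) (hlb : l ≤ b)
    (hq' : l = b → q = ∞)
    (hconv : l = b → ∀ f : ℤ → X → ℝ≥0∞, Φ (fun k x => ⨆ n : ℕ, f (k - n) x) ≤ Φ f) (N : ℕ) :
    ∃ A : ℝ≥0∞, A ≠ ∞ ∧ ∀ (u : X → ℝ) (W : ℤ → X → ℝ≥0∞), Measurable u → (∀ k, Measurable (W k)) →
      eLpNorm (extSize μ Ω pt K t N u W) p μ ≤ A * (Φ (weighted l W) + eLpNorm u p μ) ∧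
      Φ (weighted l (extGrad μ Ω pt b K t N u W)) ≤ A * (Φ (weighted l W) + eLpNorm u p μ) := by
  obtain ⟨h, hd, hM, hΩ, hne, hpt, hR, ht, hK⟩ := id S
  have hl0 : 0 < l := by linarith
  have hb0 : 0 < b := by linarith
  obtain ⟨B, hB, hB'⟩ := exists_eLpNorm_whitneyAvg_le h hd hM hne hpt hR (K := 3 * K + 2)
    (by linarith) ht hp htp
  obtain ⟨ν, hν⟩ := whitneyAvg_eq_lintegral (μ := μ) (Ω := Ω) (pt := pt) ht (3 * K + 2)
  have hν' : ∀ f, whitneyAvg μ Ω pt (3 * K + 2) t f = fun x => (∫⁻ y, f y ^ t ∂ν x) ^ (1 / t) :=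
    fun f => funext fun x => hν f x
  have hBΦ : ∀ f : ℤ → X → ℝ≥0∞, (∀ k, Measurable (f k)) →
      Φ (fun k => whitneyAvg μ Ω pt (3 * K + 2) t (f k)) ≤ B * Φ f := by
    intro f hf
    simp_rw [hν']
    exact hΦ.average ν t B ht htq (fun f hf => by rw [← hν']; exact hB' f hf) hB f hf
  -- The gain `b ^ (-n)` competes with the loss `l ^ n` of the weights. The ratio `l / b` is
  -- summable below the endpoint; at the endpoint only the bare supremum over shifts remains, which
  -- is `hconv`.
  obtain ⟨B₁, hB₁, hB₁'⟩ : ∃ B₁ : ℝ≥0∞, B₁ ≠ ∞ ∧ ∀ f : ℤ → X → ℝ≥0∞, (∀ k, Measurable (f k)) →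
      Φ (fun k x => ⨆ n : ℕ, ENNReal.ofReal (l / b) ^ n * f (k - n) x) ≤ B₁ * Φ f := by
    rcases hlb.lt_or_eq with hlt | heq
    · obtain ⟨B₁, hB₁, hB₁'⟩ := hΦ.conv (-1) (ENNReal.ofReal (l / b)) (by
        rw [← ENNReal.ofReal_one, ENNReal.ofReal_lt_ofReal_iff one_pos]
        exact (div_lt_one hb0).2 hlt)
      refine ⟨B₁, hB₁, fun f hf => ?_⟩
      have := hB₁' f hf
      simpa only [neg_mul, one_mul, ← sub_eq_add_neg] using this
    · refine ⟨1, ENNReal.one_ne_top, fun f _ => ?_⟩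
      rw [heq, div_self hb0.ne', one_mul]
      simpa only [ENNReal.ofReal_one, one_pow, one_mul] using hconv heq f
  obtain ⟨G, hG, hG'⟩ := hΦ.add
  set κ := seqNorm q (fun k : ℤ => ENNReal.ofReal (l ^ k) * ENNReal.ofReal (min 1 (b ^ (-k))))
    with hκ
  have hκt : κ ≠ ∞ := seqNorm_scale_ne_top hq hl hlb hq'
  set lN := ENNReal.ofReal (l ^ N) with hlN
  have hlNt : lN ≠ ∞ := ENNReal.ofReal_ne_top
  set a := ENNReal.LpAddConst p with ha
  have hat : a ≠ ∞ := (ENNReal.LpAddConst_lt_top p).ne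
  set A₁ := a * (1 + B * (a * (1 + lN))) with hA₁
  have hA₁t : A₁ ≠ ∞ := ENNReal.mul_ne_top hat (ENNReal.add_ne_top.2 ⟨ENNReal.one_ne_top,
    ENNReal.mul_ne_top hB (ENNReal.mul_ne_top hat
      (ENNReal.add_ne_top.2 ⟨ENNReal.one_ne_top, hlNt⟩))⟩)
  set A₂ := G * (G * (lN + lN * (B₁ * B)) + κ * A₁) with hA₂
  have hA₂t : A₂ ≠ ∞ := by
    refine ENNReal.mul_ne_top hG (ENNReal.add_ne_top.2 ⟨ENNReal.mul_ne_top hG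
      (ENNReal.add_ne_top.2 ⟨hlNt, ?_⟩), ENNReal.mul_ne_top hκt hA₁t⟩)
    exact ENNReal.mul_ne_top hlNt (ENNReal.mul_ne_top hB₁ hB)
  refine ⟨A₁ + A₂, ENNReal.add_ne_top.2 ⟨hA₁t, hA₂t⟩, fun u W hu hW => ?_⟩
  set T := Φ (weighted l W) + eLpNorm u p μ with hT
  have hwW : ∀ k, Measurable (weighted l W k) := fun k => (hW k).const_mul _
  have hcoord : eLpNorm (W (-N)) p μ ≤ lN * Φ (weighted l W) := by
    have h1 : W (-N) = fun x => lN * weighted l W (-N) x := by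
      ext x
      rw [weighted, ← mul_assoc, hlN, ← ENNReal.ofReal_mul (by positivity), zpow_neg, zpow_natCast,
        mul_inv_cancel₀ (by positivity), ENNReal.ofReal_one, one_mul]
    rw [h1]
    refine (eLpNorm_le_const_mul hlNt (g := weighted l W (-N)) (fun x => by simp) p).trans ?_
    gcongr
    exact hΦ.coord _ _
  have hsize : eLpNorm (extSize μ Ω pt K t N u W) p μ ≤ A₁ * T := by
    have h1 : eLpNorm (fun y => ‖u y‖ₑ + W (-N) y) p μ ≤ a * ((1 + lN) * T) := by
      refine (eLpNorm_add_le' hu.enorm.aestronglyMeasurable (hW _).aestronglyMeasurable p).trans ?_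
      refine mul_le_mul' le_rfl ?_
      rw [add_mul, one_mul]
      refine add_le_add ?_ (hcoord.trans (mul_le_mul' le_rfl le_self_add))
      rw [eLpNorm_enorm]
      exact le_add_self
    have h2 : eLpNorm (Ω.indicator fun y => ‖u y‖ₑ) p μ ≤ T := by
      refine le_trans ?_ (le_add_self (a := eLpNorm u p μ))
      refine (eLpNorm_mono_ennreal p μ fun x => ?_).trans (eLpNorm_enorm u).le
      exact Set.indicator_le_self _ _ _
    refine (eLpNorm_add_le' (hu.enorm.indicator hΩ).aestronglyMeasurable
      (measurable_whitneyAvg hpt _ _ _).aestronglyMeasurable p).trans ?_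
    rw [hA₁, mul_assoc]
    refine mul_le_mul' le_rfl ?_
    rw [add_mul, one_mul]
    refine add_le_add h2 ((hB' _ (hu.enorm.add (hW _))).trans ?_)
    rw [mul_assoc, mul_assoc]
    exact mul_le_mul' le_rfl h1
  refine ⟨hsize.trans (mul_le_mul' le_self_add le_rfl), ?_⟩
  set f₁ : ℤ → X → ℝ≥0∞ := fun k x => lN * weighted l W (k + -N) x with hf₁
  set f₂ : ℤ → X → ℝ≥0∞ := fun k x => lN * ⨆ n : ℕ, ENNReal.ofReal (l / b) ^ n *
    whitneyAvg μ Ω pt (3 * K + 2) t (weighted l W (k + -N - n)) x with hf₂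
  set f₃ : ℤ → X → ℝ≥0∞ := fun k x => (ENNReal.ofReal (l ^ k) *
    ENNReal.ofReal (min 1 (b ^ (-k)))) * extSize μ Ω pt K t N u W x with hf₃
  have hm₁ : ∀ k, Measurable (f₁ k) := fun k => (hwW _).const_mul _
  have hm₂ : ∀ k, Measurable (f₂ k) := fun k => (Measurable.iSup fun n =>
    (measurable_whitneyAvg hpt _ _ _).const_mul _).const_mul _
  have hm₃ : ∀ k, Measurable (f₃ k) := fun k => (measurable_extSize hpt hΩ hu N W).const_mul _
  -- Moving the weight to the index `k - N - n` of the gradient costs `l ^ N * l ^ n`.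
  have hscale : ∀ (k : ℤ) (n : ℕ), ENNReal.ofReal (l ^ k) * ENNReal.ofReal ((b ^ n)⁻¹) =
      lN * (ENNReal.ofReal (l / b) ^ n * ENNReal.ofReal (l ^ (k - N - n))) := by
    intro k n
    rw [hlN, ← ENNReal.ofReal_pow (by positivity), ← ENNReal.ofReal_mul (by positivity),
      ← ENNReal.ofReal_mul (by positivity), ← ENNReal.ofReal_mul (by positivity)]
    congr 1
    rw [zpow_sub₀ hl0.ne', zpow_sub₀ hl0.ne', zpow_natCast, zpow_natCast, div_pow]
    field_simp
  have hdom : ∀ k x, weighted l (extGrad μ Ω pt b K t N u W) k x ≤ (f₁ k x + f₂ k x) + f₃ k x := by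
    intro k x
    unfold weighted extGrad
    rw [mul_add, mul_add]
    refine add_le_add (add_le_add ?_ ?_) (mul_assoc _ _ _).ge
    · have := hscale k 0
      simp only [pow_zero, inv_one, ENNReal.ofReal_one, mul_one, one_mul, Nat.cast_zero,
        sub_zero] at this
      rw [this, hf₁, mul_assoc]
      exact mul_le_mul' le_rfl (mul_le_mul' le_rfl (Set.indicator_le_self _ _ _))
    · simp only [hf₂]
      rw [ENNReal.mul_iSup, ENNReal.mul_iSup]
      refine iSup_mono fun n => le_of_eq ?_
      rw [← mul_assoc, hscale, mul_assoc, mul_assoc,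
        const_mul_whitneyAvg ht ENNReal.ofReal_ne_top]
      rfl
  have b₁ : Φ f₁ ≤ lN * T := by
    refine (hΦ.const_mul lN hlNt _).trans ?_
    rw [hΦ.shift (weighted l W) (-N)]
    exact mul_le_mul' le_rfl le_self_add
  have b₂ : Φ f₂ ≤ lN * (B₁ * B) * T := by
    refine (hΦ.const_mul lN hlNt _).trans ?_
    rw [hΦ.shift (fun k x => ⨆ n : ℕ, ENNReal.ofReal (l / b) ^ n *
      whitneyAvg μ Ω pt (3 * K + 2) t (weighted l W (k - n)) x) (-N), mul_assoc]
    refine mul_le_mul' le_rfl ?_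
    refine (hB₁' (fun k => whitneyAvg μ Ω pt (3 * K + 2) t (weighted l W k))
      fun k => measurable_whitneyAvg hpt _ _ _).trans ?_
    rw [mul_assoc]
    exact mul_le_mul' le_rfl ((hBΦ _ hwW).trans (mul_le_mul' le_rfl le_self_add))
  have b₃ : Φ f₃ ≤ κ * A₁ * T := by
    refine (hΦ.single _ _ hκt).trans ?_
    rw [mul_assoc]
    exact mul_le_mul' le_rfl hsize
  calc Φ (weighted l (extGrad μ Ω pt b K t N u W))
      ≤ Φ (fun k x => (f₁ k x + f₂ k x) + f₃ k x) := hΦ.mono _ _ hdom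
    _ ≤ G * (Φ (fun k x => f₁ k x + f₂ k x) + Φ f₃) :=
        hG' _ _ (fun k => (hm₁ k).add (hm₂ k)) hm₃
    _ ≤ G * (G * (Φ f₁ + Φ f₂) + Φ f₃) := by
        gcongr
        exact hG' _ _ hm₁ hm₂
    _ ≤ G * (G * (lN * T + lN * (B₁ * B) * T) + κ * A₁ * T) := by gcongr
    _ = A₂ * T := by rw [hA₂]; ring
    _ ≤ _ := mul_le_mul' le_add_self le_rfl

end

end HajlaszExt

/-! ### Reference values -/

namespace HajlaszExt

open Metric

/-- The finest scale not below `x`. Since ball gradients decrease with `k`, a bound with `W j` at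
this scale implies the bound at every admissible scale. -/
lemma exists_scale {b x : ℝ} (hb : 1 < b) (hx : 0 < x) :
    ∃ j : ℤ, x ≤ b ^ (-j) ∧ b ^ (-j) < b * x ∧ ∀ k : ℤ, x ≤ b ^ (-k) → k ≤ j := by
  have hb0 : 0 < b := by linarith
  obtain ⟨n, hn1, hn2⟩ := exists_mem_Ioc_zpow hx hb
  refine ⟨-(n + 1), by rwa [neg_neg], ?_, fun k hk => ?_⟩
  · rw [neg_neg, zpow_add_one₀ hb0.ne', mul_comm]
    exact mul_lt_mul_of_pos_left hn1 hb0
  · have := (zpow_lt_zpow_iff_right₀ hb).1 (hn1.trans_le hk)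
    lia

/-- Optimizing a family of bounds of geometric growth. -/
lemma le_of_forall_pow_bound {η θ : ℝ≥0} {t : ℝ} (hη : 1 < η) (ht : 0 < t)
    (hθ : θ * η = η ^ t) {e G γ c : ℝ≥0∞} (hγ0 : γ ≠ 0) (hγ : γ ≠ ∞)
    (h : ∀ n : ℕ, e ≤ θ ^ n * G + c * (θ * η) ^ n * γ) :
    e ≤ (η + c) * (γ + γ * (G / γ) ^ t) := by
  have hη0 : (η : ℝ≥0∞) ≠ 0 := by simpa using (zero_lt_one.trans hη).ne'
  by_cases hG : G = ∞
  · rw [hG, ENNReal.top_div_of_ne_top hγ, ENNReal.top_rpow_of_pos ht, ENNReal.mul_top hγ0, add_top,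
      ENNReal.mul_top (by simp [hη0])]
    exact le_top
  lift G to ℝ≥0 using hG
  lift γ to ℝ≥0 using hγ
  have hγ0' : γ ≠ 0 := by simpa using hγ0
  -- The balancing index: `η ^ n` is about `max 1 (G / γ)`, where the two terms of the bound agree
  -- up to constants and `(θ * η) ^ n = (η ^ n) ^ t` produces the power `t`.
  obtain ⟨n, hn1, hn2⟩ := exists_nat_pow_near (le_max_left (1 : ℝ≥0) (G / γ)) hη
  have hG' : G ≤ γ * η ^ (n + 1) := by
    calc G = γ * (G / γ) := by field_simp
      _ ≤ γ * η ^ (n + 1) := by gcongr; exact (le_max_right _ _).trans hn2.le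
  have hpow : (θ * η) ^ n ≤ 1 + (G / γ) ^ t := by
    rw [hθ, ← NNReal.rpow_mul_natCast, mul_comm t, NNReal.rpow_natCast_mul]
    refine (NNReal.rpow_le_rpow hn1 ht.le).trans ?_
    rcases max_cases (1 : ℝ≥0) (G / γ) with h | h <;> rw [h.1]
    · rw [NNReal.one_rpow]; exact le_self_add
    · exact le_add_self
  have hpow' : ((θ : ℝ≥0∞) * η) ^ n ≤ 1 + (G / γ : ℝ≥0∞) ^ t := by
    rw [← ENNReal.coe_div hγ0', ← ENNReal.coe_rpow_of_nonneg _ ht.le]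
    exact_mod_cast hpow
  have hG'' : (G : ℝ≥0∞) ≤ γ * η ^ (n + 1) := by exact_mod_cast hG'
  calc e ≤ θ ^ n * G + c * (θ * η) ^ n * γ := h n
    _ ≤ θ ^ n * (γ * η ^ (n + 1)) + c * (θ * η) ^ n * γ := by gcongr
    _ = (η + c) * (γ * (θ * η) ^ n) := by rw [pow_succ, mul_pow]; ring
    _ ≤ (η + c) * (γ * (1 + (G / γ : ℝ≥0∞) ^ t)) := by gcongr
    _ = _ := by rw [mul_add, mul_one]

/-- A weighted geometric mean is at most the sum. It recovers a linear bound at the one point where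
no average is taken. -/
lemma mul_div_rpow_le {t : ℝ} (ht : 0 < t) (ht1 : t ≤ 1) {γ : ℝ≥0∞} (hγ0 : γ ≠ 0) (hγ : γ ≠ ∞)
    (G : ℝ≥0∞) : γ * (G / γ) ^ t ≤ γ + G := by
  have h1 : (G / γ) ^ t ≤ 1 + G / γ := by
    rcases le_total (G / γ) 1 with h | h
    · exact (ENNReal.rpow_le_one h ht.le).trans le_self_add
    · exact ((ENNReal.rpow_le_rpow_of_exponent_le h ht1).trans (ENNReal.rpow_one _).le).trans
        le_add_self
  calc γ * (G / γ) ^ t ≤ γ * (1 + G / γ) := by gcongr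
    _ = γ + G := by rw [mul_add, mul_one, ENNReal.mul_div_cancel hγ0 hγ]

/-- When `u` is not integrable on `S` the Bochner average has a default value, but then the
right-hand side is infinite. -/
lemma edist_setAverage_le {X : Type*} [MeasurableSpace X] {μ : Measure X} {S : Set X}
    (h0 : μ S ≠ 0) (ht : μ S ≠ ∞) {u : X → ℝ} (hu : Measurable u) (c : ℝ) :
    edist (⨍ x in S, u x ∂μ) c ≤ ⨍⁻ x in S, edist (u x) c ∂μ := by
  have : IsFiniteMeasure (μ.restrict S) := isFiniteMeasure_restrict.2 ht
  have hr : μ.real S ≠ 0 := (ENNReal.toReal_pos h0 ht).ne'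
  rw [setLAverage_eq]
  by_cases hi : IntegrableOn u S μ
  · have h1 : (⨍ x in S, u x ∂μ) - c = (μ.real S)⁻¹ * ∫ x in S, (u x - c) ∂μ := by
      rw [setAverage_eq, integral_sub hi (integrable_const c), setIntegral_const, smul_eq_mul,
        smul_eq_mul]
      field_simp
    rw [edist_eq_enorm_sub, h1, enorm_mul, enorm_inv hr, mul_comm, ← div_eq_mul_inv,
      Real.enorm_of_nonneg measureReal_nonneg, ofReal_measureReal ht]
    refine ENNReal.div_le_div_right ?_ _
    simp_rw [edist_eq_enorm_sub]
    exact enorm_integral_le_lintegral_enorm _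
  · have h1 : ∫⁻ x in S, edist (u x) c ∂μ = ∞ := by
      by_contra h
      refine hi ?_
      have h2 : IntegrableOn (fun x => u x - c) S μ := by
        refine ⟨(hu.sub_const c).aestronglyMeasurable, ?_⟩
        rw [hasFiniteIntegral_iff_enorm]
        simp_rw [← edist_eq_enorm_sub]
        exact lt_top_iff_ne_top.2 h
      have h3 := h2.add (integrable_const c)
      refine h3.congr (Filter.Eventually.of_forall fun x => ?_)
      simp
    rw [h1, ENNReal.top_div_of_ne_top ht]
    exact le_top

section

variable {X : Type*} [PseudoMetricSpace X] [MeasurableSpace X] [OpensMeasurableSpace X]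
  {Ω : Set X} {pt : ℕ → X} {μ : Measure X} {C D : ℝ} {M : ℝ≥0∞} {R b K t : ℝ} {u : X → ℝ}
  {W : ℤ → X → ℝ≥0∞} {E : Set X}

/-- Values at well chosen points are reference values. -/
lemma exists_isReference (S : WhitneySetup μ Ω pt C D M R 3 t) (hb : 1 < b)
    (hW : IsBallGradient Ω b u W E) (hE : μ E = 0) :
    ∃ a, IsReference μ Ω pt b 3 t 1 u W E a := by
  classical
  obtain ⟨h, hd, -, hΩ, hne, hpt, hR, ht, -⟩ := id S
  have key : ∀ i, ∃ c : ℝ, 0 < infDist (pt i) Ω → infDist (pt i) Ω < 1 → ∀ k : ℤ,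
      12 * infDist (pt i) Ω ≤ b ^ (-k) → ∀ y ∈ reflBall Ω pt 3 i, y ∉ E →
        edist c (u y) ≤ 1 * (powAvg μ t (reflBall Ω pt 3 i) (W k) + W k y) := by
    intro i
    by_cases hi : 0 < infDist (pt i) Ω ∧ infDist (pt i) Ω < 1
    -- One point, chosen for the gradient at the finest admissible scale, serves all coarser scales
    -- by monotonicity.
    · obtain ⟨j, hj1, -, hj3⟩ := exists_scale hb (x := 12 * infDist (pt i) Ω) (by linarith)
      obtain ⟨z, hz, hzE, hzW⟩ := exists_mem_le_powAvg ht (measurableSet_reflBall hΩ 3 i)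
        (measure_reflBall_ne_zero h hd hne hi.1 (by linarith) le_rfl)
        (measure_reflBall_ne_top h _ _) hE (hW.measurable j)
      refine ⟨u z, fun _ _ k hk y hy hyE => ?_⟩
      have hle : ∀ x, W j x ≤ W k x := fun x => by
        obtain ⟨n, hn⟩ := Int.le.dest (hj3 k hk)
        rw [← hn]
        exact hW.antitone k n x
      have hzy : dist z y < b ^ (-j) := by
        have h1 := mem_ball.1 hz.1
        have h2 := mem_ball.1 hy.1
        linarith [dist_triangle_right z y (pt i)]
      rw [one_mul]
      exact (hW.bound j z y hz.2 hy.2 hzE hyE hzy).trans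
        (add_le_add (hzW.trans (powAvg_mono ht _ hle)) (hle y))
    · exact ⟨0, fun h1 h2 => absurd ⟨h1, h2⟩ hi⟩
  choose a ha using key
  refine ⟨fun i => if infDist (pt i) Ω < 1 then a i else 0, fun i hi => ?_, fun i h0 h1 => ?_⟩
  · simp only [if_neg (not_lt.2 hi)]
  · simp only [if_pos h1]
    exact ha i h0 h1

/-- Points close to a given point of the reflected ball at which a function is controlled by its
mean. -/
lemma exists_mem_ball_le_powAvg (S : WhitneySetup μ Ω pt C D M R (3 + 3 * b) t) (hb : 1 < b)
    (hR : 3 * b ≤ R) {η : ℝ≥0} (hη : b ^ D ≤ (η : ℝ) ^ t) (hE : μ E = 0) {i : ℕ}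
    (hi0 : 0 < infDist (pt i) Ω) (hi1 : infDist (pt i) Ω < 1) {j : ℤ}
    (hj : 12 * infDist (pt i) Ω ≤ b ^ (-j)) (hj' : b ^ (-j) < b * (12 * infDist (pt i) Ω))
    {G : X → ℝ≥0∞} (hG : Measurable G) {x : X} (hx : x ∈ reflBall Ω pt 3 i) (n : ℕ) :
    ∃ z ∈ ball x (b ^ (-(j + n)) / 4) ∩ Ω, z ∉ E ∧ G z ≤
      (ENNReal.ofReal (C * (2 + b) ^ D) * M) ^ (1 / t) * η ^ n *
        powAvg μ t (reflBall Ω pt (3 + 3 * b) i) G := by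
  obtain ⟨h, hd, -, hΩ, hne, hpt, -, ht, -⟩ := id S
  have hb0 : 0 < b := by linarith
  have hC := h.const_pos
  set δ := infDist (pt i) Ω with hδ
  have hscale : b ^ (-(j + n)) * b ^ n = b ^ (-j) := by
    rw [← zpow_natCast, ← zpow_add₀ hb0.ne']; congr 1; ring
  have hbn : 1 ≤ b ^ n := one_le_pow₀ hb.le
  set r := b ^ (-(j + n)) / 4 with hr
  have hr0 : 0 < r := by positivity
  have hrle : r ≤ b ^ (-j) / 4 := by
    rw [hr, ← hscale]
    have := zpow_pos hb0 (-(j + n))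
    nlinarith
  have hxi := mem_ball.1 hx.1
  have hsub : ball x r ∩ Ω ⊆ reflBall Ω pt (3 + 3 * b) i := by
    refine Set.inter_subset_inter_left _ (ball_subset_ball' ?_)
    nlinarith
  -- Shrinking the ball by `b ^ n` costs `b ^ (D * n)` in measure, which after the `t`-th root is at
  -- most `η ^ n`. The enlargement `3 + 3 * b` contains these balls because `b ^ (-j) / 4 < 3 * b *
  -- infDist (pt i) Ω`.
  have hmeas : μ (reflBall Ω pt (3 + 3 * b) i) ≤
      ((ENNReal.ofReal (C * (2 + b) ^ D) * M) * ENNReal.ofReal (b ^ D) ^ n) *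
        μ (ball x r ∩ Ω) := by
    have h1 : μ (ball (pt i) ((3 + 3 * b) * δ)) ≤
        ENNReal.ofReal (C * ((2 + b) * b ^ n) ^ D) * μ (ball x r) := by
      refine h.ball_le_ball hr0 (by nlinarith) ?_
      have h2 : (2 + b) * b ^ n * r = (2 + b) * (b ^ (-j) / 4) := by rw [hr, ← hscale]; ring
      rw [h2, dist_comm]
      nlinarith
    refine (measure_mono Set.inter_subset_left).trans (h1.trans ?_)
    have h3 : C * ((2 + b) * b ^ n) ^ D = (C * (2 + b) ^ D) * (b ^ D) ^ n := by
      rw [Real.mul_rpow (by positivity) (by positivity), ← Real.rpow_natCast_mul hb0.le,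
        ← Real.rpow_mul_natCast hb0.le, mul_comm D]
      ring
    rw [h3, ENNReal.ofReal_mul (by positivity), ENNReal.ofReal_pow (by positivity)]
    calc _ ≤ ENNReal.ofReal (C * (2 + b) ^ D) * ENNReal.ofReal (b ^ D) ^ n *
          (M * μ (ball x r ∩ Ω)) := by
          gcongr
          exact hd x hx.2 r hr0 (by nlinarith)
      _ = _ := by ring
  have hpos : μ (ball x r ∩ Ω) ≠ 0 := fun h0 => by
    have := hd x hx.2 r hr0 (by nlinarith)
    rw [h0, mul_zero] at this
    exact absurd (h.ball_pos x r hr0) (not_lt.2 this)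
  obtain ⟨z, hz, hzE, hzG⟩ := exists_mem_le_powAvg ht (isOpen_ball.measurableSet.inter hΩ) hpos
    (ne_top_of_le_ne_top (h.ball_lt_top x r).ne (measure_mono Set.inter_subset_left)) hE hG
  refine ⟨z, hz, hzE, hzG.trans ((powAvg_le_of_subset ht hsub hpos (measure_reflBall_ne_top h _ _)
    hmeas G).trans ?_)⟩
  refine mul_le_mul' ?_ le_rfl
  rw [ENNReal.mul_rpow_of_nonneg _ _ (by positivity)]
  refine mul_le_mul' le_rfl ?_
  rw [rpow_one_div_le_iff ht]
  have h5 : ((η : ℝ≥0∞) ^ n) ^ t = ((η : ℝ≥0∞) ^ t) ^ n := by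
    rw [← ENNReal.rpow_natCast_mul, mul_comm, ENNReal.rpow_mul_natCast]
  rw [h5]
  gcongr
  rw [← ENNReal.coe_rpow_of_nonneg _ ht.le, ENNReal.ofReal_le_iff_le_toReal ENNReal.coe_ne_top]
  simpa using hη

/-- A point near `x` whose value is controlled at all scales simultaneously. -/
lemma exists_mem_ball_forall_edist_le (S : WhitneySetup μ Ω pt C D M R (3 + 3 * b) t) (hb : 1 < b)
    (hR : 3 * b ≤ R) {η θ : ℝ≥0} (hη : b ^ D ≤ (η : ℝ) ^ t) (hE : μ E = 0)
    (hW : IsBallGradient Ω b u W E) (hθ : ∀ (k : ℤ) (n : ℕ) x, W (k + n) x ≤ θ ^ n * W k x)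
    {σ : ℝ≥0∞} (hσ : σ + 1 ≤ σ * (θ * η)) {i : ℕ}
    (hi0 : 0 < infDist (pt i) Ω) (hi1 : infDist (pt i) Ω < 1) {j : ℤ}
    (hj : 12 * infDist (pt i) Ω ≤ b ^ (-j)) (hj' : b ^ (-j) < b * (12 * infDist (pt i) Ω))
    {c : ℝ≥0∞} (hc : c = (ENNReal.ofReal (C * (2 + b) ^ D) * M) ^ (1 / t))
    {x : X} (hx : x ∈ reflBall Ω pt 3 i) (hxE : x ∉ E) :
    ∃ z ∈ ball x (b ^ (-j) / 4) ∩ Ω, z ∉ E ∧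
      W j z ≤ c * powAvg μ t (reflBall Ω pt (3 + 3 * b) i) (W j) ∧
      ∀ n : ℕ, edist (u x) (u z) ≤ θ ^ n * W j x + (c + c * (1 + η) * σ) * (θ * η) ^ n *
        powAvg μ t (reflBall Ω pt (3 + 3 * b) i) (W j) := by
  have hb0 : 0 < b := by linarith
  set V := powAvg μ t (reflBall Ω pt (3 + 3 * b) i) (W j)
  -- Points in balls shrinking to `x`. At stage `n` the gradient decays by `θ ^ n` while its
  -- controlled value grows by `η ^ n`.
  choose z hz hzE hzW using fun n : ℕ =>
    exists_mem_ball_le_powAvg S hb hR hη hE hi0 hi1 hj hj' (hW.measurable j) hx n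
  rw [← hc] at hzW
  have hpos : ∀ n : ℕ, 0 < b ^ (-(j + n)) := fun n => zpow_pos hb0 _
  have hanti : ∀ n : ℕ, b ^ (-(j + (n + 1 : ℕ))) ≤ b ^ (-(j + n)) := fun n =>
    zpow_le_zpow_right₀ hb.le (by push_cast; lia)
  have hstep : ∀ n, edist (u (z n)) (u (z (n + 1))) ≤ c * (1 + η) * (θ * η) ^ n * V := by
    intro n
    have h1 := mem_ball.1 (hz n).1
    have h2 := mem_ball.1 (hz (n + 1)).1
    refine (hW.bound (j + n) _ _ (hz n).2 (hz (n + 1)).2 (hzE n) (hzE (n + 1)) ?_).trans ?_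
    · linarith [dist_triangle_right (z n) (z (n + 1)) x, hanti n, hpos n]
    · calc W (j + n) (z n) + W (j + n) (z (n + 1))
          ≤ θ ^ n * (c * η ^ n * V) + θ ^ n * (c * η ^ (n + 1) * V) :=
            add_le_add ((hθ j n _).trans (by gcongr; exact hzW n))
              ((hθ j n _).trans (by gcongr; exact hzW (n + 1)))
        _ = _ := by rw [pow_succ, mul_pow]; ring
  -- The steps increase geometrically with ratio `θ * η`, so their sum is governed by the last one.
  -- The inequality `σ + 1 ≤ σ * (θ * η)` is exactly what closes the induction.
  have hsum : ∀ n, edist (u (z 0)) (u (z n)) ≤ c * (1 + η) * σ * (θ * η) ^ n * V := by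
    intro n
    induction n with
    | zero => rw [edist_self]; exact zero_le
    | succ n ih =>
      calc edist (u (z 0)) (u (z (n + 1)))
          ≤ c * (1 + η) * σ * (θ * η) ^ n * V + c * (1 + η) * (θ * η) ^ n * V :=
            (edist_triangle _ _ _).trans (add_le_add ih (hstep n))
        _ = c * (1 + η) * (σ + 1) * (θ * η) ^ n * V := by ring
        _ ≤ c * (1 + η) * (σ * (θ * η)) * (θ * η) ^ n * V := by gcongr
        _ = _ := by rw [pow_succ]; ring
  refine ⟨z 0, by simpa using hz 0, hzE 0, by simpa using hzW 0, fun n => ?_⟩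
  have h1 := mem_ball'.1 (hz n).1
  have h2 : edist (u x) (u (z n)) ≤ θ ^ n * W j x + θ ^ n * (c * η ^ n * V) :=
    (hW.bound (j + n) _ _ hx.2 (hz n).2 hxE (hzE n) (by linarith [hpos n])).trans
      (add_le_add (hθ j n _) ((hθ j n _).trans (by gcongr; exact hzW n)))
  calc edist (u x) (u (z 0)) ≤ edist (u x) (u (z n)) + edist (u (z n)) (u (z 0)) :=
        edist_triangle _ _ _
    _ ≤ (θ ^ n * W j x + θ ^ n * (c * η ^ n * V)) + c * (1 + η) * σ * (θ * η) ^ n * V := by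
        rw [edist_comm (u (z n))]
        exact add_le_add h2 (hsum n)
    _ = _ := by rw [mul_pow]; ring

/-- The constant in the mean oscillation estimate. -/
noncomputable def oscConst (C D : ℝ) (M : ℝ≥0∞) (b t : ℝ) (η : ℝ≥0) (σ : ℝ≥0∞) : ℝ≥0∞ :=
  let c := (ENNReal.ofReal (C * (2 + b) ^ D) * M) ^ (1 / t)
  (3 * (η + (c + c * (1 + η) * σ)) + 2 * c) * (1 + ENNReal.ofReal (C * (5 + 3 * b) ^ D) * M)

lemma oscConst_ne_top (ht : 0 < t) (hM : M ≠ ∞) {η : ℝ≥0} {σ : ℝ≥0∞} (hσ : σ ≠ ∞) :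
    oscConst C D M b t η σ ≠ ∞ := by
  have hc : (ENNReal.ofReal (C * (2 + b) ^ D) * M) ^ (1 / t) ≠ ∞ :=
    ENNReal.rpow_ne_top_of_nonneg (by positivity) (ENNReal.mul_ne_top ENNReal.ofReal_ne_top hM)
  have h1 : (1 : ℝ≥0∞) + η ≠ ∞ := by simp
  have h2 : ENNReal.ofReal (C * (5 + 3 * b) ^ D) * M ≠ ∞ :=
    ENNReal.mul_ne_top ENNReal.ofReal_ne_top hM
  unfold oscConst
  refine ENNReal.mul_ne_top (ENNReal.add_ne_top.2 ⟨ENNReal.mul_ne_top (by simp)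
    (ENNReal.add_ne_top.2 ⟨by simp, ENNReal.add_ne_top.2 ⟨hc,
      ENNReal.mul_ne_top (ENNReal.mul_ne_top hc h1) hσ⟩⟩), ENNReal.mul_ne_top (by simp) hc⟩)
    (ENNReal.add_ne_top.2 ⟨by simp, h2⟩)

/-- The mean oscillation of `u` over a reflected ball is controlled by a power mean of exponent
less than one of its ball gradient. -/
lemma laverage_edist_le (S : WhitneySetup μ Ω pt C D M R (3 + 3 * b) t) (ht1 : t ≤ 1) (hb : 1 < b)
    (hR : 3 * b ≤ R) {η θ : ℝ≥0} (hη1 : 1 < η) (hηθ : θ * η = η ^ t) (hη : b ^ D ≤ (η : ℝ) ^ t)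
    (hE : μ E = 0) (hW : IsBallGradient Ω b u W E)
    (hθ : ∀ (k : ℤ) (n : ℕ) x, W (k + n) x ≤ θ ^ n * W k x)
    {σ : ℝ≥0∞} (hσt : σ ≠ ∞) (hσ : σ + 1 ≤ σ * (θ * η)) {i : ℕ}
    (hi0 : 0 < infDist (pt i) Ω) (hi1 : infDist (pt i) Ω < 1) {k : ℤ}
    (hk : 12 * infDist (pt i) Ω ≤ b ^ (-k)) {y : X} (hy : y ∈ reflBall Ω pt 3 i) (hyE : y ∉ E) :
    ⨍⁻ x in reflBall Ω pt 3 i, edist (u x) (u y) ∂μ ≤ oscConst C D M b t η σ *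
      (powAvg μ t (reflBall Ω pt (3 + 3 * b) i) (W k) + W k y) := by
  obtain ⟨h, hd, hM, hΩ, hne, hpt, hR8, ht, -⟩ := id S
  obtain ⟨j, hj, hj', hjk⟩ := exists_scale hb (x := 12 * infDist (pt i) Ω) (by linarith)
  have hle : ∀ x, W j x ≤ W k x := fun x => by
    obtain ⟨n, hn⟩ := Int.le.dest (hjk k hk)
    rw [← hn]
    exact hW.antitone k n x
  refine le_trans ?_ (mul_le_mul' le_rfl (add_le_add (powAvg_mono ht _ hle) (hle y)))
  set T := reflBall Ω pt (3 + 3 * b) i with hT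
  set V := powAvg μ t T (W j) with hV
  set c := (ENNReal.ofReal (C * (2 + b) ^ D) * M) ^ (1 / t) with hc
  set c' := η + (c + c * (1 + η) * σ) with hc'
  set L := ENNReal.ofReal (C * (5 + 3 * b) ^ D) * M with hL
  have hA : oscConst C D M b t η σ = (3 * c' + 2 * c) * (1 + L) := rfl
  have hS0 := measure_reflBall_ne_zero h hd hne hi0 (by linarith) le_rfl
  have hSt := measure_reflBall_ne_top h (Ω := Ω) (pt := pt) 3 i
  -- The mean `V` may vanish, and the optimization divides by it; a finite `γ > V` is used and sent
  -- to `V` afterwards.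
  suffices H : ∀ γ, V < γ → γ ≠ ∞ → ⨍⁻ x in reflBall Ω pt 3 i, edist (u x) (u y) ∂μ ≤
      oscConst C D M b t η σ * (γ + W j y) by
    have h1 : (1 : ℝ≥0∞) ≤ oscConst C D M b t η σ := by
      rw [hA]
      have h3 : (1 : ℝ≥0∞) ≤ 3 * c' := by
        have : (1 : ℝ≥0∞) ≤ c' := (by exact_mod_cast hη1.le : (1 : ℝ≥0∞) ≤ η).trans le_self_add
        exact this.trans (le_mul_of_one_le_left zero_le (by norm_num))
      calc (1 : ℝ≥0∞) = 1 * 1 := (one_mul 1).symm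
        _ ≤ _ := mul_le_mul' (h3.trans le_self_add) le_self_add
    by_cases hAt : oscConst C D M b t η σ * (V + W j y) = ∞
    · rw [hAt]; exact le_top
    have hVt : V ≠ ∞ := by
      rintro hVt
      rw [hVt, top_add, ENNReal.mul_top (zero_lt_one.trans_le h1).ne'] at hAt
      exact hAt rfl
    have hA' : oscConst C D M b t η σ ≠ ∞ := oscConst_ne_top ht hM hσt
    refine ENNReal.le_of_forall_pos_le_add fun ε hε _ => ?_
    have := H (V + ε / oscConst C D M b t η σ) (ENNReal.lt_add_right hVt
      (ENNReal.div_pos (by exact_mod_cast hε.ne') hA').ne')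
      (ENNReal.add_ne_top.2 ⟨hVt, ENNReal.div_ne_top ENNReal.coe_ne_top
        (zero_lt_one.trans_le h1).ne'⟩)
    refine this.trans (le_of_eq ?_)
    rw [add_right_comm, mul_add, ENNReal.mul_div_cancel (zero_lt_one.trans_le h1).ne' hA']
  intro γ hγ hγt
  have hγ0 : γ ≠ 0 := (lt_of_le_of_lt zero_le hγ).ne'
  -- The decisive gain: stopping the chain at the best stage makes the oscillation at `x` depend on
  -- `W j x` only through its power `t`, so its integral is governed by the `t`-power mean.
  have hpoint : ∀ x ∈ reflBall Ω pt 3 i, x ∉ E → ∃ z ∈ ball x (b ^ (-j) / 4) ∩ Ω, z ∉ E ∧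
      W j z ≤ c * γ ∧ edist (u x) (u z) ≤ c' * (γ + γ * (W j x / γ) ^ t) := by
    intro x hx hxE
    obtain ⟨z, hz, hzE, hzW, hzu⟩ := exists_mem_ball_forall_edist_le S hb hR hη hE hW hθ hσ hi0
      hi1 hj hj' hc hx hxE
    refine ⟨z, hz, hzE, hzW.trans (by gcongr), ?_⟩
    exact le_of_forall_pow_bound hη1 ht hηθ hγ0 hγt fun n => (hzu n).trans (by gcongr)
  obtain ⟨y', hy', hyE', hyW', hyu'⟩ := hpoint y hy hyE
  have hpair : ∀ x ∈ reflBall Ω pt 3 i, x ∉ E → edist (u x) (u y) ≤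
      (3 * c' + 2 * c) * ((γ + W j y) + γ * (W j x / γ) ^ t) := by
    intro x hx hxE
    obtain ⟨x', hx', hxE', hxW', hxu'⟩ := hpoint x hx hxE
    have hd' : dist x' y' < b ^ (-j) := by
      have h1 := mem_ball.1 hx.1
      have h2 := mem_ball.1 hy.1
      have h3 := mem_ball.1 hx'.1
      have h4 := mem_ball'.1 hy'.1
      linarith [dist_triangle4 x' x y y', dist_triangle_right x y (pt i)]
    have h5 := hW.bound j x' y' hx'.2 hy'.2 hxE' hyE' hd'
    have h6 := mul_div_rpow_le ht ht1 hγ0 hγt (W j y)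
    set P := γ * (W j x / γ) ^ t
    calc edist (u x) (u y) ≤ edist (u x) (u x') + edist (u x') (u y') + edist (u y') (u y) :=
          edist_triangle4 _ _ _ _
      _ ≤ c' * (γ + P) + (c * γ + c * γ) + c' * (γ + (γ + W j y)) := by
          rw [edist_comm (u y')]
          gcongr
          · exact h5.trans (add_le_add hxW' hyW')
          · exact hyu'.trans (by gcongr)
      _ = 3 * c' * γ + 2 * c * γ + c' * (P + W j y) := by ring
      _ ≤ 3 * c' * γ + 2 * c * γ + ((3 * c' + 2 * c) * (P + W j y)) := by
          gcongr
          exact (le_mul_of_one_le_left zero_le (by norm_num)).trans le_self_add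
      _ = _ := by ring
  -- The mean of `W j ^ t` over the smaller reflected ball is at most `L * γ ^ t`, so the normalized
  -- integrand has mean at most `γ * L`.
  have hmean : ∫⁻ x in reflBall Ω pt 3 i, γ * (W j x / γ) ^ t ∂μ ≤
      γ * L * μ (reflBall Ω pt 3 i) := by
    have h1 : μ T ≤ L * μ (reflBall Ω pt 3 i) := by
      refine (measure_mono Set.inter_subset_left).trans ((measure_ball_le_reflBall h hd hne hi0
        (by linarith) (L := 3 + 3 * b) (by linarith) (by simp)).trans ?_)
      rw [show 3 + 3 * b + 2 = 5 + 3 * b by ring]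
    have h2 := powAvg_le_of_subset ht (reflBall_mono (by linarith) i) hS0
      (measure_reflBall_ne_top h (3 + 3 * b) i) h1 (W j)
    have h3 : powAvg μ t (reflBall Ω pt 3 i) (W j) ≤ L ^ (1 / t) * γ := h2.trans (by gcongr)
    rw [powAvg, rpow_one_div_le_iff ht, ENNReal.mul_rpow_of_nonneg _ _ ht.le, ← ENNReal.rpow_mul,
      one_div_mul_cancel ht.ne', ENNReal.rpow_one, setLAverage_eq,
      ENNReal.div_le_iff hS0 hSt] at h3
    have h4 : ∀ x, γ * (W j x / γ) ^ t = γ * (γ ^ t)⁻¹ * W j x ^ t := fun x => by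
      rw [ENNReal.div_rpow_of_nonneg _ _ ht.le, div_eq_mul_inv]; ring
    simp_rw [h4]
    rw [lintegral_const_mul _ ((hW.measurable j).pow_const t)]
    have hγt0 : γ ^ t ≠ 0 := (ENNReal.rpow_pos (pos_iff_ne_zero.2 hγ0) hγt).ne'
    have hγtt : γ ^ t ≠ ∞ := ENNReal.rpow_ne_top_of_nonneg ht.le hγt
    calc γ * (γ ^ t)⁻¹ * ∫⁻ x in reflBall Ω pt 3 i, W j x ^ t ∂μ
        ≤ γ * (γ ^ t)⁻¹ * (L * γ ^ t * μ (reflBall Ω pt 3 i)) := by gcongr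
      _ = γ * L * μ (reflBall Ω pt 3 i) * (γ ^ t * (γ ^ t)⁻¹) := by ring
      _ = _ := by rw [ENNReal.mul_inv_cancel hγt0 hγtt, mul_one]
  rw [setLAverage_eq, ENNReal.div_le_iff hS0 hSt]
  have hmeas : Measurable fun x => γ * (W j x / γ) ^ t :=
    (((hW.measurable j).div_const γ).pow_const t).const_mul γ
  calc ∫⁻ x in reflBall Ω pt 3 i, edist (u x) (u y) ∂μ
      ≤ ∫⁻ x in reflBall Ω pt 3 i, (3 * c' + 2 * c) *
          ((γ + W j y) + γ * (W j x / γ) ^ t) ∂μ := by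
        refine setLIntegral_mono_ae' (measurableSet_reflBall hΩ 3 i) ?_
        filter_upwards [measure_eq_zero_iff_ae_notMem.1 hE] with x hxE hx
        exact hpair x hx hxE
    _ = (3 * c' + 2 * c) * ((γ + W j y) * μ (reflBall Ω pt 3 i) +
          ∫⁻ x in reflBall Ω pt 3 i, γ * (W j x / γ) ^ t ∂μ) := by
        rw [lintegral_const_mul _ (hmeas.const_add _), lintegral_add_right _ hmeas,
          setLIntegral_const]
    _ ≤ (3 * c' + 2 * c) * ((γ + W j y) * μ (reflBall Ω pt 3 i) +
          (γ + W j y) * L * μ (reflBall Ω pt 3 i)) := by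
        gcongr
        refine hmean.trans ?_
        gcongr
        exact le_self_add
    _ = _ := by rw [hA]; ring

/-- Mean values over reflected balls near `Ω`, and `0` far from `Ω`. -/
noncomputable def meanRef (μ : Measure X) (Ω : Set X) (pt : ℕ → X) (u : X → ℝ) (i : ℕ) : ℝ :=
  open Classical in
  if 0 < infDist (pt i) Ω ∧ infDist (pt i) Ω < 1 then ⨍ x in reflBall Ω pt 3 i, u x ∂μ else 0

/-- Mean values are reference values. -/
lemma isReference_meanRef (S : WhitneySetup μ Ω pt C D M R (3 + 3 * b) t) (ht1 : t ≤ 1)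
    (hb : 1 < b) (hR : 3 * b ≤ R) {η θ : ℝ≥0} (hη1 : 1 < η) (hηθ : θ * η = η ^ t)
    (hη : b ^ D ≤ (η : ℝ) ^ t) (hE : μ E = 0) (hu : Measurable u) (hW : IsBallGradient Ω b u W E)
    (hθ : ∀ (k : ℤ) (n : ℕ) x, W (k + n) x ≤ θ ^ n * W k x)
    {σ : ℝ≥0∞} (hσt : σ ≠ ∞) (hσ : σ + 1 ≤ σ * (θ * η)) :
    IsReference μ Ω pt b (3 + 3 * b) t (oscConst C D M b t η σ) u W E (meanRef μ Ω pt u) := by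
  obtain ⟨h, hd, -, hΩ, hne, hpt, hR8, ht, -⟩ := id S
  refine ⟨fun i hi => ?_, fun i h0 h1 k hk y hy hyE => ?_⟩
  · rw [meanRef, if_neg fun h => absurd h.2 (not_lt.2 hi)]
  · rw [meanRef, if_pos ⟨h0, h1⟩]
    exact (edist_setAverage_le (measure_reflBall_ne_zero h hd hne h0 (by linarith) le_rfl)
      (measure_reflBall_ne_top h _ _) hu _).trans
      (laverage_edist_le S ht1 hb hR hη1 hηθ hη hE hW hθ hσt hσ h0 h1 hk hy hyE)

end

end HajlaszExt

/-! ### Sets of positive density are almost closed -/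

namespace HajlaszExt

open Metric Filter Topology

/-- By the Lebesgue density theorem almost every point of `N` is a point of density 1, which a bound
`κ < 1` excludes. -/
lemma measure_eq_zero_of_density_lt {X : Type*} [PseudoMetricSpace X] [MeasurableSpace X]
    [BorelSpace X] [SecondCountableTopology X] {ν : Measure X} [IsUnifLocDoublingMeasure ν]
    [IsLocallyFiniteMeasure ν] {N : Set X} {κ : ℝ≥0∞} (hκ : κ < 1)
    (h : ∀ x ∈ N, ∀ᶠ r in 𝓝[>] (0 : ℝ), ν (N ∩ closedBall x r) / ν (closedBall x r) ≤ κ) :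
    ν N = 0 := by
  have h1 := IsUnifLocDoublingMeasure.ae_tendsto_measure_inter_div ν N 1
  have h2 : ∀ᵐ x ∂ν.restrict N, x ∉ N := by
    filter_upwards [h1] with x hx hxN
    have h3 := hx (l := 𝓝[>] (0 : ℝ)) (fun _ => x) id tendsto_id (by
      filter_upwards [self_mem_nhdsWithin] with r hr
      exact mem_closedBall_self (by simpa using (Set.mem_Ioi.1 hr).le))
    exact absurd (le_of_tendsto h3 (h x hxN)) (not_le.2 hκ)
  rw [← measure_eq_zero_iff_ae_notMem, Measure.restrict_apply_self] at h2
  exact h2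

variable {X : Type*} [PseudoMetricSpace X] [MeasurableSpace X] [OpensMeasurableSpace X]
  {Ω : Set X} {μ : Measure X} {C D : ℝ} {M : ℝ≥0∞} {R : ℝ}

/-- Points of `closure Ω` inherit the density condition from points of `Ω` close by. The rest of the
closure thus has density at most `1 - K⁻¹` at each of its points and must be null. -/
lemma measure_closure_diff_eq_zero (h : IsDoublingSpace μ C D) (hd : HasDensity μ Ω M R)
    (hM : M ≠ ∞) (hR : 0 < R) (hΩ : MeasurableSet Ω)
    (hreg : ∀ A : Set X, MeasurableSet A → ∃ B, MeasurableSet[borel X] B ∧ A ⊆ B ∧ μ B = μ A) :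
    μ (closure Ω \ Ω) = 0 := by
  have hle : borel X ≤ ‹MeasurableSpace X› := OpensMeasurableSpace.borel_le
  have hsc := h.secondCountable
  -- The ambient σ-algebra may exceed the Borel one, for which the density theorem is available.
  -- Borel regularity says that restricting to Borel sets loses no measure.
  have htrim : ∀ A, MeasurableSet A → μ.trim hle A = μ A := by
    intro A hA
    refine le_antisymm ?_ (le_trim hle)
    obtain ⟨B, hB, hAB, hBA⟩ := hreg A hA
    rw [← hBA, ← trim_measurableSet_eq hle hB]
    exact measure_mono hAB
  have hcb : ∀ (x : X) r, MeasurableSet (closedBall x r) := fun x r =>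
    isClosed_closedBall.measurableSet
  have hcbt : ∀ (x : X) r, μ (closedBall x r) ≠ ∞ := fun x r =>
    ne_top_of_le_ne_top (h.ball_lt_top x (r + 1)).ne
      (measure_mono (closedBall_subset_ball (by linarith)))
  set K := ENNReal.ofReal (C * 5 ^ D) * M with hK
  have hKt : K ≠ ∞ := ENNReal.mul_ne_top ENNReal.ofReal_ne_top hM
  have hdens : ∀ x ∈ closure Ω, ∀ r, 0 < r → r ≤ R →
      μ (closedBall x r) ≤ K * μ (closedBall x r ∩ Ω) := by
    intro x hx r hr hrR
    obtain ⟨z, hz, hxz⟩ := Metric.mem_closure_iff.1 hx (r / 2) (by positivity)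
    calc μ (closedBall x r) ≤ μ (ball x (2 * r)) :=
          measure_mono (closedBall_subset_ball (by linarith))
      _ ≤ ENNReal.ofReal (C * 5 ^ D) * μ (ball z (r / 2)) :=
          h.ball_le_ball (by positivity) (by norm_num) (by linarith)
      _ ≤ ENNReal.ofReal (C * 5 ^ D) * (M * μ (ball z (r / 2) ∩ Ω)) := by
          gcongr
          exact hd z hz _ (by positivity) (by linarith)
      _ ≤ ENNReal.ofReal (C * 5 ^ D) * (M * μ (closedBall x r ∩ Ω)) := by
          gcongr
          intro w hw
          rw [mem_ball] at hw
          rw [mem_closedBall]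
          linarith [dist_triangle w z x, dist_comm z x]
      _ = _ := by rw [hK, mul_assoc]
  have hdoub : ∀ (x : X) r, 0 < r → μ.trim hle (closedBall x (2 * r)) ≤
      ENNReal.ofReal (C * 3 ^ D) * μ.trim hle (closedBall x r) := by
    intro x r hr
    rw [htrim _ (hcb _ _), htrim _ (hcb _ _)]
    calc μ (closedBall x (2 * r)) ≤ μ (ball x (3 * r)) :=
          measure_mono (closedBall_subset_ball (by linarith))
      _ ≤ ENNReal.ofReal (C * 3 ^ D) * μ (ball x r) :=
          h.ball_le_ball hr (by norm_num) (by simp)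
      _ ≤ _ := by
          gcongr
          exact ball_subset_closedBall
  have hfin : ∀ x : X, μ.trim hle (closedBall x 1) < ∞ := fun x => by
    rw [htrim _ (hcb _ _)]
    exact (hcbt x 1).lt_top
  have hN : MeasurableSet (closure Ω \ Ω) := isClosed_closure.measurableSet.diff hΩ
  have hratio : ∀ x ∈ closure Ω, ∀ r, 0 < r → r ≤ R →
      μ.trim hle ((closure Ω \ Ω) ∩ closedBall x r) / μ.trim hle (closedBall x r) ≤ 1 - K⁻¹ := by
    intro x hx r hr hrR
    have hpos : μ (closedBall x r) ≠ 0 := fun h0 =>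
      (h.ball_pos x r hr).ne' (measure_mono_null ball_subset_closedBall h0)
    rw [htrim _ (hN.inter (hcb x r)), htrim _ (hcb x r),
      ENNReal.div_le_iff hpos (hcbt x r), ENNReal.sub_mul fun _ _ => hcbt x r, one_mul]
    have h1 : μ (closure Ω \ Ω ∩ closedBall x r) ≤ μ (closedBall x r \ Ω) :=
      measure_mono fun w hw => ⟨hw.2, hw.1.2⟩
    have h2 := measure_inter_add_sdiff (μ := μ) (closedBall x r) hΩ
    have h3 : K⁻¹ * μ (closedBall x r) ≤ μ (closedBall x r ∩ Ω) := by
      rw [mul_comm, ← div_eq_mul_inv]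
      exact ENNReal.div_le_of_le_mul' (hdens x hx r hr hrR)
    refine h1.trans (ENNReal.le_sub_of_add_le_left
      (ne_top_of_le_ne_top (hcbt x r) (h3.trans (measure_mono Set.inter_subset_left))) ?_)
    exact (add_le_add_left h3 _).trans h2.le
  refine measure_eq_zero_of_trim_eq_zero hle ?_
  set ν := μ.trim hle with hν
  let m₀ : MeasurableSpace X := borel X
  have : BorelSpace X := ⟨rfl⟩
  have : IsUnifLocDoublingMeasure ν := by
    refine ⟨⟨Real.toNNReal (C * 3 ^ D), ?_⟩⟩
    filter_upwards [self_mem_nhdsWithin] with r hr x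
    have hr' : 0 < r := hr
    exact hdoub x r hr'
  have : IsLocallyFiniteMeasure ν := by
    refine ⟨fun x => ⟨closedBall x 1, closedBall_mem_nhds x one_pos, hfin x⟩⟩
  refine measure_eq_zero_of_density_lt (κ := 1 - K⁻¹)
    (ENNReal.sub_lt_self ENNReal.one_ne_top one_ne_zero (ENNReal.inv_ne_zero.2 hKt)) ?_
  rintro x ⟨hx, -⟩
  filter_upwards [Ioc_mem_nhdsGT hR] with r hr
  exact hratio x hx r hr.1 hr.2

end HajlaszExt

/-! ### Measurability and linearity of the extension -/

namespace HajlaszExt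

open Metric

/-- On a set of finite measure `f ^ t ≤ 1 + f ^ p` suffices. -/
lemma powAvg_ne_top {X : Type*} [MeasurableSpace X] {μ : Measure X} {t : ℝ} (ht : 0 < t)
    {p : ℝ≥0∞} (hp : p ≠ ∞) (htp : ENNReal.ofReal t < p) {S : Set X} (hS0 : μ S ≠ 0)
    (hS : μ S ≠ ∞) {f : X → ℝ≥0∞} (hf : eLpNorm f p μ ≠ ∞) : powAvg μ t S f ≠ ∞ := by
  have hp0 : p ≠ 0 := (lt_of_le_of_lt zero_le htp).ne'
  have htp' : t < p.toReal := (ENNReal.ofReal_lt_iff_lt_toReal ht.le hp).1 htp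
  have hp' : 0 < p.toReal := ht.trans htp'
  refine ENNReal.rpow_ne_top_of_nonneg (by positivity) ?_
  rw [setLAverage_eq]
  refine ENNReal.div_ne_top ?_ hS0
  have h1 : ∫⁻ x, f x ^ p.toReal ∂μ ≠ ∞ := fun h => hf (by
    rw [eLpNorm_eq_lintegral_ennreal hp0 hp, h, ENNReal.top_rpow_of_pos (by positivity)])
  have h2 : ∀ x, f x ^ t ≤ 1 + f x ^ p.toReal := fun x => by
    rcases le_total (f x) 1 with h | h
    · exact (ENNReal.rpow_le_one h ht.le).trans le_self_add
    · exact (ENNReal.rpow_le_rpow_of_exponent_le h htp'.le).trans le_add_self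
  refine ne_top_of_le_ne_top ?_ (lintegral_mono h2)
  rw [lintegral_add_left measurable_const, setLIntegral_const, one_mul]
  exact ENNReal.add_ne_top.2 ⟨hS, ne_top_of_le_ne_top h1 (setLIntegral_le_lintegral _ _)⟩

section

variable {X : Type*} [PseudoMetricSpace X] [MeasurableSpace X]
  {Ω : Set X} {pt : ℕ → X} {μ : Measure X} {C D : ℝ} {M : ℝ≥0∞} {R b K t : ℝ} {u v : X → ℝ}
  {W : ℤ → X → ℝ≥0∞} {E : Set X} {A p : ℝ≥0∞} {a : ℕ → ℝ}

lemma whitneyAvg_ne_top (S : WhitneySetup μ Ω pt C D M R K t) (hp : p ≠ ∞)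
    (htp : ENNReal.ofReal t < p) {f : X → ℝ≥0∞} (hf : eLpNorm f p μ ≠ ∞) (x : X) :
    whitneyAvg μ Ω pt (3 * K + 2) t f x ≠ ∞ := by
  obtain ⟨h, hd, -, hΩ, hne, hpt, hR, ht, hK⟩ := id S
  unfold whitneyAvg
  split_ifs with hx
  · have ai := abs_le.1 (abs_infDist_sub_le (Ω := Ω) x (pt (whitneyIndex Ω pt x)))
    have hi := dist_whitneyIndex hpt hx.1
    exact powAvg_ne_top ht hp htp
      (measure_reflBall_ne_zero h hd hne (by linarith [hx.1]) (by linarith [hx.2]) (by linarith))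
      (measure_reflBall_ne_top h _ _) hf
  · exact ENNReal.zero_ne_top

lemma smoothAvg_const_mul (c : ℝ) (m : X → ℝ) (x : X) :
    smoothAvg μ Ω (fun w => c * m w) x = c * smoothAvg μ Ω m x := by
  unfold smoothAvg
  simp_rw [mul_left_comm _ c]
  rw [integral_const_mul, mul_div_assoc]

/-- Homogeneity holds for every function, as Bochner integrals commute with scalars without
integrability; additivity is where work is needed. -/
lemma extendBy_meanRef_smul (c : ℝ) (u : X → ℝ) :
    extendBy μ Ω pt (meanRef μ Ω pt (c • u)) (c • u) =
      c • extendBy μ Ω pt (meanRef μ Ω pt u) u := by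
  have h1 : ∀ i, meanRef μ Ω pt (c • u) i = c * meanRef μ Ω pt u i := fun i => by
    unfold meanRef
    split_ifs
    · simp only [setAverage_eq, Pi.smul_apply, smul_eq_mul, integral_const_mul]
      ring
    · simp
  ext x
  simp only [extendBy, h1, Pi.smul_apply, smul_eq_mul, smoothAvg_const_mul]
  split_ifs <;> simp

variable [OpensMeasurableSpace X]

lemma WhitneySetup.measurable_extendBy (S : WhitneySetup μ Ω pt C D M R K t) (hu : Measurable u)
    (a : ℕ → ℝ) : Measurable (extendBy μ Ω pt a u) := by
  classical
  have := S.doubling.secondCountable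
  have := S.doubling.sigmaFinite
  unfold extendBy
  refine Measurable.ite S.measurableSet hu (Measurable.ite ?_ ?_ measurable_const)
  · exact (isOpen_lt continuous_const (continuous_infDist_pt Ω)).measurableSet
  · exact measurable_smoothAvg (measurable_ref S.dense a)

/-- Reference values are locally bounded away from `Ω`. -/
lemma IsReference.exists_abs_le (ha : IsReference μ Ω pt b K t A u W E a)
    (hW : IsBallGradient Ω b u W E) (hu : Measurable u) (S : WhitneySetup μ Ω pt C D M R K t)
    (hE : μ E = 0) (hb : 1 < b) (hA : A ≠ ∞) (hp : p ≠ ∞) (htp : ENNReal.ofReal t < p)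
    (hup : eLpNorm u p μ ≠ ∞) (hWp : ∀ k, eLpNorm (W k) p μ ≠ ∞) {x : X}
    (hx : 0 < infDist x Ω) :
    ∃ B, ∀ w, dist x w < infDist x Ω / 8 → |a (whitneyIndex Ω pt w)| ≤ B := by
  obtain ⟨N, hN⟩ := pow_unbounded_of_one_lt 12 hb
  have hsum : eLpNorm (fun y => ‖u y‖ₑ + W (-N) y) p μ ≠ ∞ := by
    refine ne_top_of_le_ne_top (ENNReal.mul_ne_top (ENNReal.LpAddConst_lt_top p).ne
      (ENNReal.add_ne_top.2 ⟨?_, hWp (-N)⟩)) (eLpNorm_add_le' hu.enorm.aestronglyMeasurable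
        (hW.measurable _).aestronglyMeasurable p)
    rwa [eLpNorm_enorm]
  set V := ((2 * A + 1) * avgConst C D M K t) *
      whitneyAvg μ Ω pt (3 * K + 2) t (fun y => ‖u y‖ₑ + W (-N) y) x with hV
  have hVt : V ≠ ∞ := by
    refine ENNReal.mul_ne_top (ENNReal.mul_ne_top (ENNReal.add_ne_top.2
      ⟨ENNReal.mul_ne_top (by simp) hA, by simp⟩) ?_) (whitneyAvg_ne_top S hp htp hsum x)
    have := S.exponent_pos
    exact ENNReal.rpow_ne_top_of_nonneg (by positivity)
      (ENNReal.mul_ne_top ENNReal.ofReal_ne_top S.density_ne_top)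
  refine ⟨V.toReal, fun w hw => ?_⟩
  have h1 := ha.enorm_le hW hu S hE hx (dist_whitneyIndex_lt S.dense hx (w := w) (by linarith))
    (k := -N) (by simpa using hN.le)
  rwa [edist_dist, ENNReal.ofReal_le_iff_le_toReal hVt, Real.dist_eq, sub_zero] at h1

lemma smoothAvg_add (h : IsDoublingSpace μ C D) {m m' : X → ℝ} (hm : Measurable m)
    (hm' : Measurable m') {x : X} {B B' : ℝ} (hB : ∀ w, dist x w < infDist x Ω / 8 → |m w| ≤ B)
    (hB' : ∀ w, dist x w < infDist x Ω / 8 → |m' w| ≤ B') :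
    smoothAvg μ Ω (fun w => m w + m' w) x = smoothAvg μ Ω m x + smoothAvg μ Ω m' x := by
  unfold smoothAvg
  simp_rw [mul_add]
  rw [integral_add (integrable_bump_mul h hm hB) (integrable_bump_mul h hm' hB'), add_div]

/-- Parameters for the chaining argument behind the mean oscillation estimate. -/
structure ChainSetup (μ : Measure X) (Ω : Set X) (pt : ℕ → X) (C D : ℝ)
    (M : ℝ≥0∞) (R b t : ℝ) (η θ : ℝ≥0) (σ : ℝ≥0∞) : Prop where
  whitney : WhitneySetup μ Ω pt C D M R (3 + 3 * b) t
  exponent_le : t ≤ 1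
  one_lt : 1 < b
  radius : 3 * b ≤ R
  one_lt_eta : 1 < η
  theta_mul : θ * η = η ^ t
  le_eta : b ^ D ≤ (η : ℝ) ^ t
  sigma_ne_top : σ ≠ ∞
  sigma_le : σ + 1 ≤ σ * (θ * η)

variable {η θ : ℝ≥0} {σ : ℝ≥0∞}

/-- A function of finite `L^p` norm having an integrable, geometrically decaying ball gradient. -/
structure IsTame (μ : Measure X) (Ω : Set X) (b : ℝ) (θ : ℝ≥0) (p : ℝ≥0∞) (u : X → ℝ)
    (W : ℤ → X → ℝ≥0∞) (E : Set X) : Prop where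
  measurable : Measurable u
  ballGradient : IsBallGradient Ω b u W E
  null : μ E = 0
  decay : ∀ (k : ℤ) (n : ℕ) x, W (k + n) x ≤ θ ^ n * W k x
  norm_ne_top : eLpNorm u p μ ≠ ∞
  grad_ne_top : ∀ k, eLpNorm (W k) p μ ≠ ∞

lemma IsTame.isReference (T : IsTame μ Ω b θ p u W E) (S : ChainSetup μ Ω pt C D M R b t η θ σ) :
    IsReference μ Ω pt b (3 + 3 * b) t (oscConst C D M b t η σ) u W E (meanRef μ Ω pt u) :=
  isReference_meanRef S.whitney S.exponent_le S.one_lt S.radius S.one_lt_eta S.theta_mul S.le_eta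
    T.null T.measurable T.ballGradient T.decay S.sigma_ne_top S.sigma_le

/-- For `p < 1` membership in `L^p` does not give local integrability. It comes from the mean
oscillation estimate against a good point, whose right-hand side is finite. -/
lemma IsTame.integrableOn (T : IsTame μ Ω b θ p u W E) (S : ChainSetup μ Ω pt C D M R b t η θ σ)
    (hp : p ≠ ∞) (htp : ENNReal.ofReal t < p) {i : ℕ} (hi0 : 0 < infDist (pt i) Ω)
    (hi1 : infDist (pt i) Ω < 1) : IntegrableOn u (reflBall Ω pt 3 i) μ := by
  obtain ⟨h, hd, hM, hΩ, hne, hpt, hR, ht, hK⟩ := id S.whitney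
  obtain ⟨k, hk, -, -⟩ := exists_scale S.one_lt (x := 12 * infDist (pt i) Ω) (by linarith)
  have hS0 := measure_reflBall_ne_zero h hd hne hi0 (by linarith) le_rfl
  have hSt := measure_reflBall_ne_top h (Ω := Ω) (pt := pt) 3 i
  obtain ⟨y, hy, hyE, hyW⟩ := exists_mem_le_powAvg ht (measurableSet_reflBall hΩ 3 i) hS0 hSt
    T.null (T.ballGradient.measurable k)
  have h1 := laverage_edist_le S.whitney S.exponent_le S.one_lt S.radius S.one_lt_eta S.theta_mul
    S.le_eta T.null T.ballGradient T.decay S.sigma_ne_top S.sigma_le hi0 hi1 hk hy hyE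
  have h2 : ⨍⁻ x in reflBall Ω pt 3 i, edist (u x) (u y) ∂μ ≠ ∞ := by
    refine ne_top_of_le_ne_top (ENNReal.mul_ne_top (oscConst_ne_top ht hM S.sigma_ne_top)
      (ENNReal.add_ne_top.2 ⟨?_, ne_top_of_le_ne_top ?_ hyW⟩)) h1
    · exact powAvg_ne_top ht hp htp (measure_reflBall_ne_zero h hd hne hi0 (by linarith) hK)
        (measure_reflBall_ne_top h _ i) (T.grad_ne_top k)
    · exact powAvg_ne_top ht hp htp hS0 hSt (T.grad_ne_top k)
  have h3 : ∫⁻ x in reflBall Ω pt 3 i, edist (u x) (u y) ∂μ ≠ ∞ := by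
    intro h3
    rw [setLAverage_eq, h3, ENNReal.top_div_of_ne_top hSt] at h2
    exact h2 rfl
  have : IsFiniteMeasure (μ.restrict (reflBall Ω pt 3 i)) := isFiniteMeasure_restrict.2 hSt
  have h4 : IntegrableOn (fun x => u x - u y) (reflBall Ω pt 3 i) μ := by
    refine ⟨(T.measurable.sub_const _).aestronglyMeasurable, ?_⟩
    rw [hasFiniteIntegral_iff_enorm]
    simp_rw [← edist_eq_enorm_sub]
    exact lt_top_iff_ne_top.2 h3
  refine (h4.add (integrable_const (u y))).congr (Filter.Eventually.of_forall fun x => ?_)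
  simp

/-- Two integrals must be additive: the means over reflected balls, by integrability, and the
smoothing, by local boundedness of the reference values. -/
lemma extendBy_meanRef_add (S : ChainSetup μ Ω pt C D M R b t η θ σ)
    (hp : p ≠ ∞) (htp : ENNReal.ofReal t < p) {W' : ℤ → X → ℝ≥0∞} {E' : Set X}
    (T : IsTame μ Ω b θ p u W E) (T' : IsTame μ Ω b θ p v W' E') :
    extendBy μ Ω pt (meanRef μ Ω pt (u + v)) (u + v) =
      extendBy μ Ω pt (meanRef μ Ω pt u) u + extendBy μ Ω pt (meanRef μ Ω pt v) v := by
  have h1 : ∀ i, meanRef μ Ω pt (u + v) i = meanRef μ Ω pt u i + meanRef μ Ω pt v i := fun i => by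
    unfold meanRef
    split_ifs with hi
    · simp only [setAverage_eq, Pi.add_apply, smul_eq_mul]
      rw [integral_add (T.integrableOn S hp htp hi.1 hi.2) (T'.integrableOn S hp htp hi.1 hi.2),
        mul_add]
    · simp
  have hA := oscConst_ne_top (C := C) (D := D) (b := b) (η := η) S.whitney.exponent_pos
    S.whitney.density_ne_top S.sigma_ne_top
  ext x
  simp only [extendBy, h1, Pi.add_apply]
  split_ifs with hx hx0
  · rfl
  · obtain ⟨B, hB⟩ := (T.isReference S).exists_abs_le T.ballGradient T.measurable S.whitney T.null
      S.one_lt hA hp htp T.norm_ne_top T.grad_ne_top hx0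
    obtain ⟨B', hB'⟩ := (T'.isReference S).exists_abs_le T'.ballGradient T'.measurable S.whitney
      T'.null S.one_lt hA hp htp T'.norm_ne_top T'.grad_ne_top hx0
    exact smoothAvg_add S.whitney.doubling (measurable_ref S.whitney.dense _)
      (measurable_ref S.whitney.dense _) hB hB'
  · simp

end

end HajlaszExt

/-! ### Passing from a quasi-metric to a metric -/

namespace HajlaszExt

open Metric

/-- The metric of `X` is comparable to `ρ ^ β`. -/
structure IsSnowflake {X : Type*} [PseudoMetricSpace X] (ρ : X → X → ℝ) (β c : ℝ) : Prop where
  nonneg : ∀ x y, 0 ≤ ρ x y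
  exponent_pos : 0 < β
  one_le : 1 ≤ c
  dist_le : ∀ x y, dist x y ≤ c * ρ x y ^ β
  le_dist : ∀ x y, ρ x y ^ β ≤ c * dist x y

namespace IsSnowflake

variable {X : Type*} [PseudoMetricSpace X] {ρ : X → X → ℝ} {β c : ℝ}

lemma ball_subset_qball (h : IsSnowflake ρ β c) {x : X} {r : ℝ} (hr : 0 ≤ r) :
    ball x (r ^ β / c) ⊆ qball ρ x r := by
  intro y hy
  have hc : 0 < c := by linarith [h.one_le]
  rw [mem_ball', lt_div_iff₀ hc, mul_comm] at hy
  exact (Real.rpow_lt_rpow_iff (h.nonneg x y) hr h.exponent_pos).1 ((h.le_dist x y).trans_lt hy)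

lemma qball_subset_ball (h : IsSnowflake ρ β c) {x : X} {r : ℝ} :
    qball ρ x r ⊆ ball x (c * r ^ β) := by
  intro y hy
  have hc : 0 < c := by linarith [h.one_le]
  rw [mem_ball']
  refine (h.dist_le x y).trans_lt (mul_lt_mul_of_pos_left ?_ hc)
  exact Real.rpow_lt_rpow (h.nonneg x y) hy h.exponent_pos

lemma root_pow (h : IsSnowflake ρ β c) {r : ℝ} (hr : 0 ≤ r) : (r ^ β⁻¹) ^ β = r :=
  Real.rpow_inv_rpow hr h.exponent_pos.ne'

lemma qball_root_subset_ball (h : IsSnowflake ρ β c) {x : X} {r : ℝ} (hr : 0 ≤ r) :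
    qball ρ x ((r / c) ^ β⁻¹) ⊆ ball x r := by
  have hc : 0 < c := by linarith [h.one_le]
  have := h.qball_subset_ball (x := x) (r := (r / c) ^ β⁻¹)
  rwa [h.root_pow (by positivity), mul_div_cancel₀ _ hc.ne'] at this

lemma ball_subset_qball_root (h : IsSnowflake ρ β c) {x : X} {r : ℝ} (hr : 0 ≤ r) :
    ball x r ⊆ qball ρ x ((c * r) ^ β⁻¹) := by
  have hc : 0 < c := by linarith [h.one_le]
  have := h.ball_subset_qball (x := x) (r := (c * r) ^ β⁻¹) (by positivity)
  rwa [h.root_pow (by positivity), mul_div_cancel_left₀ _ hc.ne'] at this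

lemma qtopology_eq (h : IsSnowflake ρ β c) :
    qtopology ρ = (inferInstance : TopologicalSpace X) := by
  have hc : 0 < c := by linarith [h.one_le]
  refine TopologicalSpace.ext (funext fun O => propext ⟨fun hO => ?_, fun hO => ?_⟩)
  · refine Metric.isOpen_iff.2 fun x hx => ?_
    obtain ⟨r, hr, hrO⟩ := hO x hx
    exact ⟨r ^ β / c, by positivity, (h.ball_subset_qball hr.le).trans hrO⟩
  · intro x hx
    obtain ⟨r, hr, hrO⟩ := Metric.isOpen_iff.1 hO x hx
    exact ⟨(r / c) ^ β⁻¹, by positivity, (h.qball_root_subset_ball hr.le).trans hrO⟩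

variable [MeasurableSpace X] {μ : Measure X}

lemma opensMeasurableSpace (h : IsSnowflake ρ β c) (hX : IsQuasiMetricMeasureSpace ρ μ) :
    OpensMeasurableSpace X := by
  have := hX.borel_le
  rw [h.qtopology_eq] at this
  exact ⟨this⟩

/-- Balls of the two structures are nested with radii related by the power `β`, which turns the
exponent `Q` into `Q / β`. -/
lemma exists_isDoublingSpace (h : IsSnowflake ρ β c) (hX : IsQuasiMetricMeasureSpace ρ μ) {Q : ℝ}
    (hQ : 0 < Q) (hd : IsQDoubling Q ρ μ) : ∃ C, IsDoublingSpace μ C (Q / β) := by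
  obtain ⟨κ, hκ, hd⟩ := hd
  have hc : 0 < c := by linarith [h.one_le]
  have hβ := h.exponent_pos
  refine ⟨κ⁻¹ * (c * c) ^ (Q / β), by positivity, by positivity, fun x r hr => ?_, fun x r => ?_,
    fun x r R hr hrR => ?_⟩
  · exact (hX.ball_pos x _ (by positivity)).trans_le (measure_mono (h.qball_root_subset_ball hr.le))
  · rcases le_or_gt r 0 with hr | hr
    · rw [ball_eq_empty.2 hr, measure_empty]; exact ENNReal.zero_lt_top
    · exact (measure_mono (h.ball_subset_qball_root hr.le)).trans_lt
        (hX.ball_lt_top x _ (by positivity))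
  · have hR : 0 < R := hr.trans_le hrR
    set r' := (r / c) ^ β⁻¹ with hr'
    set R' := (c * R) ^ β⁻¹ with hR'
    have hr0 : 0 < r' := by positivity
    have hR0 : 0 < R' := by positivity
    have hle : r' ≤ R' := by
      refine Real.rpow_le_rpow (by positivity) ?_ (by positivity)
      rw [div_le_iff₀ hc]
      nlinarith [h.one_le, mul_pos hc hc, mul_pos hc hR]
    have key := hd x x r' R' hr0 hle fun y hy => lt_of_lt_of_le hy hle
    have e1 : R' / r' = (c * c * (R / r)) ^ β⁻¹ := by
      rw [hr', hR', ← Real.div_rpow (by positivity) (by positivity)]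
      congr 1
      field_simp
    have e2 : (R' / r') ^ Q = (c * c) ^ (Q / β) * (R / r) ^ (Q / β) := by
      rw [e1, ← Real.rpow_mul (by positivity), Real.mul_rpow (by positivity) (by positivity),
        inv_mul_eq_div]
    have hRb := hX.ball_pos x R' hR0
    have hRt := hX.ball_lt_top x R' hR0
    rw [ENNReal.le_div_iff_mul_le (Or.inl hRb.ne') (Or.inl hRt.ne)] at key
    calc μ (ball x R) ≤ μ (qball ρ x R') := measure_mono (h.ball_subset_qball_root hR.le)
      _ = ENNReal.ofReal (κ⁻¹ * (R' / r') ^ Q) *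
            (ENNReal.ofReal (κ * (r' / R') ^ Q) * μ (qball ρ x R')) := by
          rw [← mul_assoc, ← ENNReal.ofReal_mul (by positivity)]
          have : κ⁻¹ * (R' / r') ^ Q * (κ * (r' / R') ^ Q) = 1 := by
            rw [Real.div_rpow hR0.le hr0.le, Real.div_rpow hr0.le hR0.le]
            have := (Real.rpow_pos_of_pos hr0 Q).ne'
            have := (Real.rpow_pos_of_pos hR0 Q).ne'
            field_simp
          rw [this, ENNReal.ofReal_one, one_mul]
      _ ≤ ENNReal.ofReal (κ⁻¹ * (R' / r') ^ Q) * μ (ball x r) := by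
          gcongr
          exact key.trans (measure_mono (h.qball_root_subset_ball hr.le))
      _ = _ := by rw [e2]; congr 2; ring

lemma exists_hasDensity (h : IsSnowflake ρ β c) {C D : ℝ} (hC : IsDoublingSpace μ C D) {Ω : Set X}
    (hd : MeasureDensity ρ μ Ω) {R : ℝ} : ∃ M : ℝ≥0∞, M ≠ ∞ ∧ HasDensity μ Ω M R := by
  obtain ⟨A, -, hA⟩ := hd
  have hc : 0 < c := by linarith [h.one_le]
  have hβ := h.exponent_pos
  -- Dividing `r ≤ R` by `c * m` brings the `ρ`-radius to at most 1, where the density condition is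
  -- assumed; doubling pays for the shrinking.
  set m := max 1 (R / c) with hm
  have hm1 : 1 ≤ m := le_max_left _ _
  have hm0 : 0 < m := by linarith
  refine ⟨ENNReal.ofReal (C * (c * c * m) ^ D) * ENNReal.ofReal A,
    ENNReal.mul_ne_top ENNReal.ofReal_ne_top ENNReal.ofReal_ne_top, fun x hx r hr hrR => ?_⟩
  set r' := (r / (c * m)) ^ β⁻¹ with hr'
  have hr0 : 0 < r' := by positivity
  have hr1 : r' ≤ 1 := by
    refine Real.rpow_le_one (by positivity) ?_ (by positivity)
    rw [div_le_one (by positivity)]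
    have : R / c ≤ m := le_max_right _ _
    rw [div_le_iff₀ hc] at this
    linarith
  have hpow : r' ^ β = r / (c * m) := h.root_pow (by positivity)
  have hcm : 1 ≤ c * c * m := by nlinarith [h.one_le]
  have h1 : μ (ball x r) ≤ ENNReal.ofReal (C * (c * c * m) ^ D) * μ (ball x (r' ^ β / c)) := by
    refine hC.ball_le_ball (by positivity) hcm (le_of_eq ?_)
    rw [hpow, dist_self]
    field_simp
    ring
  have h2 : qball ρ x r' ⊆ ball x r := by
    refine h.qball_subset_ball.trans (ball_subset_ball ?_)
    rw [hpow, mul_div_assoc', mul_div_mul_left _ _ hc.ne']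
    exact div_le_self hr.le hm1
  calc μ (ball x r) ≤ ENNReal.ofReal (C * (c * c * m) ^ D) * μ (ball x (r' ^ β / c)) := h1
    _ ≤ ENNReal.ofReal (C * (c * c * m) ^ D) * (ENNReal.ofReal A * μ (ball x r ∩ Ω)) := by
        gcongr
        refine (measure_mono (h.ball_subset_qball hr0.le)).trans ((hA x hx r' hr0 hr1).trans ?_)
        gcongr
    _ = _ := (mul_assoc _ _ _).symm

end IsSnowflake

end HajlaszExt

/-! ### Fractional gradients and ball gradients -/

namespace HajlaszExt

open Metric

/-! ### Functions on the subset as functions on the whole space vanishing outside it. -/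

section ZeroExt

variable {X : Type*} {Ω : Set X}

/-- The extension of a function on `Ω` by zero. -/
noncomputable def zeroExt (h : Ω → ℝ) : X → ℝ := Function.extend Subtype.val h 0

@[simp]
lemma zeroExt_coe (h : Ω → ℝ) (x : Ω) : zeroExt h x = h x :=
  Subtype.val_injective.extend_apply h 0 x

lemma zeroExt_of_notMem (h : Ω → ℝ) {x : X} (hx : x ∉ Ω) : zeroExt h x = 0 :=
  Function.extend_apply' _ _ _ fun ⟨y, hy⟩ => hx (hy ▸ y.2)

lemma zeroExt_add (u v : Ω → ℝ) : zeroExt (u + v) = zeroExt u + zeroExt v := by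
  ext x
  by_cases hx : x ∈ Ω
  · lift x to Ω using hx
    simp
  · simp [zeroExt_of_notMem _ hx]

lemma zeroExt_smul (a : ℝ) (u : Ω → ℝ) : zeroExt (a • u) = a • zeroExt u := by
  ext x
  by_cases hx : x ∈ Ω
  · lift x to Ω using hx
    simp
  · simp [zeroExt_of_notMem _ hx]

variable [MeasurableSpace X] {μ : Measure X}

lemma measurable_zeroExt (hΩ : MeasurableSet Ω) {h : Ω → ℝ} (hh : Measurable h) :
    Measurable (zeroExt h) :=
  (MeasurableEmbedding.subtype_coe hΩ).measurable_extend hh measurable_const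

lemma eLpNorm_subMeasure (hΩ : MeasurableSet Ω) {F : X → ℝ≥0∞} (hF : ∀ x ∉ Ω, F x = 0)
    (p : ℝ≥0∞) : eLpNorm (fun x : Ω => F x) p (subMeasure μ Ω) = eLpNorm F p μ := by
  have h1 : Ω.indicator F = F := Set.indicator_eq_self.2 fun x hx => by
    by_contra h
    exact hx (hF x h)
  have h2 := (MeasurableEmbedding.subtype_coe hΩ).eLpNorm_map_measure (μ := subMeasure μ Ω)
    (g := F) (p := p)
  rw [subMeasure, map_comap_subtype_coe hΩ] at h2
  rw [← h1, eLpNorm_indicator_eq_eLpNorm_restrict hΩ, h2, h1]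
  rfl

lemma eLpNorm_zeroExt (hΩ : MeasurableSet Ω) (h : Ω → ℝ) (p : ℝ≥0∞) :
    eLpNorm h p (subMeasure μ Ω) = eLpNorm (zeroExt h) p μ := by
  rw [← eLpNorm_enorm, ← eLpNorm_enorm (zeroExt h), ← eLpNorm_subMeasure hΩ]
  · simp
  · intro x hx
    simp [zeroExt_of_notMem h hx]

/-- The pointwise norms of the extension of a sequence by zero. -/
noncomputable def extEnorm (g : ℤ → Ω → ℝ) (k : ℤ) (x : X) : ℝ≥0∞ := ‖zeroExt (g k) x‖ₑ

lemma measurable_extEnorm (hΩ : MeasurableSet Ω) {g : ℤ → Ω → ℝ} (hg : ∀ k, Measurable (g k))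
    (k : ℤ) : Measurable (extEnorm g k) :=
  (measurable_zeroExt hΩ (hg k)).enorm

lemma seqNorm_enorm (q : ℝ≥0∞) (a : ℤ → ℝ) : seqNorm q (fun k => ‖a k‖ₑ) = seqNorm q a :=
  eLpNorm_enorm a

lemma normLpSeq_eq_mixedM (p q : ℝ≥0∞) (g : ℤ → X → ℝ) :
    normLpSeq p q μ g = mixedM p q μ (fun k x => ‖g k x‖ₑ) := by
  simp only [normLpSeq, mixedM, seqNorm_enorm]

lemma normSeqLp_eq_mixedN (p q : ℝ≥0∞) (g : ℤ → X → ℝ) :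
    normSeqLp p q μ g = mixedN p q μ (fun k x => ‖g k x‖ₑ) := by
  simp only [normSeqLp, mixedN, eLpNorm_enorm]

lemma normLpSeq_subMeasure (hΩ : MeasurableSet Ω) (p q : ℝ≥0∞) (g : ℤ → Ω → ℝ) :
    normLpSeq p q (subMeasure μ Ω) g = mixedM p q μ (extEnorm g) := by
  rw [normLpSeq_eq_mixedM, mixedM, mixedM, ← eLpNorm_subMeasure hΩ]
  · simp [extEnorm]
  · intro x hx
    have : (fun k => extEnorm g k x) = fun _ => (0 : ℝ≥0∞) := by
      ext k
      simp [extEnorm, zeroExt_of_notMem _ hx]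
    rw [this]
    simp [seqNorm]

lemma normSeqLp_subMeasure (hΩ : MeasurableSet Ω) (p q : ℝ≥0∞) (g : ℤ → Ω → ℝ) :
    normSeqLp p q (subMeasure μ Ω) g = mixedN p q μ (extEnorm g) := by
  have h1 : ∀ k, eLpNorm (extEnorm g k) p μ = eLpNorm (zeroExt (g k)) p μ :=
    fun k => eLpNorm_enorm _
  simp only [normSeqLp, mixedN, eLpNorm_zeroExt hΩ, h1]

end ZeroExt

/-! ### Ball gradients with prescribed geometric decay. -/

section BallGrad

variable {X : Type*} {l : ℝ} {θ : ℝ≥0} {f : ℤ → X → ℝ≥0∞}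

/-- The ball gradient built from a sequence of pointwise gradients, with decay `θ`. -/
noncomputable def ballGrad (l : ℝ) (θ : ℝ≥0) (f : ℤ → X → ℝ≥0∞) (k : ℤ) (x : X) : ℝ≥0∞ :=
  ⨆ n : ℕ, ENNReal.ofReal (l ^ (-(k + n))) * (θ : ℝ≥0∞)⁻¹ ^ n * f (k + n) x

/-- The factor `θ⁻¹ ^ n` is built in for this: terms of the later supremum reappear in the earlier
one with `m` additional factors `θ⁻¹`. -/
lemma ballGrad_add_le (hθ : θ ≠ 0) (k : ℤ) (m : ℕ) (x : X) :
    ballGrad l θ f (k + m) x ≤ θ ^ m * ballGrad l θ f k x := by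
  unfold ballGrad
  rw [ENNReal.mul_iSup]
  refine iSup_le fun n => le_iSup_of_le (m + n) (le_of_eq ?_)
  have h1 : (θ : ℝ≥0∞) ^ m * (θ : ℝ≥0∞)⁻¹ ^ m = 1 := by
    rw [← mul_pow, ENNReal.mul_inv_cancel (by simpa using hθ) ENNReal.coe_ne_top, one_pow]
  push_cast
  rw [← add_assoc k, pow_add]
  calc _ = (θ : ℝ≥0∞) ^ m * (θ : ℝ≥0∞)⁻¹ ^ m * (ENNReal.ofReal (l ^ (-(k + m + n))) *
        (θ : ℝ≥0∞)⁻¹ ^ n * f (k + m + n) x) := by rw [h1, one_mul]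
    _ = _ := by ring

/-- The price of the decay: the weighted ball gradient is a geometric convolution of ratio `(l *
θ)⁻¹`, which is bounded when `l * θ > 1`. -/
lemma weighted_ballGrad (hl : 0 < l) (k : ℤ) (x : X) :
    weighted l (ballGrad l θ f) k x =
      ⨆ n : ℕ, (ENNReal.ofReal l⁻¹ * (θ : ℝ≥0∞)⁻¹) ^ n * f (k + 1 * n) x := by
  unfold weighted ballGrad
  rw [ENNReal.mul_iSup]
  refine iSup_congr fun n => ?_
  rw [one_mul, mul_pow, ← mul_assoc, ← mul_assoc, ← ENNReal.ofReal_mul (by positivity),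
    ← zpow_add₀ hl.ne', ← ENNReal.ofReal_pow (by positivity), inv_pow, ← zpow_natCast l,
    ← zpow_neg]
  congr 4
  ring

variable [MeasurableSpace X]

lemma measurable_ballGrad (hf : ∀ k, Measurable (f k)) (k : ℤ) : Measurable (ballGrad l θ f k) :=
  Measurable.iSup fun _ => (hf _).const_mul _

lemma IsMixedNorm.exists_ballGrad_le {μ : Measure X} {p q : ℝ≥0∞} {Φ : (ℤ → X → ℝ≥0∞) → ℝ≥0∞}
    (hΦ : IsMixedNorm μ p q Φ) (hl : 0 < l) (hθ : ENNReal.ofReal l⁻¹ * (θ : ℝ≥0∞)⁻¹ < 1) (N : ℕ) :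
    ∃ K : ℝ≥0∞, K ≠ ∞ ∧ ∀ f : ℤ → X → ℝ≥0∞, (∀ k, Measurable (f k)) →
      Φ (weighted l (fun k => ballGrad l θ f (k - N))) ≤ K * Φ f := by
  obtain ⟨K, hK, hK'⟩ := hΦ.conv 1 _ hθ
  refine ⟨ENNReal.ofReal (l ^ N) * K, ENNReal.mul_ne_top ENNReal.ofReal_ne_top hK,
    fun f hf => ?_⟩
  have h1 : weighted l (fun k => ballGrad l θ f (k - N)) =
      fun k x => ENNReal.ofReal (l ^ N) * weighted l (ballGrad l θ f) (k + -N) x := by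
    ext k x
    simp only [weighted, sub_eq_add_neg]
    rw [← mul_assoc, ← ENNReal.ofReal_mul (by positivity), ← zpow_natCast, ← zpow_add₀ hl.ne']
    congr 3
    ring
  rw [h1]
  refine (hΦ.const_mul _ ENNReal.ofReal_ne_top _).trans ?_
  rw [hΦ.shift (weighted l (ballGrad l θ f)) (-N), mul_assoc]
  refine mul_le_mul' le_rfl (le_trans (le_of_eq ?_) (hK' f hf))
  congr 1
  ext k x
  exact weighted_ballGrad hl k x

end BallGrad

lemma ae_lt_top_of_eLpNorm_ne_top {X : Type*} [MeasurableSpace X] {μ : Measure X} {p : ℝ≥0∞}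
    (h0 : p ≠ 0) (ht : p ≠ ∞) {F : X → ℝ≥0∞}
    (hF : Measurable F) (h : eLpNorm F p μ ≠ ∞) : ∀ᵐ x ∂μ, F x ≠ ∞ := by
  have hp : 0 < p.toReal := ENNReal.toReal_pos h0 ht
  rw [eLpNorm_eq_lintegral_ennreal h0 ht] at h
  have h1 : ∫⁻ x, F x ^ p.toReal ∂μ ≠ ∞ := fun h1 => h (by
    rw [h1, ENNReal.top_rpow_of_pos (by positivity)])
  filter_upwards [ae_lt_top (hF.pow_const _) h1] with x hx hx'
  rw [hx', ENNReal.top_rpow_of_pos hp] at hx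
  exact lt_irrefl _ hx

lemma zpow_rpow_comm (z : ℤ) (β : ℝ) : ((2 : ℝ) ^ z) ^ β = ((2 : ℝ) ^ β) ^ z := by
  rw [← Real.rpow_intCast_mul zero_le_two, mul_comm, Real.rpow_mul_intCast zero_le_two]

/-! ### Conversion between gradients for `ρ` and for the comparable metric. -/

section Transfer

variable {X : Type*} [PseudoMetricSpace X] [MeasurableSpace X] {μ : Measure X} {Ω : Set X}
  {ρ : X → X → ℝ} {β c s : ℝ} {N : ℕ}

/-- Points at metric distance below `b ^ (-k)` lie in some `ρ`-annulus of index at least `k - N`,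
where `N` absorbs the comparison constant, and the gradient of that annulus occurs in the supremum.
-/
lemma IsSnowflake.isBallGradient (h : IsSnowflake ρ β c) (hρ : ∀ x y, ρ x y = 0 → x = y)
    (hN : c ≤ ((2 : ℝ) ^ β) ^ N) (hs : 0 < s) {θ : ℝ≥0} (hθ0 : θ ≠ 0) (hθ1 : θ ≤ 1)
    (hΩ : MeasurableSet Ω) {u : Ω → ℝ} {g : ℤ → Ω → ℝ}
    (hg : g ∈ fracGradients s (subDist ρ Ω) (subMeasure μ Ω) u) :
    ∃ E, μ E = 0 ∧ IsBallGradient Ω ((2 : ℝ) ^ β) (zeroExt u)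
      (fun k => ballGrad ((2 : ℝ) ^ s) θ (extEnorm g) (k - N)) E := by
  obtain ⟨hgm, hg0, E, hE, hgE⟩ := hg
  have hβ := h.exponent_pos
  set b := (2 : ℝ) ^ β with hb
  set l := (2 : ℝ) ^ s with hl
  have hb0 : 0 < b := by positivity
  have hl0 : 0 < l := by positivity
  refine ⟨Subtype.val '' E, ?_, fun k => measurable_ballGrad (measurable_extEnorm hΩ hgm) _,
    fun k n x => ?_, fun k x y hx hy hxE hyE hxy => ?_⟩
  · rwa [subMeasure, (MeasurableEmbedding.subtype_coe hΩ).comap_apply] at hE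
  · rw [add_sub_right_comm]
    refine (ballGrad_add_le hθ0 _ _ _).trans (mul_le_of_le_one_left zero_le ?_)
    exact pow_le_one₀ zero_le (by exact_mod_cast hθ1)
  · lift x to Ω using hx
    lift y to Ω using hy
    rcases (h.nonneg x y).eq_or_lt with h0 | hpos
    · rw [hρ _ _ h0.symm, edist_self]; exact zero_le
    obtain ⟨n, hn1, hn2⟩ := exists_mem_Ico_zpow hpos (one_lt_two : (1 : ℝ) < 2)
    have hlt : ρ x y < (2 : ℝ) ^ ((N : ℤ) - k) := by
      refine (Real.rpow_lt_rpow_iff hpos.le (by positivity) hβ).1 ?_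
      rw [zpow_rpow_comm, sub_eq_add_neg, zpow_add₀ hb0.ne', zpow_natCast]
      calc ρ x y ^ β ≤ c * dist (x : X) y := h.le_dist _ _
        _ < c * b ^ (-k) := mul_lt_mul_of_pos_left hxy (by linarith [h.one_le])
        _ ≤ _ := by gcongr
    have hnk := (zpow_lt_zpow_iff_right₀ (one_lt_two : (1 : ℝ) < 2)).1 (hn1.trans_lt hlt)
    obtain ⟨m, hm⟩ := Int.le.dest (show k - N ≤ -(n + 1) by lia)
    have key := hgE (-(n + 1)) x y (fun h => hxE ⟨x, h, rfl⟩) (fun h => hyE ⟨y, h, rfl⟩)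
      (by rw [show -(-(n + 1)) - 1 = n by ring]; exact hn1) (by rw [neg_neg]; exact hn2)
    have hpow : ρ x y ^ s ≤ l ^ (n + 1) := by
      rw [hl, ← zpow_rpow_comm]
      exact Real.rpow_le_rpow hpos.le hn2.le hs.le
    have hterm : ∀ z : Ω, ENNReal.ofReal (l ^ (n + 1)) * ‖g (-(n + 1)) z‖ₑ ≤
        ballGrad l θ (extEnorm g) (k - N) z := by
      intro z
      refine le_trans ?_ (le_iSup (fun i : ℕ => ENNReal.ofReal (l ^ (-(k - N + i))) *
        (θ : ℝ≥0∞)⁻¹ ^ i * extEnorm g (k - N + i) z) m)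
      simp only [hm, neg_neg]
      rw [extEnorm, zeroExt_coe]
      refine mul_le_mul' (le_mul_of_one_le_right zero_le (one_le_pow₀ ?_)) le_rfl
      exact ENNReal.one_le_inv.2 (by exact_mod_cast hθ1)
    rw [zeroExt_coe, zeroExt_coe]
    refine le_trans ?_ (add_le_add (hterm x) (hterm y))
    rw [← mul_add, Real.enorm_of_nonneg (hg0 _ x), Real.enorm_of_nonneg (hg0 _ y),
      ← ENNReal.ofReal_add (hg0 _ x) (hg0 _ y), ← ENNReal.ofReal_mul (by positivity), edist_dist,
      Real.dist_eq]
    refine ENNReal.ofReal_le_ofReal (key.trans ?_)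
    exact mul_le_mul_of_nonneg_right hpow (add_nonneg (hg0 _ x) (hg0 _ y))

lemma IsSnowflake.exists_fracGradient (h : IsSnowflake ρ β c) (hN : c ≤ ((2 : ℝ) ^ β) ^ N)
    (hs : 0 < s) {p q : ℝ≥0∞} (h0 : p ≠ 0) (ht : p ≠ ∞) {Φ : (ℤ → X → ℝ≥0∞) → ℝ≥0∞}
    (hΦ : IsMixedNorm μ p q Φ) {v : X → ℝ} {H : ℤ → X → ℝ≥0∞} {E : Set X} (hE : μ E = 0)
    (hHm : ∀ k, Measurable (H k)) (hH : ∀ (k : ℤ) x y, x ∉ E → y ∉ E →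
      dist x y < ((2 : ℝ) ^ β) ^ (-k) → edist (v x) (v y) ≤ H k x + H k y)
    (hfin : Φ (weighted ((2 : ℝ) ^ s) H) ≠ ∞) :
    ∃ g ∈ fracGradients s ρ μ v, Φ (fun k x => ‖g k x‖ₑ) ≤
      ENNReal.ofReal (((2 : ℝ) ^ s) ^ (N + 1)) * Φ (weighted ((2 : ℝ) ^ s) H) := by
  have hβ := h.exponent_pos
  set b := (2 : ℝ) ^ β with hb
  set l := (2 : ℝ) ^ s with hl
  have hb0 : 0 < b := by positivity
  have hl0 : 0 < l := by positivity
  have hHfin : ∀ k, ∀ᵐ x ∂μ, H k x ≠ ∞ := fun k => by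
    have h1 := ae_lt_top_of_eLpNorm_ne_top h0 ht ((hHm k).const_mul (ENNReal.ofReal (l ^ k)))
      (ne_top_of_le_ne_top hfin (hΦ.coord (weighted l H) k))
    filter_upwards [h1] with x hx hx'
    rw [hx', ENNReal.mul_top (ENNReal.ofReal_pos.2 (by positivity)).ne'] at hx
    exact hx rfl
  -- On the annulus of index `k` one has `ρ ^ s ≥ l ^ (-k - 1)`, which explains the weight.
  -- Gradients must be real, so the points where some `H k` is infinite, a null set by finiteness of
  -- the norm, join the exceptional set.
  refine ⟨fun k x => (ENNReal.ofReal (l ^ (k + 1)) * H (k - N) x).toReal,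
    ⟨fun k => ((hHm _).const_mul _).ennreal_toReal, fun k x => ENNReal.toReal_nonneg,
      E ∪ {x | ¬ ∀ k, H k x ≠ ∞}, measure_union_null hE (ae_all_iff.2 hHfin),
      fun k x y hx hy hk1 hk2 => ?_⟩, ?_⟩
  · simp only [Set.mem_union, Set.mem_ofPred_eq, not_or, not_not] at hx hy
    have hd : dist x y < b ^ (-(k - N)) := by
      rw [neg_sub, sub_eq_add_neg, zpow_add₀ hb0.ne', zpow_natCast]
      calc dist x y ≤ c * ρ x y ^ β := h.dist_le x y
        _ < c * b ^ (-k) := by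
            refine mul_lt_mul_of_pos_left ?_ (by linarith [h.one_le])
            rw [hb, ← zpow_rpow_comm]
            exact Real.rpow_lt_rpow (h.nonneg x y) hk2 hβ
        _ ≤ _ := by gcongr
    have key := hH (k - N) x y hx.1 hy.1 hd
    rw [edist_dist, Real.dist_eq, ENNReal.ofReal_le_iff_le_toReal
      (ENNReal.add_ne_top.2 ⟨hx.2 _, hy.2 _⟩), ENNReal.toReal_add (hx.2 _) (hy.2 _)] at key
    have hpow : 1 ≤ ρ x y ^ s * l ^ (k + 1) := by
      have h1 : l ^ (-k - 1) ≤ ρ x y ^ s := by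
        rw [hl, ← zpow_rpow_comm]
        exact Real.rpow_le_rpow (by positivity) hk1 hs.le
      calc (1 : ℝ) = l ^ (-k - 1) * l ^ (k + 1) := by
            rw [← zpow_add₀ hl0.ne']; simp
        _ ≤ _ := by gcongr
    simp only [ENNReal.toReal_mul, ENNReal.toReal_ofReal (zpow_nonneg hl0.le _)]
    rw [← mul_add, ← mul_assoc]
    exact key.trans (le_mul_of_one_le_left (by positivity) hpow)
  · have h1 : ∀ k x, ‖(ENNReal.ofReal (l ^ (k + 1)) * H (k - N) x).toReal‖ₑ ≤
        ENNReal.ofReal (l ^ (N + 1)) * weighted l H (k + -N) x := fun k x => by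
      rw [Real.enorm_of_nonneg ENNReal.toReal_nonneg]
      refine ENNReal.ofReal_toReal_le.trans (le_of_eq ?_)
      rw [weighted, ← mul_assoc, ← ENNReal.ofReal_mul (by positivity), ← zpow_natCast,
        ← zpow_add₀ hl0.ne', sub_eq_add_neg]
      congr 3
      push_cast
      ring
    refine (hΦ.mono _ _ h1).trans ((hΦ.const_mul _ ENNReal.ofReal_ne_top _).trans ?_)
    rw [hΦ.shift (weighted l H) (-N)]

end Transfer

end HajlaszExt

/-! ### Extension operators on a space with a comparable metric -/

namespace HajlaszExt

open Metric

lemma IsMixedNorm.eLpNorm_ne_top {X : Type*} [MeasurableSpace X] {μ : Measure X} {p q : ℝ≥0∞}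
    {Φ : (ℤ → X → ℝ≥0∞) → ℝ≥0∞} (hΦ : IsMixedNorm μ p q Φ) {l : ℝ} (hl : 0 < l)
    {W : ℤ → X → ℝ≥0∞} (h : Φ (weighted l W) ≠ ∞) (k : ℤ) : eLpNorm (W k) p μ ≠ ∞ := by
  have h1 : W k = fun x => ENNReal.ofReal (l ^ (-k)) * weighted l W k x := by
    ext x
    rw [weighted, ← mul_assoc, ← ENNReal.ofReal_mul (by positivity), ← zpow_add₀ hl.ne']
    simp
  rw [h1]
  refine ne_top_of_le_ne_top (ENNReal.mul_ne_top ENNReal.ofReal_ne_top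
    (ne_top_of_le_ne_top h (hΦ.coord (weighted l W) k)))
    (eLpNorm_le_const_mul (c := ENNReal.ofReal (l ^ (-k))) ENNReal.ofReal_ne_top (fun x => ?_) p)
  simp

section

variable {X : Type*} [PseudoMetricSpace X] [MeasurableSpace X] {μ : Measure X} {Ω : Set X}
  {pt : ℕ → X} {ρ : X → X → ℝ} {β c s : ℝ} {C D : ℝ} {M : ℝ≥0∞} {R K t : ℝ} {p q : ℝ≥0∞}
  {Φ : (ℤ → X → ℝ≥0∞) → ℝ≥0∞}

variable [OpensMeasurableSpace X]

/-- Bounds for the extension of a function by reference values. -/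
lemma WhitneySetup.exists_extendBy_le (S : WhitneySetup μ Ω pt C D M R K t)
    (h : IsSnowflake ρ β c) (hs : 0 < s) (hsβ : s ≤ β) (hp0 : p ≠ 0) (hp : p ≠ ∞) (hq : q ≠ 0)
    (htp : ENNReal.ofReal t < p) (htq : ENNReal.ofReal t ≤ q) (hΦ : IsMixedNorm μ p q Φ)
    (hend : s = β → q = ∞ ∧ ∀ f : ℤ → X → ℝ≥0∞, Φ (fun k x => ⨆ n : ℕ, f (k - n) x) ≤ Φ f)
    (hnull : μ (closure Ω \ Ω) = 0) {A₀ : ℝ≥0∞} (hA₀ : A₀ ≠ ∞) :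
    ∃ A : ℝ≥0∞, A ≠ ∞ ∧ ∀ (u : X → ℝ) (W : ℤ → X → ℝ≥0∞) (E : Set X) (a : ℕ → ℝ), Measurable u →
      IsBallGradient Ω ((2 : ℝ) ^ β) u W E → μ E = 0 →
      IsReference μ Ω pt ((2 : ℝ) ^ β) K t A₀ u W E a → Φ (weighted ((2 : ℝ) ^ s) W) ≠ ∞ →
      eLpNorm u p μ ≠ ∞ → ∃ g ∈ fracGradients s ρ μ (extendBy μ Ω pt a u),
        Φ (fun k x => ‖g k x‖ₑ) + eLpNorm (extendBy μ Ω pt a u) p μ ≤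
          A * (Φ (weighted ((2 : ℝ) ^ s) W) + eLpNorm u p μ) := by
  have hβ := h.exponent_pos
  set b := (2 : ℝ) ^ β with hb
  set l := (2 : ℝ) ^ s with hl
  have hb1 : 1 < b := Real.one_lt_rpow one_lt_two hβ
  have hl1 : 1 < l := Real.one_lt_rpow one_lt_two hs
  have hlb : l ≤ b := Real.rpow_le_rpow_of_exponent_le one_le_two hsβ
  have hinj : l = b → s = β := fun h =>
    (Real.strictMono_rpow_of_base_gt_one one_lt_two).injective h
  obtain ⟨N, hN⟩ := pow_unbounded_of_one_lt (300 * b) hb1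
  obtain ⟨N₀, hN₀⟩ := pow_unbounded_of_one_lt c hb1
  obtain ⟨A₁, hA₁, hA₁'⟩ := S.exists_norm_le hp hq htp htq hΦ hl1 hlb (fun h => (hend (hinj h)).1)
    (fun h => (hend (hinj h)).2) N
  have hav : avgConst C D M K t ≠ ∞ := by
    have := S.exponent_pos
    exact ENNReal.rpow_ne_top_of_nonneg (by positivity)
      (ENNReal.mul_ne_top ENNReal.ofReal_ne_top S.density_ne_top)
  have hc₁ : 1 + (2 * A₀ + 1) * avgConst C D M K t ≠ ∞ :=
    ENNReal.add_ne_top.2 ⟨ENNReal.one_ne_top, ENNReal.mul_ne_top (ENNReal.add_ne_top.2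
      ⟨ENNReal.mul_ne_top ENNReal.ofNat_ne_top hA₀, ENNReal.one_ne_top⟩) hav⟩
  have hc₂ : extConst C D M K t A₀ ≠ ∞ := by
    refine ENNReal.mul_ne_top ENNReal.ofNat_ne_top (ENNReal.mul_ne_top ?_ hc₁)
    exact ENNReal.add_ne_top.2 ⟨ENNReal.one_ne_top,
      ENNReal.mul_ne_top ENNReal.ofNat_ne_top ENNReal.ofReal_ne_top⟩
  set c₁ := 1 + (2 * A₀ + 1) * avgConst C D M K t
  set c₂ := extConst C D M K t A₀
  set c₃ := ENNReal.ofReal (l ^ (N₀ + 1)) with hc₃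
  refine ⟨c₃ * (c₂ * A₁) + c₁ * A₁, ENNReal.add_ne_top.2 ⟨ENNReal.mul_ne_top ENNReal.ofReal_ne_top
    (ENNReal.mul_ne_top hc₂ hA₁), ENNReal.mul_ne_top hc₁ hA₁⟩,
    fun u W E a hu hW hE ha hfin hup => ?_⟩
  obtain ⟨hsize, hgrad⟩ := hA₁' u W hu hW.measurable
  set T := Φ (weighted l W) + eLpNorm u p μ with hT
  have hTt : T ≠ ∞ := ENNReal.add_ne_top.2 ⟨hfin, hup⟩
  have hv : eLpNorm (extendBy μ Ω pt a u) p μ ≤ c₁ * A₁ * T := by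
    rw [mul_assoc]
    refine (eLpNorm_le_const_mul hc₁ (g := extSize μ Ω pt K t N u W) (fun x => ?_) p).trans
      (mul_le_mul' le_rfl hsize)
    exact ha.enorm_extendBy_le hW hu S hE (N := N) (by linarith) x
  have hH : Φ (weighted l fun k x => c₂ * extGrad μ Ω pt b K t N u W k x) ≤ c₂ * A₁ * T := by
    have : (weighted l fun k x => c₂ * extGrad μ Ω pt b K t N u W k x) =
        fun k x => c₂ * weighted l (extGrad μ Ω pt b K t N u W) k x := by
      ext k x
      simp only [weighted]
      ring
    rw [this, mul_assoc]
    exact (hΦ.const_mul _ hc₂ _).trans (mul_le_mul' le_rfl hgrad)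
  obtain ⟨g, hg, hgΦ⟩ := h.exists_fracGradient (s := s) hN₀.le hs hp0 hp hΦ
    (v := extendBy μ Ω pt a u) (H := fun k x => c₂ * extGrad μ Ω pt b K t N u W k x)
    (E := E ∪ (closure Ω \ Ω)) (measure_union_null hE hnull)
    (fun k => (measurable_extGrad S.dense S.measurableSet hu N hW.measurable b k).const_mul _)
    (fun k x y hx hy hxy => by
      have hloc : ∀ z, z ∉ E ∪ (closure Ω \ Ω) → z ∈ Ω ∨ 0 < infDist z Ω := fun z hz => by
        by_contra hz'
        rw [not_or, not_lt] at hz'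
        refine hz (Or.inr ⟨?_, hz'.1⟩)
        rw [mem_closure_iff_infDist_zero S.nonempty]
        exact le_antisymm hz'.2 infDist_nonneg
      rw [← mul_add]
      exact ha.edist_extendBy_le hW hu S hE hb1 hN.le (fun h => hx (Or.inl h))
        (fun h => hy (Or.inl h)) (hloc x hx) (hloc y hy) hxy)
    (ne_top_of_le_ne_top (ENNReal.mul_ne_top (ENNReal.mul_ne_top hc₂ hA₁) hTt) hH)
  refine ⟨g, hg, ?_⟩
  rw [add_mul]
  refine add_le_add (hgΦ.trans ?_) hv
  rw [mul_assoc]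
  exact mul_le_mul' le_rfl hH

end

lemma exists_exponent {a b : ℝ≥0∞} (h : a < b) :
    ∃ t : ℝ, 0 < t ∧ a < ENNReal.ofReal t ∧ ENNReal.ofReal t < b := by
  obtain ⟨r, h1, h2⟩ := ENNReal.lt_iff_exists_nnreal_btwn.1 h
  refine ⟨r, ?_, by simpa using h1, by simpa using h2⟩
  have : (0 : ℝ≥0∞) < r := lt_of_le_of_lt zero_le h1
  exact_mod_cast this

section

variable {X : Type*} [PseudoMetricSpace X] [MeasurableSpace X] {μ : Measure X} {Ω : Set X}
  {ρ : X → X → ℝ} {β c s Q : ℝ} {p q : ℝ≥0∞} {Φ : (ℤ → X → ℝ≥0∞) → ℝ≥0∞}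

lemma IsSnowflake.exists_whitneySetup (h : IsSnowflake ρ β c) (hX : IsQuasiMetricMeasureSpace ρ μ)
    (hreg : IsBorelRegular ρ μ) (hQ : 0 < Q) (hd : IsQDoubling Q ρ μ) (hΩ : MeasurableSet Ω)
    (hne : Ω.Nonempty) (hdens : MeasureDensity ρ μ Ω) {R K t : ℝ} (hR : 8 ≤ R) (hK : 3 ≤ K)
    (ht : 0 < t) : ∃ (pt : ℕ → X) (C : ℝ) (M : ℝ≥0∞), WhitneySetup μ Ω pt C (Q / β) M R K t ∧
      μ (closure Ω \ Ω) = 0 := by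
  have := h.opensMeasurableSpace hX
  obtain ⟨C, hC⟩ := h.exists_isDoublingSpace hX hQ hd
  obtain ⟨M, hM, hM'⟩ := h.exists_hasDensity hC hdens (R := R)
  have := hC.secondCountable
  have : Nonempty X := ⟨hne.some⟩
  refine ⟨TopologicalSpace.denseSeq X, C, M, ⟨hC, hM', hM, hΩ, hne,
    TopologicalSpace.denseRange_denseSeq X, hR, ht, hK⟩, ?_⟩
  refine measure_closure_diff_eq_zero hC hM' hM (by linarith) hΩ fun A hA => ?_
  have := hreg A hA
  rwa [h.qtopology_eq] at this

/-- Extension of a single function, with control of the norms. -/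
lemma IsSnowflake.exists_extension (h : IsSnowflake ρ β c) (hX : IsQuasiMetricMeasureSpace ρ μ)
    (hreg : IsBorelRegular ρ μ) (hQ : 0 < Q) (hd : IsQDoubling Q ρ μ) (hs : 0 < s) (hsβ : s ≤ β)
    (hp0 : p ≠ 0) (hp : p ≠ ∞) (hq : q ≠ 0) (hΦ : IsMixedNorm μ p q Φ)
    (hend : s = β → q = ∞ ∧ ∀ f : ℤ → X → ℝ≥0∞, Φ (fun k x => ⨆ n : ℕ, f (k - n) x) ≤ Φ f)
    (hΩ : MeasurableSet Ω) (hne : Ω.Nonempty) (hdens : MeasureDensity ρ μ Ω) :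
    ∃ A : ℝ≥0∞, A ≠ ∞ ∧ ∀ (u : Ω → ℝ) (g : ℤ → Ω → ℝ), Measurable u →
      g ∈ fracGradients s (subDist ρ Ω) (subMeasure μ Ω) u → Φ (extEnorm g) ≠ ∞ →
      eLpNorm u p (subMeasure μ Ω) ≠ ∞ → ∃ v : X → ℝ, Measurable v ∧ (∀ x : Ω, v x = u x) ∧
        ∃ g' ∈ fracGradients s ρ μ v, Φ (fun k x => ‖g' k x‖ₑ) + eLpNorm v p μ ≤
          A * (Φ (extEnorm g) + eLpNorm u p (subMeasure μ Ω)) := by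
  have := h.opensMeasurableSpace hX
  have hβ := h.exponent_pos
  obtain ⟨t, ht, -, htpq⟩ := exists_exponent
    (show (0 : ℝ≥0∞) < min p q from lt_min (pos_iff_ne_zero.2 hp0) (pos_iff_ne_zero.2 hq))
  obtain ⟨pt, C, M, S, hnull⟩ := h.exists_whitneySetup hX hreg hQ hd hΩ hne hdens (R := 8) (K := 3)
    le_rfl le_rfl ht
  have hb1 : 1 < (2 : ℝ) ^ β := Real.one_lt_rpow one_lt_two hβ
  have hl1 : 1 < (2 : ℝ) ^ s := Real.one_lt_rpow one_lt_two hs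
  obtain ⟨N, hN⟩ := pow_unbounded_of_one_lt c hb1
  obtain ⟨A, hA, hA'⟩ := S.exists_extendBy_le h hs hsβ hp0 hp hq
    (htpq.trans_le (min_le_left _ _)) (htpq.le.trans (min_le_right _ _)) hΦ hend hnull
    (A₀ := 1) ENNReal.one_ne_top
  -- Pointwise reference values need monotonicity of the ball gradient but no decay, so `θ = 1` and
  -- no lower bound on `t` appears.
  obtain ⟨B, hB, hB'⟩ := hΦ.exists_ballGrad_le (l := (2 : ℝ) ^ s) (θ := 1) (by positivity) (by
    rw [ENNReal.coe_one, inv_one, mul_one, ENNReal.ofReal_lt_one]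
    exact inv_lt_one_of_one_lt₀ hl1) N
  refine ⟨A * (B + 1), ENNReal.mul_ne_top hA (ENNReal.add_ne_top.2 ⟨hB, ENNReal.one_ne_top⟩),
    fun u g hu hg hgfin hufin => ?_⟩
  obtain ⟨E, hE, hW⟩ := h.isBallGradient (fun x y => (hX.quasiMetric.eq_zero_iff x y).1) hN.le hs
    one_ne_zero le_rfl hΩ hg
  obtain ⟨a, ha⟩ := exists_isReference S hb1 hW hE
  have hu' := measurable_zeroExt hΩ hu
  have hWΦ := hB' (extEnorm g) (measurable_extEnorm hΩ hg.1)
  rw [eLpNorm_zeroExt hΩ] at hufin ⊢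
  obtain ⟨g', hg', hg'Φ⟩ := hA' (zeroExt u) _ E a hu' hW hE ha
    (ne_top_of_le_ne_top (ENNReal.mul_ne_top hB hgfin) hWΦ) hufin
  refine ⟨_, S.measurable_extendBy hu' a, fun x => ?_, g', hg', hg'Φ.trans ?_⟩
  · rw [extendBy, if_pos x.2, zeroExt_coe]
  · rw [mul_assoc]
    refine mul_le_mul' le_rfl ?_
    rw [mul_add]
    refine add_le_add (hWΦ.trans (mul_le_mul' le_self_add le_rfl)) ?_
    exact le_mul_of_one_le_left zero_le le_add_self

/-- Linear extension, with control of the norms. -/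
lemma IsSnowflake.exists_linear_extension (h : IsSnowflake ρ β c)
    (hX : IsQuasiMetricMeasureSpace ρ μ) (hreg : IsBorelRegular ρ μ) (hQ : 0 < Q)
    (hd : IsQDoubling Q ρ μ) (hs : 0 < s) (hsβ : s ≤ β) (hp : p ≠ ∞)
    (hpQ : ENNReal.ofReal (Q / (Q + s)) < p) (hqQ : ENNReal.ofReal (Q / (Q + s)) < q)
    (hΦ : IsMixedNorm μ p q Φ)
    (hend : s = β → q = ∞ ∧ ∀ f : ℤ → X → ℝ≥0∞, Φ (fun k x => ⨆ n : ℕ, f (k - n) x) ≤ Φ f)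
    (hΩ : MeasurableSet Ω) (hne : Ω.Nonempty) (hdens : MeasureDensity ρ μ Ω) :
    ∃ (L : (Ω → ℝ) → X → ℝ) (A : ℝ≥0∞), A ≠ ∞ ∧ (∀ u (x : Ω), L u x = u x) ∧
      (∀ (a : ℝ) u, L (a • u) = a • L u) ∧
      (∀ (u v : Ω → ℝ) (g g' : ℤ → Ω → ℝ), Measurable u → Measurable v →
        g ∈ fracGradients s (subDist ρ Ω) (subMeasure μ Ω) u →
        g' ∈ fracGradients s (subDist ρ Ω) (subMeasure μ Ω) v → Φ (extEnorm g) ≠ ∞ →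
        Φ (extEnorm g') ≠ ∞ → eLpNorm u p (subMeasure μ Ω) ≠ ∞ →
        eLpNorm v p (subMeasure μ Ω) ≠ ∞ → L (u + v) = L u + L v) ∧
      ∀ (u : Ω → ℝ) (g : ℤ → Ω → ℝ), Measurable u →
        g ∈ fracGradients s (subDist ρ Ω) (subMeasure μ Ω) u → Φ (extEnorm g) ≠ ∞ →
        eLpNorm u p (subMeasure μ Ω) ≠ ∞ → Measurable (L u) ∧
        ∃ g' ∈ fracGradients s ρ μ (L u), Φ (fun k x => ‖g' k x‖ₑ) + eLpNorm (L u) p μ ≤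
          A * (Φ (extEnorm g) + eLpNorm u p (subMeasure μ Ω)) := by
  have := h.opensMeasurableSpace hX
  have hβ := h.exponent_pos
  have hp0 : p ≠ 0 := (lt_of_le_of_lt zero_le hpQ).ne'
  have hq0 : q ≠ 0 := (lt_of_le_of_lt zero_le hqQ).ne'
  have hQs : Q / (Q + s) < 1 := (div_lt_one (by positivity)).2 (by linarith)
  obtain ⟨t, ht, htQ, htpq⟩ := exists_exponent
    (show ENNReal.ofReal (Q / (Q + s)) < min (min p q) 1 from
      lt_min (lt_min hpQ hqQ) (ENNReal.ofReal_lt_one.2 hQs))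
  have ht1 : t < 1 := ENNReal.ofReal_lt_one.1 (htpq.trans_le (min_le_right _ _))
  have htp : ENNReal.ofReal t < p :=
    htpq.trans_le ((min_le_left _ _).trans (min_le_left _ _))
  have htq : ENNReal.ofReal t ≤ q :=
    htpq.le.trans ((min_le_left _ _).trans (min_le_right _ _))
  have htQ' : Q / (Q + s) < t := (ENNReal.ofReal_lt_ofReal_iff ht).1 htQ
  set b := (2 : ℝ) ^ β with hb
  have hb1 : 1 < b := Real.one_lt_rpow one_lt_two hβ
  obtain ⟨pt, C, M, S, hnull⟩ := h.exists_whitneySetup hX hreg hQ hd hΩ hne hdens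
    (R := max 8 (3 * b)) (K := 3 + 3 * b) (le_max_left _ _) (by linarith) ht
  obtain ⟨N, hN⟩ := pow_unbounded_of_one_lt c hb1
  -- The choice gives `η ^ t = 2 ^ Q = b ^ D` with `D = Q / β`, the cost of shrinking a ball by `b`;
  -- then `θ` is determined by `θ * η = η ^ t`.
  set η : ℝ≥0 := 2 ^ (Q / t) with hη
  set θ : ℝ≥0 := 2 ^ (Q - Q / t) with hθ
  have h2 : (2 : ℝ≥0) ≠ 0 := two_ne_zero
  have hθ0 : θ ≠ 0 := (NNReal.rpow_pos (by norm_num)).ne'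
  have hηt : η ^ t = 2 ^ Q := by
    rw [hη, ← NNReal.rpow_mul, div_mul_cancel₀ _ ht.ne']
  have hθη : θ * η = 2 ^ Q := by
    rw [hη, hθ, ← NNReal.rpow_add h2, sub_add_cancel]
  have hθ1 : θ ≤ 1 := by
    refine NNReal.rpow_le_one_of_one_le_of_nonpos one_le_two ?_
    have : Q ≤ Q / t := by rw [le_div_iff₀ ht]; nlinarith
    linarith
  have hQ1 : (1 : ℝ) < 2 ^ Q := Real.one_lt_rpow one_lt_two hQ
  set σ : ℝ≥0∞ := ENNReal.ofReal (((2 : ℝ) ^ Q - 1)⁻¹) with hσ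
  have hθη' : (θ : ℝ≥0∞) * η = ENNReal.ofReal (2 ^ Q) := by
    rw [← ENNReal.coe_mul, hθη, ENNReal.ofReal]
    congr 1
    ext
    rw [Real.coe_toNNReal _ (by positivity)]
    simp
  have T : ChainSetup μ Ω pt C (Q / β) M (max 8 (3 * b)) b t η θ σ := by
    refine ⟨S, ht1.le, hb1, le_max_right _ _, NNReal.one_lt_rpow one_lt_two (by positivity),
      by rw [hθη, hηt], ?_, ENNReal.ofReal_ne_top, ?_⟩
    · rw [← NNReal.coe_rpow, hηt, hb, ← Real.rpow_mul zero_le_two, mul_div_cancel₀ _ hβ.ne']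
      simp
    · have h0 : (2 : ℝ) ^ Q - 1 ≠ 0 := by linarith
      have h0' : 0 ≤ ((2 : ℝ) ^ Q - 1)⁻¹ := inv_nonneg.2 (by linarith)
      rw [hθη', hσ, ← ENNReal.ofReal_one, ← ENNReal.ofReal_add h0' zero_le_one,
        ← ENNReal.ofReal_mul h0']
      refine ENNReal.ofReal_le_ofReal (le_of_eq ?_)
      field_simp
      ring
  obtain ⟨A, hA, hA'⟩ := S.exists_extendBy_le h hs hsβ hp0 hp hq0 htp htq hΦ hend hnull
    (oscConst_ne_top (C := C) (D := Q / β) (b := b) (η := η) ht S.density_ne_top T.sigma_ne_top)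
  -- This is where the threshold enters: `(l * θ)⁻¹ = 2 ^ (Q / t - Q - s)` is less than 1 exactly
  -- when `t > Q / (Q + s)`.
  obtain ⟨B, hB, hB'⟩ := hΦ.exists_ballGrad_le (l := (2 : ℝ) ^ s) (θ := θ) (by positivity) (by
    rw [← ENNReal.coe_inv hθ0, ENNReal.ofReal, ← ENNReal.coe_mul, ← ENNReal.coe_one,
      ENNReal.coe_lt_coe, ← NNReal.coe_lt_coe]
    rw [NNReal.coe_mul, Real.coe_toNNReal _ (by positivity), NNReal.coe_inv, hθ, NNReal.coe_rpow,
      NNReal.coe_ofNat, NNReal.coe_one, ← Real.rpow_neg zero_le_two, ← Real.rpow_neg zero_le_two,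
      ← Real.rpow_add zero_lt_two]
    refine Real.rpow_lt_one_of_one_lt_of_neg one_lt_two ?_
    rw [div_lt_iff₀ (by positivity)] at htQ'
    have : Q / t < Q + s := by rw [div_lt_iff₀ ht]; linarith
    linarith) N
  have htame : ∀ (u : Ω → ℝ) (g : ℤ → Ω → ℝ), Measurable u →
      g ∈ fracGradients s (subDist ρ Ω) (subMeasure μ Ω) u → Φ (extEnorm g) ≠ ∞ →
      eLpNorm u p (subMeasure μ Ω) ≠ ∞ → ∃ E, IsTame μ Ω b θ p (zeroExt u)
        (fun k => ballGrad ((2 : ℝ) ^ s) θ (extEnorm g) (k - N)) E := by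
    intro u g hu hg hgfin hufin
    obtain ⟨E, hE, hW⟩ := h.isBallGradient (fun x y => (hX.quasiMetric.eq_zero_iff x y).1) hN.le hs
      hθ0 hθ1 hΩ hg
    rw [eLpNorm_zeroExt hΩ] at hufin
    refine ⟨E, measurable_zeroExt hΩ hu, hW, hE, fun k n x => ?_, hufin, hΦ.eLpNorm_ne_top
      (l := (2 : ℝ) ^ s) (by positivity) (ne_top_of_le_ne_top (ENNReal.mul_ne_top hB hgfin)
        (hB' (extEnorm g) (measurable_extEnorm hΩ hg.1)))⟩
    rw [add_sub_right_comm]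
    exact ballGrad_add_le hθ0 _ _ _
  refine ⟨fun u => extendBy μ Ω pt (meanRef μ Ω pt (zeroExt u)) (zeroExt u), A * (B + 1),
    ENNReal.mul_ne_top hA (ENNReal.add_ne_top.2 ⟨hB, ENNReal.one_ne_top⟩), fun u x => ?_,
    fun a u => ?_, fun u v g g' hu hv hg hg' hgfin hgfin' hufin hvfin => ?_,
    fun u g hu hg hgfin hufin => ?_⟩ <;> beta_reduce
  · rw [extendBy, if_pos x.2, zeroExt_coe]
  · rw [zeroExt_smul]
    exact extendBy_meanRef_smul a _
  · obtain ⟨E, hE⟩ := htame u g hu hg hgfin hufin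
    obtain ⟨E', hE'⟩ := htame v g' hv hg' hgfin' hvfin
    rw [zeroExt_add]
    exact extendBy_meanRef_add T hp htp hE hE'
  · obtain ⟨E, hE⟩ := htame u g hu hg hgfin hufin
    have hWΦ := hB' (extEnorm g) (measurable_extEnorm hΩ hg.1)
    obtain ⟨g', hg', hg'Φ⟩ := hA' (zeroExt u) _ E _ hE.measurable hE.ballGradient hE.null
      (hE.isReference T) (ne_top_of_le_ne_top (ENNReal.mul_ne_top hB hgfin) hWΦ) hE.norm_ne_top
    refine ⟨S.measurable_extendBy hE.measurable _, g', hg', hg'Φ.trans ?_⟩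
    rw [mul_assoc, eLpNorm_zeroExt hΩ]
    refine mul_le_mul' le_rfl ?_
    rw [mul_add]
    refine add_le_add (hWΦ.trans (mul_le_mul' le_self_add le_rfl)) ?_
    exact le_mul_of_one_le_left zero_le le_add_self

end

end HajlaszExt

/-! ### Extension and restriction theorems -/

namespace HajlaszExt

lemma enorm_zeroExt_domRestrict_le {X : Type*} {Ω : Set X} (v : X → ℝ) (x : X) :
    ‖zeroExt (Ω.domRestrict v) x‖ₑ ≤ ‖v x‖ₑ := by
  by_cases hx : x ∈ Ω
  · lift x to Ω using hx
    rw [zeroExt_coe]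
    rfl
  · simp [zeroExt_of_notMem _ hx]

section

variable {X : Type*} [MeasurableSpace X] {μ : Measure X} {Ω : Set X} {ρ : X → X → ℝ} {s : ℝ}
  {p q : ℝ≥0∞} {Φ : (ℤ → X → ℝ≥0∞) → ℝ≥0∞}

lemma domRestrict_mem_fracGradients (hΩ : MeasurableSet Ω) {v : X → ℝ} {g : ℤ → X → ℝ}
    (hg : g ∈ fracGradients s ρ μ v) :
    (fun k => Ω.domRestrict (g k)) ∈
      fracGradients s (subDist ρ Ω) (subMeasure μ Ω) (Ω.domRestrict v) := by
  obtain ⟨hgm, hg0, E, hE, hgE⟩ := hg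
  refine ⟨fun k => (hgm k).comp measurable_subtype_coe, fun k x => hg0 k x, Subtype.val ⁻¹' E, ?_,
    fun k x y hx hy h1 h2 => hgE k x y hx hy h1 h2⟩
  rw [subMeasure, (MeasurableEmbedding.subtype_coe hΩ).comap_apply]
  exact measure_mono_null (Set.image_preimage_subset _ _) hE

/-- The homogeneous seminorm on `Ω` associated with a mixed norm on `X`. -/
noncomputable def homNormOn (Φ : (ℤ → X → ℝ≥0∞) → ℝ≥0∞) (s : ℝ) (ρ : X → X → ℝ) (μ : Measure X)
    (Ω : Set X) (u : Ω → ℝ) : ℝ≥0∞ :=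
  ⨅ g ∈ fracGradients s (subDist ρ Ω) (subMeasure μ Ω) u, Φ (extEnorm g)

/-- The homogeneous seminorm associated with a mixed norm. -/
noncomputable def homNorm (Φ : (ℤ → X → ℝ≥0∞) → ℝ≥0∞) (s : ℝ) (ρ : X → X → ℝ) (μ : Measure X)
    (v : X → ℝ) : ℝ≥0∞ :=
  ⨅ g ∈ fracGradients s ρ μ v, Φ (fun k x => ‖g k x‖ₑ)

lemma homNormOn_domRestrict_le (hΦ : IsMixedNorm μ p q Φ) (hΩ : MeasurableSet Ω) (v : X → ℝ) :
    homNormOn Φ s ρ μ Ω (Ω.domRestrict v) ≤ homNorm Φ s ρ μ v :=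
  le_iInf₂ fun g hg => (iInf₂_le _ (domRestrict_mem_fracGradients hΩ hg)).trans
    (hΦ.mono _ _ fun k x => enorm_zeroExt_domRestrict_le (g k) x)

/-- The zero sequence is a gradient off the null set where `v` does not vanish. This settles the
degenerate case in which no near-optimal gradient can be selected with strict inequality. -/
lemma homNorm_eq_zero (hp : p ≠ 0) (hΦ : IsMixedNorm μ p q Φ) {v : X → ℝ}
    (hv : Measurable v) (h : eLpNorm v p μ = 0) : homNorm Φ s ρ μ v = 0 := by
  have h1 := (eLpNorm_eq_zero_iff hv.aestronglyMeasurable hp).1 h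
  have h2 : (0 : ℤ → X → ℝ) ∈ fracGradients s ρ μ v := by
    refine ⟨fun _ => measurable_const, fun _ _ => le_rfl, {x | v x ≠ 0}, h1,
      fun k x y hx hy _ _ => ?_⟩
    have hx' : v x = 0 := not_not.1 hx
    have hy' : v y = 0 := not_not.1 hy
    simp [hx', hy']
  refine le_antisymm ((iInf₂_le _ h2).trans ?_) zero_le
  have h3 := hΦ.single (fun _ => 0) (fun _ => 0) (by simp [seqNorm])
  simpa [seqNorm] using h3

/-- The extension theorems for function spaces defined by a mixed norm. -/
theorem extension_restriction [Nontrivial X] (hX : IsQuasiMetricMeasureSpace ρ μ)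
    (hreg : IsBorelRegular ρ μ) {Q : ℝ} (hQ : 0 < Q) (hdoub : IsQDoubling Q ρ μ) (hs : 0 < s)
    (hp : 0 < p) (hp' : p < ∞) (hq : 0 < q) (hsq : SmoothnessAdmissible s q ρ)
    (hΩne : Ω.Nonempty) (hΩ : MeasurableSet Ω) (hdens : MeasureDensity ρ μ Ω)
    (hΦ : IsMixedNorm μ p q Φ)
    (hend : (q = ∞ ∧ ∀ f : ℤ → X → ℝ≥0∞, Φ (fun k x => ⨆ n : ℕ, f (k - n) x) ≤ Φ f) ∨
      ENNReal.ofReal s < lowerIndex ρ)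
    (VΩ : Submodule ℝ (Ω → ℝ)) (VX : Submodule ℝ (X → ℝ)) (nΩ : (Ω → ℝ) → ℝ≥0∞)
    (nX : (X → ℝ) → ℝ≥0∞)
    (hVΩ : ∀ u, u ∈ VΩ ↔ Measurable u ∧ homNormOn Φ s ρ μ Ω u < ∞ ∧
      eLpNorm u p (subMeasure μ Ω) < ∞)
    (hVX : ∀ v, v ∈ VX ↔ Measurable v ∧ homNorm Φ s ρ μ v < ∞ ∧ eLpNorm v p μ < ∞)
    (hnΩ : ∀ u, nΩ u = homNormOn Φ s ρ μ Ω u + eLpNorm u p (subMeasure μ Ω))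
    (hnX : ∀ v, nX v = homNorm Φ s ρ μ v + eLpNorm v p μ) :
    (∃ C : ℝ, 0 < C ∧ ∀ u ∈ VΩ, ∃ v ∈ VX, Ω.domRestrict v = u ∧
        nX v ≤ ENNReal.ofReal C * nΩ u) ∧
      (VΩ : Set (Ω → ℝ)) = {u | ∃ v ∈ VX, Ω.domRestrict v = u} ∧
      (ENNReal.ofReal (Q / (Q + s)) < p → ENNReal.ofReal (Q / (Q + s)) < q →
        ∃ E : VΩ →ₗ[ℝ] VX, (∃ C : ℝ, 0 < C ∧ ∀ u, nX (E u) ≤ ENNReal.ofReal C * nΩ u) ∧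
          ∀ u, Ω.domRestrict (E u : X → ℝ) = u) := by
  obtain ⟨ϱ, β, hϱ, hϱe, hβ, hC, hsβ, hsβ', hqβ⟩ := hsq.exists_rpow hs
  obtain ⟨I, c, hc, hcmp⟩ := exists_pseudoMetric_rpow hϱ hϱe hβ hC
  have h : IsSnowflake ρ β c :=
    ⟨hX.quasiMetric.nonneg, hβ, hc, fun x y => (hcmp x y).1, fun x y => (hcmp x y).2⟩
  have hend' : s = β → q = ∞ ∧ ∀ f : ℤ → X → ℝ≥0∞,
      Φ (fun k x => ⨆ n : ℕ, f (k - n) x) ≤ Φ f := fun hse =>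
    hend.elim id fun hlt => absurd hse (hsβ' hlt).ne
  have hgood : ∀ u ∈ VΩ, ∃ g ∈ fracGradients s (subDist ρ Ω) (subMeasure μ Ω) u,
      Φ (extEnorm g) ≠ ∞ := fun u hu => by
    have := ((hVΩ u).1 hu).2.1
    simp only [homNormOn, iInf_lt_iff] at this
    obtain ⟨g, hg, hgt⟩ := this
    exact ⟨g, hg, hgt.ne⟩
  have hbound : ∀ {A : ℝ≥0∞}, A ≠ ∞ → ∃ C : ℝ, 0 < C ∧ 2 * A ≤ ENNReal.ofReal C := by
    intro A hA
    refine ⟨(2 * A).toReal + 1, by positivity, ?_⟩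
    rw [ENNReal.ofReal_add ENNReal.toReal_nonneg zero_le_one,
      ENNReal.ofReal_toReal (ENNReal.mul_ne_top ENNReal.ofNat_ne_top hA)]
    exact le_self_add
  have hext : ∃ C : ℝ, 0 < C ∧ ∀ u ∈ VΩ, ∃ v ∈ VX, Ω.domRestrict v = u ∧
      nX v ≤ ENNReal.ofReal C * nΩ u := by
    obtain ⟨A, hA, hA'⟩ := h.exists_extension hX hreg hQ hdoub hs hsβ hp.ne' hp'.ne hq.ne' hΦ
      hend' hΩ hΩne hdens
    obtain ⟨C, hC0, hC⟩ := hbound hA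
    refine ⟨C, hC0, fun u hu => ?_⟩
    obtain ⟨hum, hu1, hu2⟩ := (hVΩ u).1 hu
    by_cases h0 : eLpNorm u p (subMeasure μ Ω) = 0
    · have hm := measurable_zeroExt hΩ hum
      have h1 : eLpNorm (zeroExt u) p μ = 0 := by rw [← eLpNorm_zeroExt hΩ, h0]
      have h2 := homNorm_eq_zero (s := s) (ρ := ρ) hp.ne' hΦ hm h1
      refine ⟨zeroExt u, (hVX _).2 ⟨hm, by simp [h2], by simp [h1]⟩,
        funext fun x => zeroExt_coe u x, ?_⟩
      rw [hnX, h1, h2, add_zero]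
      exact zero_le
    -- The infimum over gradients need not be attained, but a positive `L^p` norm leaves room for a
    -- gradient below the full norm, at the cost of a factor 2.
    · obtain ⟨g, hg, hgt⟩ : ∃ g ∈ fracGradients s (subDist ρ Ω) (subMeasure μ Ω) u,
          Φ (extEnorm g) < homNormOn Φ s ρ μ Ω u + eLpNorm u p (subMeasure μ Ω) := by
        have := ENNReal.lt_add_right hu1.ne h0
        conv_lhs at this => rw [homNormOn]
        simp only [iInf_lt_iff, exists_prop] at this
        exact this
      obtain ⟨v, hv, hvu, g', hg', hle⟩ := hA' u g hum hg (hgt.trans_le le_top).ne hu2.ne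
      have hle' : homNorm Φ s ρ μ v + eLpNorm v p μ ≤ ENNReal.ofReal C * nΩ u := by
        calc homNorm Φ s ρ μ v + eLpNorm v p μ
            ≤ A * (Φ (extEnorm g) + eLpNorm u p (subMeasure μ Ω)) :=
              (add_le_add (iInf₂_le g' hg') le_rfl).trans hle
          _ ≤ A * (nΩ u + nΩ u) := by
              rw [hnΩ]
              exact mul_le_mul' le_rfl (add_le_add hgt.le le_add_self)
          _ = 2 * A * nΩ u := by ring
          _ ≤ _ := mul_le_mul' hC le_rfl
      have hfin : homNorm Φ s ρ μ v + eLpNorm v p μ < ∞ :=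
        hle'.trans_lt (ENNReal.mul_lt_top ENNReal.ofReal_lt_top (by
          rw [hnΩ]; exact ENNReal.add_lt_top.2 ⟨hu1, hu2⟩))
      exact ⟨v, (hVX v).2 ⟨hv, ENNReal.add_lt_top.1 hfin⟩, funext hvu, by rwa [hnX]⟩
  refine ⟨hext, ?_, fun hpQ hqQ => ?_⟩
  · ext u
    constructor
    · intro hu
      obtain ⟨C, -, hC⟩ := hext
      obtain ⟨v, hv, hvu, -⟩ := hC u hu
      exact ⟨v, hv, hvu⟩
    · rintro ⟨v, hv, rfl⟩
      obtain ⟨hvm, hv1, hv2⟩ := (hVX v).1 hv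
      refine (hVΩ _).2 ⟨hvm.comp measurable_subtype_coe,
        (homNormOn_domRestrict_le hΦ hΩ v).trans_lt hv1, ?_⟩
      rw [eLpNorm_zeroExt hΩ]
      exact (eLpNorm_mono_enorm (enorm_zeroExt_domRestrict_le v)).trans_lt hv2
  · obtain ⟨L, A, hA, hLΩ, hLs, hLa, hLn⟩ := h.exists_linear_extension hX hreg hQ hdoub hs hsβ
      hp'.ne hpQ hqQ hΦ hend' hΩ hΩne hdens
    obtain ⟨C, hC0, hC⟩ := hbound hA
    have hle : ∀ u ∈ VΩ, homNorm Φ s ρ μ (L u) + eLpNorm (L u) p μ ≤ A * nΩ u := fun u hu => by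
      obtain ⟨hum, hu1, hu2⟩ := (hVΩ u).1 hu
      rw [hnΩ, homNormOn]
      -- In the linear case the extension does not depend on the gradient, so the infimum may be
      -- taken in the bound itself; multiplication by `A` commutes with it for `A ≠ 0`.
      by_cases hA0 : A = 0
      · obtain ⟨g, hg, hgt⟩ := hgood u hu
        obtain ⟨-, g', hg', hle⟩ := hLn u g hum hg hgt hu2.ne
        rw [hA0, zero_mul] at hle ⊢
        exact (add_le_add (iInf₂_le g' hg') le_rfl).trans hle
      rw [ENNReal.iInf_add, ENNReal.mul_iInf_of_ne hA0 hA]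
      refine le_iInf fun g => ?_
      rw [ENNReal.iInf_add, ENNReal.mul_iInf_of_ne hA0 hA]
      refine le_iInf fun hg => ?_
      by_cases hgt : Φ (extEnorm g) = ∞
      · rw [hgt, top_add, ENNReal.mul_top hA0]; exact le_top
      obtain ⟨-, g', hg', hle⟩ := hLn u g hum hg hgt hu2.ne
      exact (add_le_add (iInf₂_le g' hg') le_rfl).trans hle
    have hmem : ∀ u ∈ VΩ, L u ∈ VX := fun u hu => by
      obtain ⟨hum, hu1, hu2⟩ := (hVΩ u).1 hu
      obtain ⟨g, hg, hgt⟩ := hgood u hu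
      refine (hVX _).2 ⟨(hLn u g hum hg hgt hu2.ne).1, ENNReal.add_lt_top.1 ?_⟩
      refine (hle u hu).trans_lt (ENNReal.mul_lt_top hA.lt_top ?_)
      rw [hnΩ]
      exact ENNReal.add_lt_top.2 ⟨hu1, hu2⟩
    refine ⟨{ toFun := fun u => ⟨L u, hmem u u.2⟩, map_add' := ?_, map_smul' := ?_ },
      ⟨C, hC0, fun u => ?_⟩, fun u => funext fun x => hLΩ u x⟩
    · intro u v
      obtain ⟨hum, hu1, hu2⟩ := (hVΩ u).1 u.2
      obtain ⟨hvm, hv1, hv2⟩ := (hVΩ v).1 v.2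
      obtain ⟨g, hg, hgt⟩ := hgood u u.2
      obtain ⟨g', hg', hgt'⟩ := hgood v v.2
      exact Subtype.ext (hLa u v g g' hum hvm hg hg' hgt hgt' hu2.ne hv2.ne)
    · intro a u
      exact Subtype.ext (hLs a u)
    · rw [hnX]
      refine (hle u u.2).trans (mul_le_mul' (le_trans ?_ hC) le_rfl)
      exact le_mul_of_one_le_left zero_le one_le_two

end

end HajlaszExt

theorem mainTheorem1 {X : Type*} [Nontrivial X] [MeasurableSpace X]
    (ρ : X → X → ℝ) (μ : Measure X)
    (hX : IsQuasiMetricMeasureSpace ρ μ) (hreg : IsBorelRegular ρ μ)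
    (Q : ℝ) (hQ : 0 < Q) (hdoub : IsQDoubling Q ρ μ)
    (s : ℝ) (hs : 0 < s) (p q : ℝ≥0∞) (hp : 0 < p) (hp' : p < ∞) (hq : 0 < q)
    (hsq : SmoothnessAdmissible s q ρ)
    (Ω : Set X) (hΩne : Ω.Nonempty) (hΩ : MeasurableSet Ω) (hdens : MeasureDensity ρ μ Ω) :
    -- the Triebel–Lizorkin scale
    ((∃ C : ℝ, 0 < C ∧ ∀ u ∈ spaceM s p q (subDist ρ Ω) (subMeasure μ Ω),
        ∃ v ∈ spaceM s p q ρ μ, Ω.domRestrict v = u ∧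
          normM s p q ρ μ v ≤
            ENNReal.ofReal C * normM s p q (subDist ρ Ω) (subMeasure μ Ω) u) ∧
      (spaceM s p q (subDist ρ Ω) (subMeasure μ Ω) : Set (Ω → ℝ)) =
        {u | ∃ v ∈ spaceM s p q ρ μ, Ω.domRestrict v = u} ∧
      (ENNReal.ofReal (Q / (Q + s)) < p → ENNReal.ofReal (Q / (Q + s)) < q →
        ∃ E : spaceM s p q (subDist ρ Ω) (subMeasure μ Ω) →ₗ[ℝ] spaceM s p q ρ μ,
          (∃ C : ℝ, 0 < C ∧ ∀ u, normM s p q ρ μ (E u) ≤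
            ENNReal.ofReal C * normM s p q (subDist ρ Ω) (subMeasure μ Ω) u) ∧
          ∀ u, Ω.domRestrict (E u : X → ℝ) = u)) ∧
    -- the Besov scale
    (ENNReal.ofReal s < lowerIndex ρ →
      (∃ C : ℝ, 0 < C ∧ ∀ u ∈ spaceN s p q (subDist ρ Ω) (subMeasure μ Ω),
        ∃ v ∈ spaceN s p q ρ μ, Ω.domRestrict v = u ∧
          normN s p q ρ μ v ≤
            ENNReal.ofReal C * normN s p q (subDist ρ Ω) (subMeasure μ Ω) u) ∧
      (spaceN s p q (subDist ρ Ω) (subMeasure μ Ω) : Set (Ω → ℝ)) =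
        {u | ∃ v ∈ spaceN s p q ρ μ, Ω.domRestrict v = u} ∧
      (ENNReal.ofReal (Q / (Q + s)) < p → ENNReal.ofReal (Q / (Q + s)) < q →
        ∃ E : spaceN s p q (subDist ρ Ω) (subMeasure μ Ω) →ₗ[ℝ] spaceN s p q ρ μ,
          (∃ C : ℝ, 0 < C ∧ ∀ u, normN s p q ρ μ (E u) ≤
            ENNReal.ofReal C * normN s p q (subDist ρ Ω) (subMeasure μ Ω) u) ∧
          ∀ u, Ω.domRestrict (E u : X → ℝ) = u)) := by
  have hM := isMixedNorm_mixedM μ (p := p) hq.ne'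
  have hN := isMixedNorm_mixedN μ hp.ne' hp'.ne hq.ne'
  have hMΩ : ∀ u, homNormM s p q (subDist ρ Ω) (subMeasure μ Ω) u =
      homNormOn (mixedM p q μ) s ρ μ Ω u := fun u => by
    simp only [homNormM, homNormOn, normLpSeq_subMeasure hΩ]
  have hMX : ∀ v, homNormM s p q ρ μ v = homNorm (mixedM p q μ) s ρ μ v := fun v => by
    simp only [homNormM, homNorm, normLpSeq_eq_mixedM]
  have hNΩ : ∀ u, homNormN s p q (subDist ρ Ω) (subMeasure μ Ω) u =
      homNormOn (mixedN p q μ) s ρ μ Ω u := fun u => by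
    simp only [homNormN, homNormOn, normSeqLp_subMeasure hΩ]
  have hNX : ∀ v, homNormN s p q ρ μ v = homNorm (mixedN p q μ) s ρ μ v := fun v => by
    simp only [homNormN, homNorm, normSeqLp_eq_mixedN]
  refine ⟨extension_restriction hX hreg hQ hdoub hs hp hp' hq hsq hΩne hΩ hdens hM ?_ _ _ _ _
      (fun u => by rw [← hMΩ]; exact Iff.rfl) (fun v => by rw [← hMX]; exact Iff.rfl)
      (fun u => by rw [← hMΩ]; rfl) (fun v => by rw [← hMX]; rfl),
    fun hlt => extension_restriction hX hreg hQ hdoub hs hp hp' hq hsq hΩne hΩ hdens hN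
      (Or.inr hlt) _ _ _ _
      (fun u => by rw [← hNΩ]; exact Iff.rfl) (fun v => by rw [← hNX]; exact Iff.rfl)
      (fun u => by rw [← hNΩ]; rfl) (fun v => by rw [← hNX]; rfl)⟩
  -- Equality with the index forces `q = ∞`, where `L^p(ℓ^∞)` absorbs the supremum over shifts.
  rcases hsq.1.lt_or_eq with hlt | heq
  · exact Or.inr hlt
  · obtain ⟨rfl, -⟩ := hsq.2 heq
    exact Or.inl ⟨rfl, mixedM_top_iSup_le μ p⟩
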